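/- Let $r,l,n,t,\omega$ be integers with $l\ge 1$, $r\ge 2l$, $n\ge 1$, $t\ge l$ and $0\le\omega\le l$. Put $R=(n-1)(r-l)+t$ and $S=2R-l+\omega$. Call an integer matrix totally non-singular if none of its minors vanishes. An auxiliary matrix of type $(n,t,\omega)_{r,l}$ is an integer $R\times S$ matrix $D=(d_{i,j})=(U,V)$, where $U$ is a diagonal $R\times R$ matrix with non-zero diagonal entries and the $R\times(S-R)$ matrix $V$ is obtained by placing totally non-singular blocks $V_1,\dots,V_n$ into a zero matrix as follows: $V_1$ has format $t\times(t-l+\omega)$ and occupies the upper left corner; for $2\le m\le n$ the block $V_m$ has format $r\times(r-l)$ and its lower right corner is at position $(t+(m-1)(r-l),\ t-l+\omega+(m-1)(r-l))$. (Thus adjacent blocks occupy disjoint sets of columns and share exactly $l$ rows.) For a positive integer $P$ let $g(\eta)=\sum_{x\in\mathbb Z,\,|x|\le P}e^{2\pi i\eta x^3}$, and for an auxiliary matrix $D$ let $$I(P,D)=\int_{[0,1]^R}\ \prod_{j=1}^{R}|g(\theta_j)|^2\prod_{j=R+1}^{S}|g(\theta_j)|^4\,d\boldsymbol\eta,\qquad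 \theta_j=\sum_{i=1}^R d_{i,j}\eta_i .$$ Let $I_{n,t}^{\omega}(P)=\sup_D I(P,D)$, the supremum being taken over all auxiliary matrices $D$ of type $(n,t,\omega)_{r,l}$. Then for every $\varepsilon>0$ there is a constant $K$, depending only on $r,l,n,t,\omega,\varepsilon$, such that for all integers $P\ge 1$ the supremum is finite and $$I_{n,t}^{\omega}(P)\le K\,P^{3((n-1)(r-l)+t+\omega)-2l+\varepsilon}.$$ -/

import Mathlib

open scoped BigOperators

namespace CubicAux

/-- A matrix is totally non-singular if none of its minors vanishes. A minor is the determinant of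
the square submatrix cut out by increasing selections of `k` rows and `k` columns
(for `k = 0` it is `1`). -/
def IsTotallyNonsingular {α β : Type*} [Preorder α] [Preorder β] (A : Matrix α β ℤ) : Prop :=
  ∀ (k : ℕ) (f : Fin k ↪o α) (g : Fin k ↪o β), (A.submatrix f g).det ≠ 0

/-- Rows (counted from `0`) met by the `m`-th block (counted from `0`) of a linked-block matrix
whose blocks have their lower right corners after `i m` rows. The block `0` has height `i 0`; the
block `m + 1` has height `i (m + 1) - i m + l`, so it shares `l` linking rows with the previous
block. -/
def blockRows (l : ℕ) (i : ℕ → ℕ) : ℕ → Finset ℕ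
  | 0 => Finset.Ico 0 (i 0)
  | m + 1 => Finset.Ico (i m - l) (i (m + 1))

/-- Columns (counted from `0`) met by the `m`-th block of a linked-block matrix whose blocks have
their lower right corners after `j m` columns; the block `m + 1` has width `j (m + 1) - j m`. -/
def blockCols (j : ℕ → ℕ) : ℕ → Finset ℕ
  | 0 => Finset.Ico 0 (j 0)
  | m + 1 => Finset.Ico (j m) (j (m + 1))

/-- The `m`-th block of `V`, as a submatrix. -/
def block {R C : ℕ} (l : ℕ) (i j : ℕ → ℕ) (V : Matrix (Fin R) (Fin C) ℤ) (m : ℕ) :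
    Matrix {a : Fin R // (a : ℕ) ∈ blockRows l i m} {b : Fin C // (b : ℕ) ∈ blockCols j m} ℤ :=
  V.submatrix Subtype.val Subtype.val

/-- `V` is a linked-block matrix of type `(n, l)` with block corners `(i m, j m)`, `m < n`:
all entries outside the `n` blocks are zero. -/
def IsLinkedBlock {R C : ℕ} (n l : ℕ) (i j : ℕ → ℕ) (V : Matrix (Fin R) (Fin C) ℤ) : Prop :=
  ∀ (a : Fin R) (b : Fin C),
    (∀ m < n, ¬ ((a : ℕ) ∈ blockRows l i m ∧ (b : ℕ) ∈ blockCols j m)) → V a b = 0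

/-- Number of rows `(n - 1)(r - l) + t` of an auxiliary matrix. -/
abbrev auxRows (r l n t : ℕ) : ℕ := (n - 1) * (r - l) + t

/-- Number of columns of the linked-block part of an auxiliary matrix. -/
abbrev auxCols (r l n t ω : ℕ) : ℕ := (n - 1) * (r - l) + (t - l + ω)

/-- An auxiliary matrix has `R` rows and `R + C = 2 * R - l + ω` columns. -/
theorem auxRows_add_auxCols {r l n t ω : ℕ} (ht : l ≤ t) :
    ((auxRows r l n t + auxCols r l n t ω : ℕ) : ℤ) = 2 * auxRows r l n t - l + ω := by
  simp only [auxRows, auxCols]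
  push_cast [Nat.cast_sub ht]
  ring

/-- Lower ends of the blocks: block `0` has `t` rows, all later blocks have `r` rows. -/
def auxRowCorner (r l t : ℕ) (m : ℕ) : ℕ := t + m * (r - l)

/-- Right ends of the blocks: block `0` has `t - l + ω` columns, all later ones `r - l`. -/
def auxColCorner (r l t ω : ℕ) (m : ℕ) : ℕ := t - l + ω + m * (r - l)

/-- `D = (U, V)` is an (integral) auxiliary matrix of type `(n, t, ω)_{r, l}`: `U` is a
non-singular diagonal matrix and `V` is a linked-block matrix of type `(n, l)` with totally
non-singular blocks, the first one of format `t × (t - l + ω)` and the `n - 1` others of format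
`r × (r - l)`. The columns of `U` are indexed by `Sum.inl`, those of `V` by `Sum.inr`. -/
def IsAuxiliary (r l n t ω : ℕ)
    (D : Matrix (Fin (auxRows r l n t)) (Fin (auxRows r l n t) ⊕ Fin (auxCols r l n t ω)) ℤ) :
    Prop :=
  ∃ (u : Fin (auxRows r l n t) → ℤ)
    (V : Matrix (Fin (auxRows r l n t)) (Fin (auxCols r l n t ω)) ℤ),
    D = Matrix.fromCols (Matrix.diagonal u) V ∧
    (∀ a, u a ≠ 0) ∧
    IsLinkedBlock n l (auxRowCorner r l t) (auxColCorner r l t ω) V ∧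
    ∀ m < n, IsTotallyNonsingular (block l (auxRowCorner r l t) (auxColCorner r l t ω) V m)

/-- The cubic exponential sum `g(η) = ∑_{|x| ≤ P} e(η x³)`, where `e(y) = exp(2πiy)`. -/
noncomputable def cubicSum (P : ℕ) (η : ℝ) : ℂ :=
  ∑ x ∈ Finset.Icc (-(P : ℤ)) (P : ℤ),
    Complex.exp (2 * Real.pi * Complex.I * ((η * (x : ℝ) ^ 3 : ℝ) : ℂ))

/-- The linear form `θ_j = ∑_i d_{i,j} η_i`. -/
noncomputable def linForm {R : ℕ} {κ : Type*} (D : Matrix (Fin R) κ ℤ) (η : Fin R → ℝ) (j : κ) :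
    ℝ :=
  ∑ i, (D i j : ℝ) * η i

/-- The mean value `I(P, D)`: the integral over the `R`-dimensional unit cube of the product of
`|g(θ_j)|²` over the columns of the diagonal part and of `|g(θ_j)|⁴` over the columns of the
linked-block part. -/
noncomputable def meanValue {R C : ℕ} (P : ℕ) (D : Matrix (Fin R) (Fin R ⊕ Fin C) ℤ) : ℝ :=
  ∫ η in Set.Icc (0 : Fin R → ℝ) 1,
    (∏ a : Fin R, ‖cubicSum P (linForm D η (Sum.inl a))‖ ^ 2) *
      ∏ b : Fin C, ‖cubicSum P (linForm D η (Sum.inr b))‖ ^ 4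

/-- All values `I(P, D)` for auxiliary matrices `D` of type `(n, t, ω)_{r, l}`. -/
def auxMeanValues (r l n t ω P : ℕ) : Set ℝ :=
  {y | ∃ D, IsAuxiliary r l n t ω D ∧ meanValue P D = y}

/-- `I_{n,t}^ω(P)`, the supremum of `I(P, D)` over all auxiliary `D` of type `(n, t, ω)_{r, l}`. -/
noncomputable def auxMeanSup (r l n t ω P : ℕ) : ℝ := sSup (auxMeanValues r l n t ω P)

end CubicAux

set_option linter.unusedSectionVars false

/-! By orthogonality `I(P, D)` is the number of integer solutions of a system of diagonal cubic
equations. A column of `U` carries the value x³ - y³ (kind `1`), a column of `V` the value x₁³ + x₂³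
- y₁³ - y₂³ (kind `2`), and the sum of the values times the columns of `D` must vanish. The proof
counts, more generally, solutions modulo a rational subspace `K` (`cnt`), and simplifies a system by
moves on one vector of kind k. Deletion costs P^(2k) (`cnt_delete`). Contraction, which adds a
vector outside `K` to `K`, costs P^(k+ε) (`cnt_contract`). For kind `1` the divisor bound yields P
times the deletion plus P^ε times the contraction (`cnt_split`). For kind `2` Weyl differencing
yields P³ times the deletion plus P^(-2+ε) times the system in which a Fejér kernel (kind `3`)
replaces the column (`exists_weyl`).

Total non-singularity puts the rows and columns of a block in general position (`Unif`), which
survives deletion and contraction within the ranks at hand. Hence only cardinalities matter, the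
estimates are uniform in `D`, and an induction on exponents remains, running from the last block to
the first (`bnd_blk`).

Inside a block the rows that are not linking rows are eliminated first (`bnd_blk_of_zero`). With
only linking rows left, Weyl differencing turns columns into Fejér elements that are kept for later
(`bnd_mix`), and the linking rows are split one by one (`bnd_part`). If the Fejér elements come to
fill the remaining rank, they are contracted and the next block starts afresh. Otherwise the next
block inherits z rows without variables together with the Fejér elements, and `bnd_defect`
eliminates these while controlling how far their independence is lost. The allowance for each
configuration is chosen so that every move fits into it. -/

namespace CubicAux

/-! ### The divisor bound. -/

section DivisorBound

theorem add_one_le_mul_two_rpow {ε : ℝ} (hε : 0 < ε) (a : ℕ) :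
    (a : ℝ) + 1 ≤ (1 + 1 / (ε * Real.log 2)) * (2 : ℝ) ^ ((a : ℝ) * ε) := by
  have hl : 0 < Real.log 2 := Real.log_pos (by norm_num)
  have h1 : (2 : ℝ) ^ ((a : ℝ) * ε) = Real.exp (Real.log 2 * (a * ε)) :=
    Real.rpow_def_of_pos (by norm_num) _
  have h2 := Real.add_one_le_exp (Real.log 2 * (a * ε))
  rw [h1]
  have ha : (0 : ℝ) ≤ a := Nat.cast_nonneg a
  have hx : 0 < ε * Real.log 2 := by positivity
  calc (a : ℝ) + 1 ≤ (1 + 1 / (ε * Real.log 2)) * (Real.log 2 * (a * ε) + 1) := by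
        have : 1 / (ε * Real.log 2) * (Real.log 2 * (a * ε)) = a := by field_simp
        have h3 : 0 < 1 / (ε * Real.log 2) := by positivity
        nlinarith [mul_nonneg ha hx.le]
    _ ≤ _ := by gcongr

/-- The divisor bound. -/
theorem exists_card_divisors_le (ε : ℝ) (hε : 0 < ε) :
    ∃ C : ℝ, 1 ≤ C ∧ ∀ n : ℕ, n ≠ 0 → (n.divisors.card : ℝ) ≤ C * (n : ℝ) ^ ε := by
  set C₀ : ℝ := 1 + 1 / (ε * Real.log 2) with hC₀
  have hl : 0 < Real.log 2 := Real.log_pos (by norm_num)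
  have hC1 : 1 ≤ C₀ := by
    have : 0 < 1 / (ε * Real.log 2) := by positivity
    linarith
  -- A prime `p ≥ B` has `p ^ ε ≥ 2`, so `a + 1 ≤ 2 ^ a ≤ p ^ (a * ε)` without loss; only the primes
  -- below `B`, at most `B` of them, contribute a factor `C₀`.
  obtain ⟨B, hB⟩ := exists_nat_ge ((2 : ℝ) ^ (1 / ε))
  refine ⟨C₀ ^ B, one_le_pow₀ hC1, fun n hn => ?_⟩
  have key : ∀ p ∈ n.primeFactors, ((n.factorization p + 1 : ℕ) : ℝ) ≤
      (if p < B then C₀ else 1) * ((p ^ n.factorization p : ℕ) : ℝ) ^ ε := by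
    intro p hp
    have hp2 : 2 ≤ p := (Nat.prime_of_mem_primeFactors hp).two_le
    have hp2' : (2 : ℝ) ≤ p := by exact_mod_cast hp2
    set a := n.factorization p
    have e1 : ((p ^ a : ℕ) : ℝ) ^ ε = (p : ℝ) ^ ((a : ℝ) * ε) := by
      push_cast
      rw [← Real.rpow_natCast, ← Real.rpow_mul (by positivity)]
    rw [e1]
    push_cast
    split_ifs with h
    · refine (add_one_le_mul_two_rpow hε a).trans ?_
      gcongr
    · rw [one_mul]
      have hpB : (2 : ℝ) ^ (1 / ε) ≤ p := hB.trans (by exact_mod_cast not_lt.mp h)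
      calc (a : ℝ) + 1 ≤ (2 : ℝ) ^ (a : ℝ) := by
            rw [Real.rpow_natCast]
            exact_mod_cast Nat.lt_two_pow_self
        _ = ((2 : ℝ) ^ (1 / ε)) ^ ((a : ℝ) * ε) := by
            rw [← Real.rpow_mul (by norm_num)]
            congr 1
            field_simp
        _ ≤ _ := by gcongr
  rw [Nat.card_divisors hn]
  push_cast
  calc ∏ x ∈ n.primeFactors, ((n.factorization x : ℝ) + 1)
      ≤ ∏ p ∈ n.primeFactors, (if p < B then C₀ else 1) *
          ((p ^ n.factorization p : ℕ) : ℝ) ^ ε := by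
        refine Finset.prod_le_prod (fun _ _ => by positivity) fun p hp => ?_
        simpa using key p hp
    _ = (∏ p ∈ n.primeFactors, if p < B then C₀ else 1) * (n : ℝ) ^ ε := by
        rw [Finset.prod_mul_distrib]
        congr 1
        rw [Real.finsetProd_rpow _ _ (fun _ _ => by positivity)]
        congr 1
        conv_rhs => rw [← Nat.prod_factorization_pow_eq_self hn]
        push_cast [Finsupp.prod]
        rfl
    _ ≤ _ := by
        gcongr
        rw [← Finset.prod_filter]
        rw [Finset.prod_const]
        refine pow_le_pow_right₀ hC1 ?_
        calc _ ≤ (Finset.range B).card := Finset.card_le_card (fun p hp => by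
              simp only [Finset.mem_filter] at hp; simpa using hp.2)
          _ = B := Finset.card_range B

/-- The set of all integer divisors, of either sign, of `m`. -/
def intDivisors (m : ℤ) : Finset ℤ :=
  m.natAbs.divisors.image (fun d : ℕ => (d : ℤ)) ∪ m.natAbs.divisors.image (fun d : ℕ => -(d : ℤ))

theorem mem_intDivisors {m d : ℤ} (hm : m ≠ 0) (h : d ∣ m) : d ∈ intDivisors m := by
  have h1 : d.natAbs ∈ m.natAbs.divisors :=
    Nat.mem_divisors.2 ⟨Int.natAbs_dvd_natAbs.2 h, Int.natAbs_ne_zero.2 hm⟩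
  rcases Int.natAbs_eq d with h2 | h2
  · exact Finset.mem_union_left _ (Finset.mem_image.2 ⟨_, h1, h2.symm⟩)
  · exact Finset.mem_union_right _ (Finset.mem_image.2 ⟨_, h1, h2.symm⟩)

theorem card_intDivisors_le (m : ℤ) : (intDivisors m).card ≤ 2 * m.natAbs.divisors.card := by
  refine (Finset.card_union_le _ _).trans ?_
  have := Finset.card_image_le (s := m.natAbs.divisors) (f := fun d : ℕ => (d : ℤ))
  have := Finset.card_image_le (s := m.natAbs.divisors) (f := fun d : ℕ => -(d : ℤ))
  omega

/-- Divisor bound for integers whose size is polynomial in `P`. -/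
theorem exists_card_intDivisors_le (B : ℝ) (hB : 1 ≤ B) (ε : ℝ) (hε : 0 < ε) :
    ∃ C : ℝ, 1 ≤ C ∧ ∀ P : ℕ, 1 ≤ P → ∀ m : ℤ, m ≠ 0 → |(m : ℝ)| ≤ B * (P : ℝ) ^ 3 →
      ((intDivisors m).card : ℝ) ≤ C * (P : ℝ) ^ ε := by
  obtain ⟨C, hC, h⟩ := exists_card_divisors_le (ε / 3) (by positivity)
  have hB3 : 1 ≤ B ^ (ε / 3) := Real.one_le_rpow hB (by positivity)
  refine ⟨2 * C * B ^ (ε / 3), by nlinarith, fun P hP m hm hmB => ?_⟩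
  have h1 := h m.natAbs (Int.natAbs_ne_zero.2 hm)
  have h2 : ((m.natAbs : ℕ) : ℝ) = |(m : ℝ)| := by
    rw [Nat.cast_natAbs, Int.cast_abs]
  have h3 : ((intDivisors m).card : ℝ) ≤ 2 * (m.natAbs.divisors.card : ℝ) := by
    exact_mod_cast card_intDivisors_le m
  have h4 : |(m : ℝ)| ^ (ε / 3) ≤ (B * (P : ℝ) ^ 3) ^ (ε / 3) := by gcongr
  have h5 : (B * (P : ℝ) ^ 3) ^ (ε / 3) = B ^ (ε / 3) * (P : ℝ) ^ ε := by
    rw [Real.mul_rpow (by positivity) (by positivity), ← Real.rpow_natCast, ← Real.rpow_mul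
      (by positivity)]
    congr 2
    push_cast
    ring
  rw [h2] at h1
  calc _ ≤ 2 * (C * |(m : ℝ)| ^ (ε / 3)) := by linarith
    _ ≤ 2 * (C * (B ^ (ε / 3) * (P : ℝ) ^ ε)) := by rw [← h5]; gcongr
    _ = _ := by ring

end DivisorBound

/-! ### Collision counts, shifts and Cauchy–Schwarz. -/

section Collisions

open scoped Classical in
/-- The number of pairs `(a, b)` with `s a - s b + y = 0`. -/
noncomputable def col {α Q : Type*} [AddCommGroup Q] (A : Finset α) (s : α → Q) (y : Q) : ℕ :=
  ∑ a ∈ A, ∑ b ∈ A, if s a - s b + y = 0 then 1 else 0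

open scoped Classical in
theorem sum_sum_eq_fiber {β Q : Type*} (B B' : Finset β) (f g : β → Q) (U : Finset Q)
    (hU : ∀ b ∈ B, f b ∈ U) :
    (∑ b ∈ B, ∑ b' ∈ B', if f b = g b' then (1 : ℕ) else 0) =
      ∑ u ∈ U, (∑ b ∈ B, if f b = u then 1 else 0) * (∑ b ∈ B', if g b = u then 1 else 0) := by
  simp only [Finset.sum_mul_sum]
  conv_rhs => rw [Finset.sum_comm]
  refine Finset.sum_congr rfl fun b hb => ?_
  conv_rhs => rw [Finset.sum_comm]
  refine Finset.sum_congr rfl fun b' _ => ?_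
  rw [Finset.sum_eq_single (f b)]
  · by_cases h : f b = g b' <;> simp [h, eq_comm]
  · intro u _ hu
    simp [hu.symm]
  · intro h
    exact absurd (hU b hb) h

/-- Grouped by common value, the shifted count is a correlation of two fibre-size functions which
are translates of each other, so `2mn ≤ m² + n²` bounds it by the unshifted one. Analytically: a
Fourier coefficient of a squared modulus is largest at zero. -/
theorem col_le_col_zero {α Q : Type*} [AddCommGroup Q] (A : Finset α) (s : α → Q) (y : Q) :
    col A s y ≤ col A s 0 := by
  classical
  set U : Finset Q := A.image s ∪ A.image (fun a => s a + y) with hU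
  have h1 : ∀ b ∈ A, s b ∈ U := fun b hb => by
    simp only [hU, Finset.mem_union, Finset.mem_image]; exact Or.inl ⟨b, hb, rfl⟩
  have h2 : ∀ b ∈ A, s b + y ∈ U := fun b hb => by
    simp only [hU, Finset.mem_union, Finset.mem_image]; exact Or.inr ⟨b, hb, rfl⟩
  have e1 : col A s y = ∑ a ∈ A, ∑ b ∈ A, if s a + y = s b then 1 else 0 := by
    unfold col
    refine Finset.sum_congr rfl fun a _ => Finset.sum_congr rfl fun b _ => ?_
    congr 1
    rw [show s a - s b + y = s a + y - s b by abel, sub_eq_zero]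
  have e2 : col A s 0 = ∑ a ∈ A, ∑ b ∈ A, if s a = s b then 1 else 0 := by
    unfold col
    refine Finset.sum_congr rfl fun a _ => Finset.sum_congr rfl fun b _ => ?_
    congr 1
    rw [add_zero, sub_eq_zero]
  have e3 : col A s 0 = ∑ a ∈ A, ∑ b ∈ A, if s a + y = s b + y then 1 else 0 := by
    rw [e2]; simp
  rw [sum_sum_eq_fiber A A _ _ U h2] at e1
  rw [sum_sum_eq_fiber A A s s U h1] at e2
  rw [sum_sum_eq_fiber A A _ (fun b => s b + y) U h2] at e3
  have : 2 * col A s y ≤ col A s 0 + col A s 0 := by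
    conv_rhs => rw [e2]
    rw [← e2]
    conv_rhs => lhs; rw [e3]
    rw [e1, e2, Finset.mul_sum, ← Finset.sum_add_distrib]
    refine Finset.sum_le_sum fun u _ => ?_
    have key : ∀ m n : ℕ, 2 * (m * n) ≤ m * m + n * n := fun m n => by
      zify; nlinarith [sq_nonneg ((m : ℤ) - n)]
    exact key _ _
  omega

open scoped Classical in
-- Cauchy–Schwarz: `c` cuts each fibre of `f` into at most `I.card` pieces. In Weyl differencing `c`
-- is the difference of two variables.
theorem collisions_le_card_mul {β Q : Type*} (B : Finset β) (f : β → Q) (c : β → ℤ)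
    (I : Finset ℤ) (hc : ∀ b ∈ B, c b ∈ I) :
    (∑ b ∈ B, ∑ b' ∈ B, if f b = f b' then (1 : ℕ) else 0) ≤
      I.card * ∑ b ∈ B, ∑ b' ∈ B, if f b = f b' ∧ c b = c b' then 1 else 0 := by
  set U : Finset Q := B.image f with hU
  have h1 : ∀ b ∈ B, f b ∈ U := fun b hb => Finset.mem_image_of_mem f hb
  rw [sum_sum_eq_fiber B B f f U h1]
  have h2 : ∀ b ∈ B, (fun b => (f b, c b)) b ∈ U ×ˢ I := fun b hb =>
    Finset.mem_product.2 ⟨h1 b hb, hc b hb⟩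
  have e := sum_sum_eq_fiber B B (fun b => (f b, c b)) (fun b => (f b, c b)) _ h2
  simp only [Prod.mk.injEq] at e
  rw [e, Finset.sum_product, Finset.mul_sum]
  refine Finset.sum_le_sum fun u _ => ?_
  have e3 : (∑ b ∈ B, if f b = u then 1 else 0) =
      ∑ h ∈ I, ∑ b ∈ B, if f b = u ∧ c b = h then 1 else 0 := by
    rw [Finset.sum_comm]
    refine Finset.sum_congr rfl fun b hb => ?_
    by_cases h : f b = u
    · simp [h, hc b hb]
    · simp [h]
  rw [e3, ← sq]
  refine (sq_sum_le_card_mul_sum_sq).trans (le_of_eq ?_)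
  congr 1
  refine Finset.sum_congr rfl fun h _ => ?_
  rw [sq]
  congr 1 <;> refine Finset.sum_congr rfl fun b _ => ?_ <;> simp [Prod.ext_iff]

end Collisions

/-! ### Representations by differences of cubes and by Weyl differenced cubes. -/

section CubeCounts

/-- The box `[-P, P]`. -/
noncomputable def box (P : ℕ) : Finset ℤ := Finset.Icc (-(P : ℤ)) P

theorem card_box (P : ℕ) : (box P).card = 2 * P + 1 := by
  simp [box]; omega

theorem card_box_le {P : ℕ} (hP : 1 ≤ P) : (box P).card ≤ 3 * P := by
  rw [card_box]; omega

/-- Pairs in the box whose cubes differ by `m`. -/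
noncomputable def cubePairs (P : ℕ) (m : ℤ) : Finset (ℤ × ℤ) :=
  (box P ×ˢ box P).filter fun p => p.1 ^ 3 - p.2 ^ 3 = m

theorem cube_injective : Function.Injective fun x : ℤ => x ^ 3 :=
  (Odd.strictMono_pow (by decide : Odd 3)).injective

theorem card_cubePairs_le {P : ℕ} (hP : 1 ≤ P) (m : ℤ) : (cubePairs P m).card ≤ 3 * P := by
  refine (Finset.card_le_card_of_injOn Prod.fst (t := box P) ?_ ?_).trans (card_box_le hP)
  · intro p hp
    simp only [cubePairs, Finset.coe_filter, Finset.mem_product, Set.mem_ofPred_eq] at hp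
    exact hp.1.1
  · rintro ⟨x, y⟩ hp ⟨x', y'⟩ hp' h
    simp only [cubePairs, Finset.coe_filter, Finset.mem_product, Set.mem_ofPred_eq] at hp hp' h
    subst h
    have : y ^ 3 = y' ^ 3 := by linarith [hp.2, hp'.2]
    rw [cube_injective this]

/-- The difference d = x - y divides m, and 4m - d³ = 3d(x + y)² determines x + y up to a sign,
which the Boolean records. -/
theorem card_cubePairs_le_intDivisors (P : ℕ) {m : ℤ} (hm : m ≠ 0) :
    (cubePairs P m).card ≤ 2 * (intDivisors m).card := by
  have : ((intDivisors m) ×ˢ (Finset.univ : Finset Bool)).card = 2 * (intDivisors m).card := by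
    simp [Finset.card_product, mul_comm]
  rw [← this]
  refine Finset.card_le_card_of_injOn (fun p => (p.1 - p.2, decide (0 ≤ p.1 + p.2))) ?_ ?_
  · intro p hp
    simp only [cubePairs, Finset.coe_filter, Finset.mem_product, Set.mem_ofPred_eq] at hp
    simp only [Finset.coe_product, Set.mem_prod, Finset.mem_coe, Finset.mem_univ, and_true]
    exact mem_intDivisors hm ⟨p.1 ^ 2 + p.1 * p.2 + p.2 ^ 2, by rw [← hp.2]; ring⟩
  · rintro ⟨x, y⟩ hp ⟨x', y'⟩ hp' h
    simp only [cubePairs, Finset.coe_filter, Finset.mem_product, Set.mem_ofPred_eq] at hp hp'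
    simp only [Prod.mk.injEq, decide_eq_decide] at h
    obtain ⟨h1, h2⟩ := h
    have hd : x - y ≠ 0 := by
      intro h0
      apply hm
      rw [← hp.2, show x = y by linarith]
      ring
    have h3 : (x - y) * (3 * (x + y) ^ 2) = (x - y) * (3 * (x' + y') ^ 2) := by
      have e1 : (x - y) * (3 * (x + y) ^ 2) = 4 * (x ^ 3 - y ^ 3) - (x - y) ^ 3 := by ring
      have e2 : (x' - y') * (3 * (x' + y') ^ 2) = 4 * (x' ^ 3 - y' ^ 3) - (x' - y') ^ 3 := by ring
      rw [← h1] at e2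
      rw [e1, e2, hp.2, hp'.2]
    have h4 : (x + y) ^ 2 = (x' + y') ^ 2 := by
      have := mul_left_cancel₀ hd h3
      linarith
    have h5 : x + y = x' + y' := by
      rcases sq_eq_sq_iff_eq_or_eq_neg.1 h4 with h | h
      · exact h
      · by_cases hx : 0 ≤ x + y
        · have := h2.1 hx; linarith
        · have : ¬ 0 ≤ x' + y' := fun h' => hx (h2.2 h')
          linarith
    simp only [Prod.mk.injEq]
    constructor <;> linarith

theorem abs_le_of_mem_box {P : ℕ} {x : ℤ} (hx : x ∈ box P) : |x| ≤ P := by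
  simp only [box, Finset.mem_Icc] at hx
  exact abs_le.2 ⟨hx.1, hx.2⟩

theorem abs_cube_le {P : ℕ} {x : ℤ} (hx : x ∈ box P) : |x ^ 3| ≤ (P : ℤ) ^ 3 := by
  rw [abs_pow]
  exact pow_le_pow_left₀ (abs_nonneg x) (abs_le_of_mem_box hx) 3

theorem exists_card_cubePairs_le (ε : ℝ) (hε : 0 < ε) :
    ∃ C : ℝ, 1 ≤ C ∧ ∀ P : ℕ, 1 ≤ P → ∀ m : ℤ, m ≠ 0 →
      ((cubePairs P m).card : ℝ) ≤ C * (P : ℝ) ^ ε := by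
  obtain ⟨C, hC, h⟩ := exists_card_intDivisors_le 2 (by norm_num) ε hε
  refine ⟨2 * C, by linarith, fun P hP m hm => ?_⟩
  rcases (cubePairs P m).eq_empty_or_nonempty with h0 | ⟨p, hp⟩
  · rw [h0]; simp; positivity
  · simp only [cubePairs, Finset.mem_filter, Finset.mem_product] at hp
    have h1 : |m| ≤ 2 * (P : ℤ) ^ 3 := by
      rw [← hp.2]
      have := abs_sub (p.1 ^ 3) (p.2 ^ 3)
      have := abs_cube_le hp.1.1
      have := abs_cube_le hp.1.2
      linarith
    have h2 : |(m : ℝ)| ≤ 2 * (P : ℝ) ^ 3 := by exact_mod_cast h1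
    have h3 : ((cubePairs P m).card : ℝ) ≤ 2 * ((intDivisors m).card : ℝ) := by
      exact_mod_cast card_cubePairs_le_intDivisors P hm
    have := h P hP m hm h2
    linarith

/-- Triples `(h, y, y')` with prescribed value of the Weyl differenced polynomial. -/
noncomputable def weylTriples (P : ℕ) (m : ℤ) : Finset (ℤ × ℤ × ℤ) :=
  (Finset.Icc (-(2 * P : ℤ)) (2 * P) ×ˢ box P ×ˢ box P).filter fun p =>
    3 * p.1 * (p.2.1 - p.2.2) * (p.2.1 + p.2.2 + p.1) = m

/-- One of the three factors vanishes, which leaves two free variables in each case: 9 + 15 + 15 =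
39. -/
theorem card_weylTriples_zero_le {P : ℕ} (hP : 1 ≤ P) :
    (weylTriples P 0).card ≤ 39 * P ^ 2 := by
  set I := Finset.Icc (-(2 * P : ℤ)) (2 * P) with hI
  have hIc : I.card ≤ 5 * P := by simp [hI]; omega
  have hb := card_box_le hP
  have hsub : weylTriples P 0 ⊆
      (box P ×ˢ box P).image (fun p => ((0 : ℤ), p.1, p.2)) ∪
      (I ×ˢ box P).image (fun p => (p.1, p.2, p.2)) ∪
      (I ×ˢ box P).image (fun p => (p.1, p.2, -p.2 - p.1)) := by
    rintro ⟨h, y, y'⟩ hp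
    simp only [weylTriples, Finset.mem_filter, Finset.mem_product] at hp
    obtain ⟨⟨h1, h2, h3⟩, h4⟩ := hp
    simp only [Finset.mem_union, Finset.mem_image, Finset.mem_product, Prod.exists, Prod.mk.injEq]
    rcases mul_eq_zero.1 h4 with h5 | h5
    · rcases mul_eq_zero.1 h5 with h6 | h6
      · exact Or.inl (Or.inl ⟨y, y', ⟨h2, h3⟩, by omega, rfl, rfl⟩)
      · exact Or.inl (Or.inr ⟨h, y, ⟨h1, h2⟩, rfl, rfl, by omega⟩)
    · exact Or.inr ⟨h, y, ⟨h1, h2⟩, rfl, rfl, by omega⟩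
  refine (Finset.card_le_card hsub).trans ?_
  refine (Finset.card_union_le _ _).trans ?_
  have a1 := Finset.card_union_le ((box P ×ˢ box P).image (fun p => ((0 : ℤ), p.1, p.2)))
    ((I ×ˢ box P).image (fun p => (p.1, p.2, p.2)))
  have a2 := Finset.card_image_le (s := box P ×ˢ box P) (f := fun p => ((0 : ℤ), p.1, p.2))
  have a3 := Finset.card_image_le (s := I ×ˢ box P) (f := fun p => (p.1, p.2, p.2))
  have a4 := Finset.card_image_le (s := I ×ˢ box P) (f := fun p => (p.1, p.2, -p.2 - p.1))
  rw [Finset.card_product] at a2 a3 a4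
  have b1 : (box P).card * (box P).card ≤ 3 * P * (3 * P) := Nat.mul_le_mul hb hb
  have b2 : I.card * (box P).card ≤ 5 * P * (3 * P) := Nat.mul_le_mul hIc hb
  nlinarith

/-- Two of the factors are divisors of `m`, and since `m ≠ 0` they determine the third. -/
theorem card_weylTriples_le_intDivisors (P : ℕ) {m : ℤ} (hm : m ≠ 0) :
    (weylTriples P m).card ≤ (intDivisors m).card ^ 2 := by
  rw [sq, ← Finset.card_product]
  refine Finset.card_le_card_of_injOn (fun p => (p.1, p.2.1 - p.2.2)) ?_ ?_
  · rintro ⟨h, y, y'⟩ hp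
    simp only [weylTriples, Finset.coe_filter, Finset.mem_product, Set.mem_ofPred_eq] at hp
    simp only [Finset.coe_product, Set.mem_prod, Finset.mem_coe]
    exact ⟨mem_intDivisors hm ⟨3 * (y - y') * (y + y' + h), by rw [← hp.2]; ring⟩,
      mem_intDivisors hm ⟨3 * h * (y + y' + h), by rw [← hp.2]; ring⟩⟩
  · rintro ⟨h, y, y'⟩ hp ⟨k, z, z'⟩ hp' he
    simp only [weylTriples, Finset.coe_filter, Finset.mem_product, Set.mem_ofPred_eq] at hp hp'
    simp only [Prod.mk.injEq] at he
    obtain ⟨rfl, h2⟩ := he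
    have e := hp.2.trans hp'.2.symm
    rw [← h2] at e
    have hne : 3 * h * (y - y') ≠ 0 := fun h0 => hm (by rw [← hp.2, h0, zero_mul])
    have e2 := mul_left_cancel₀ hne e
    simp only [Prod.mk.injEq, true_and]
    constructor <;> linarith

theorem abs_le_of_mem_weylTriples {P : ℕ} {m : ℤ} {p : ℤ × ℤ × ℤ} (hp : p ∈ weylTriples P m) :
    |m| ≤ 48 * (P : ℤ) ^ 3 := by
  obtain ⟨k, y, y'⟩ := p
  simp only [weylTriples, Finset.mem_filter, Finset.mem_product] at hp
  obtain ⟨⟨h1, h2, h3⟩, h4⟩ := hp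
  have hk : |k| ≤ 2 * P := by
    rw [Finset.mem_Icc] at h1; exact abs_le.2 h1
  have hy := abs_le_of_mem_box h2
  have hy' := abs_le_of_mem_box h3
  have c1 : |y - y'| ≤ 2 * P := (abs_sub _ _).trans (by linarith)
  have c2 : |y + y' + k| ≤ 4 * P := (abs_add_three _ _ _).trans (by linarith)
  rw [← h4, abs_mul, abs_mul, abs_mul]
  calc |(3 : ℤ)| * |k| * |y - y'| * |y + y' + k| ≤ 3 * (2 * P) * (2 * P) * (4 * P) := by
        have : |(3 : ℤ)| = 3 := rfl
        rw [this]; gcongr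
    _ = _ := by ring

theorem exists_card_weylTriples_le (ε : ℝ) (hε : 0 < ε) :
    ∃ C : ℝ, 1 ≤ C ∧ ∀ P : ℕ, 1 ≤ P → ∀ m : ℤ, m ≠ 0 →
      ((weylTriples P m).card : ℝ) ≤ C * (P : ℝ) ^ ε := by
  obtain ⟨C, hC, h⟩ := exists_card_intDivisors_le 48 (by norm_num) (ε / 2) (by positivity)
  refine ⟨C ^ 2, one_le_pow₀ hC, fun P hP m hm => ?_⟩
  rcases (weylTriples P m).eq_empty_or_nonempty with h0 | ⟨p, hp⟩
  · rw [h0]; simp; positivity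
  · have hm2 : |(m : ℝ)| ≤ 48 * (P : ℝ) ^ 3 := by exact_mod_cast abs_le_of_mem_weylTriples hp
    have h5 := h P hP m hm hm2
    have h6 : ((weylTriples P m).card : ℝ) ≤ ((intDivisors m).card : ℝ) ^ 2 := by
      exact_mod_cast card_weylTriples_le_intDivisors P hm
    calc _ ≤ _ := h6
      _ ≤ (C * (P : ℝ) ^ (ε / 2)) ^ 2 := by gcongr
      _ = _ := by
        rw [mul_pow, ← Real.rpow_natCast ((P : ℝ) ^ (ε / 2)), ← Real.rpow_mul (by positivity)]
        congr 2
        push_cast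
        ring

end CubeCounts

/-! ### The variables of each kind and the multiplicities of their differences. -/

section Kinds

/-- Half of the variables attached to an element of kind `k`: kind `0` carries no variable, kind
`1` stands for `|g|²`, kind `2` for `|g|⁴`, and larger kinds for a Fejér kernel. -/
noncomputable def half (P k : ℕ) : Finset (ℤ × ℤ) :=
  if k = 0 then {(0, 0)}
  else if k = 1 then box P ×ˢ {0}
  else if k = 2 then box P ×ˢ box P
  -- The length is twice the bound 48P³ of `abs_le_of_mem_weylTriples`, so that every integer within
  -- that bound is a difference of two elements in at least 48P³ ways.
  else Finset.Ico 0 (96 * (P : ℤ) ^ 3) ×ˢ {0}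

/-- The value of a half variable of kind `k`. -/
def val (k : ℕ) (p : ℤ × ℤ) : ℤ := if k ≤ 2 then p.1 ^ 3 + p.2 ^ 3 else p.1

theorem val_zero : val 0 (0, 0) = 0 := by simp [val]

theorem half_zero (P : ℕ) : half P 0 = {(0, 0)} := by simp [half]

theorem card_half_le {P : ℕ} (hP : 1 ≤ P) {k : ℕ} (hk : k ≤ 3) :
    (half P k).card ≤ 96 * P ^ k := by
  have hb := card_box_le hP
  interval_cases k
  · simp [half]
  · simp [half]; omega
  · have := Nat.mul_le_mul hb hb
    simp only [half, OfNat.ofNat_ne_zero, OfNat.ofNat_ne_one, if_false, if_true,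
      Finset.card_product]
    nlinarith
  · have h1 : (Finset.Ico 0 (96 * (P : ℤ) ^ 3)).card = 96 * P ^ 3 := by
      rw [Int.card_Ico, sub_zero, show 96 * (P : ℤ) ^ 3 = ((96 * P ^ 3 : ℕ) : ℤ) by push_cast; ring,
        Int.toNat_natCast]
    simp [half, h1]

/-- Number of pairs of half variables whose values differ by `m`. -/
noncomputable def coll (P k : ℕ) (m : ℤ) : ℕ :=
  ((half P k ×ˢ half P k).filter fun p => val k p.1 - val k p.2 = m).card

theorem coll_le_card {P k : ℕ} (m : ℤ) (hinj : Set.InjOn (val k) (half P k)) :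
    coll P k m ≤ (half P k).card := by
  refine Finset.card_le_card_of_injOn Prod.fst ?_ ?_
  · intro p hp
    simp only [Finset.coe_filter, Finset.mem_product, Set.mem_ofPred_eq] at hp
    exact hp.1.1
  · rintro ⟨x, y⟩ hp ⟨x', y'⟩ hp' h
    simp only [Finset.coe_filter, Finset.mem_product, Set.mem_ofPred_eq] at hp hp' h
    subst h
    have := hinj hp.1.2 hp'.1.2 (by linarith [hp.2, hp'.2])
    rw [this]

theorem coll_one_le (P : ℕ) (m : ℤ) : coll P 1 m ≤ (cubePairs P m).card := by
  refine Finset.card_le_card_of_injOn (fun p => (p.1.1, p.2.1)) ?_ ?_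
  · rintro ⟨⟨x, y⟩, ⟨x', y'⟩⟩ hp
    simp only [half, one_ne_zero, if_false, if_true, Finset.mem_product, val, Nat.one_le_ofNat,
      Finset.coe_filter, Set.mem_ofPred_eq, Finset.mem_singleton] at hp
    obtain ⟨⟨⟨h1, rfl⟩, ⟨h2, rfl⟩⟩, h3⟩ := hp
    simp only [cubePairs, Finset.coe_filter, Finset.mem_product, Set.mem_ofPred_eq]
    exact ⟨⟨h1, h2⟩, by rw [← h3]; ring⟩
  · rintro ⟨⟨x, y⟩, ⟨x', y'⟩⟩ hp ⟨⟨z, w⟩, ⟨z', w'⟩⟩ hp' h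
    simp only [half, one_ne_zero, if_false, if_true, Finset.mem_product,
      Finset.coe_filter, Set.mem_ofPred_eq, Finset.mem_singleton] at hp hp'
    simp only [Prod.mk.injEq] at h ⊢
    obtain ⟨⟨⟨-, rfl⟩, ⟨-, rfl⟩⟩, -⟩ := hp
    obtain ⟨⟨⟨-, rfl⟩, ⟨-, rfl⟩⟩, -⟩ := hp'
    tauto

theorem exists_coll_one_le (ε : ℝ) (hε : 0 < ε) :
    ∃ C : ℝ, 1 ≤ C ∧ ∀ P : ℕ, 1 ≤ P → ∀ m : ℤ, m ≠ 0 → (coll P 1 m : ℝ) ≤ C * (P : ℝ) ^ ε := by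
  obtain ⟨C, hC, h⟩ := exists_card_cubePairs_le ε hε
  refine ⟨C, hC, fun P hP m hm => le_trans ?_ (h P hP m hm)⟩
  exact_mod_cast coll_one_le P m

theorem coll_two_le (P : ℕ) (m : ℤ) :
    coll P 2 m ≤ ∑ p ∈ box P ×ˢ box P, (cubePairs P (m - (p.1 ^ 3 - p.2 ^ 3))).card := by
  rw [← Finset.card_sigma]
  refine Finset.card_le_card_of_injOn
    (fun p => ⟨(p.1.1, p.2.1), (p.1.2, p.2.2)⟩) ?_ ?_
  · rintro ⟨⟨x, y⟩, ⟨x', y'⟩⟩ hp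
    simp only [half, Finset.mem_product, val, Finset.coe_filter, Set.mem_ofPred_eq] at hp
    norm_num at hp
    simp only [Finset.coe_sigma, Set.mem_sigma_iff, Finset.mem_coe, Finset.mem_product,
      cubePairs, Finset.mem_filter]
    exact ⟨⟨hp.1.1.1, hp.1.2.1⟩, ⟨hp.1.1.2, hp.1.2.2⟩, by linarith [hp.2]⟩
  · rintro ⟨⟨x, y⟩, ⟨x', y'⟩⟩ hp ⟨⟨z, w⟩, ⟨z', w'⟩⟩ hp' h
    simp only [Sigma.mk.injEq, Prod.mk.injEq, heq_eq_eq] at h ⊢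
    tauto

theorem exists_coll_le (ε : ℝ) (hε : 0 < ε) :
    ∃ C : ℝ, 1 ≤ C ∧ ∀ P : ℕ, 1 ≤ P → ∀ k ≤ 3, ∀ m : ℤ,
      (coll P k m : ℝ) ≤ C * (P : ℝ) ^ ((k : ℝ) + ε) := by
  obtain ⟨C, hC, h⟩ := exists_card_cubePairs_le ε hε
  refine ⟨96 * C, by linarith, fun P hP k hk m => ?_⟩
  have hP' : (1 : ℝ) ≤ P := by exact_mod_cast hP
  have hPe : (1 : ℝ) ≤ (P : ℝ) ^ ε := Real.one_le_rpow hP' hε.le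
  rw [Real.rpow_add (by positivity), Real.rpow_natCast]
  have hinj : k ≠ 2 → Set.InjOn (val k) (half P k) := by
    intro hk2
    rintro ⟨x, y⟩ hx ⟨x', y'⟩ hx' he
    have : k = 0 ∨ k = 1 ∨ k = 3 := by omega
    rcases this with rfl | rfl | rfl
    · simp [half] at hx hx'
      simp [hx, hx']
    · simp [half] at hx hx'
      obtain ⟨-, rfl⟩ := hx
      obtain ⟨-, rfl⟩ := hx'
      have : x ^ 3 = x' ^ 3 := by simpa [val] using he
      rw [cube_injective this]
    · simp [half] at hx hx'
      obtain ⟨-, rfl⟩ := hx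
      obtain ⟨-, rfl⟩ := hx'
      simpa [val] using he
  by_cases hk2 : k = 2
  · subst hk2
    have h1 : (coll P 2 m : ℝ) ≤
        ∑ p ∈ box P ×ˢ box P, ((cubePairs P (m - (p.1 ^ 3 - p.2 ^ 3))).card : ℝ) := by
      exact_mod_cast coll_two_le P m
    -- The first cubes generically leave a non-zero difference for the second ones, with P^ε
    -- solutions. The exceptional pairs lie in `cubePairs P m`; there are at most `3P` of them, each
    -- allowing at most `3P` completions.
    have h2 : ∀ p ∈ box P ×ˢ box P, ((cubePairs P (m - (p.1 ^ 3 - p.2 ^ 3))).card : ℝ) ≤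
        C * (P : ℝ) ^ ε + if p.1 ^ 3 - p.2 ^ 3 = m then 3 * (P : ℝ) else 0 := by
      intro p _
      split_ifs with h3
      · have : ((cubePairs P (m - (p.1 ^ 3 - p.2 ^ 3))).card : ℝ) ≤ 3 * P := by
          exact_mod_cast card_cubePairs_le hP _
        nlinarith
      · rw [add_zero]
        exact h P hP _ (fun h0 => h3 (by linarith))
    have h4 : ((box P ×ˢ box P).card : ℝ) ≤ 9 * (P : ℝ) ^ 2 := by
      have := card_box_le hP
      have h5 : ((box P).card : ℝ) ≤ 3 * P := by exact_mod_cast this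
      rw [Finset.card_product]
      push_cast
      nlinarith
    have h6 : ((cubePairs P m).card : ℝ) ≤ 3 * P := by exact_mod_cast card_cubePairs_le hP m
    calc (coll P 2 m : ℝ) ≤ _ := h1
      _ ≤ _ := Finset.sum_le_sum h2
      _ = (box P ×ˢ box P).card * (C * (P : ℝ) ^ ε) + (cubePairs P m).card * (3 * (P : ℝ)) := by
        rw [Finset.sum_add_distrib, Finset.sum_const, nsmul_eq_mul, ← Finset.sum_filter,
          Finset.sum_const, nsmul_eq_mul]
        rfl
      _ ≤ 9 * (P : ℝ) ^ 2 * (C * (P : ℝ) ^ ε) + 3 * P * (3 * P) := by gcongr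
      _ ≤ 96 * C * ((P : ℝ) ^ 2 * (P : ℝ) ^ ε) := by
        have : (P : ℝ) ^ 2 * 1 ≤ (P : ℝ) ^ 2 * (C * (P : ℝ) ^ ε) := by
          gcongr; nlinarith
        nlinarith
  · have h1 : (coll P k m : ℝ) ≤ 96 * (P : ℝ) ^ k := by
      exact_mod_cast (coll_le_card m (hinj hk2)).trans (card_half_le hP hk)
    have : 96 * (P : ℝ) ^ k * 1 ≤ 96 * (P : ℝ) ^ k * (C * (P : ℝ) ^ ε) := by
      gcongr; nlinarith
    linarith

end Kinds

/-! ### Weyl differencing. -/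

section Weyl

variable {α Q : Type*} [AddCommGroup Q]

open scoped Classical in
theorem col_eq_card (A : Finset α) (s : α → Q) (y : Q) :
    col A s y = ((A ×ˢ A).filter fun p => s p.1 - s p.2 + y = 0).card := by
  rw [Finset.card_filter, Finset.sum_product]
  rfl

open scoped Classical in
-- The four cubes are regrouped crosswise, so that each side of the collision carries a difference
-- of two cubes; the difference of these two variables can then be fixed.
theorem sum_col_half_two_eq (P : ℕ) (A : Finset α) (s : α → Q) (w : Q) :
    (∑ p ∈ half P 2, ∑ q ∈ half P 2, col A s ((val 2 p - val 2 q) • w)) =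
      ∑ b ∈ A ×ˢ box P ×ˢ box P, ∑ b' ∈ A ×ˢ box P ×ˢ box P,
        if s b.1 + (b.2.1 ^ 3 - b.2.2 ^ 3) • w = s b'.1 + (b'.2.1 ^ 3 - b'.2.2 ^ 3) • w
        then (1 : ℕ) else 0 := by
  have h2 : half P 2 = box P ×ˢ box P := by simp [half]
  simp only [col, h2, ← Finset.sum_product']
  refine Finset.sum_nbij'
    (fun t => ((t.2.2.1, t.1.1, t.2.1.1), (t.2.2.2, t.2.1.2, t.1.2)))
    (fun t => ((t.1.2.1, t.2.2.2), (t.1.2.2, t.2.2.1), (t.1.1, t.2.1))) ?_ ?_ ?_ ?_ ?_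
  · intro t ht
    simp only [Finset.mem_product] at ht ⊢
    tauto
  · intro t ht
    simp only [Finset.mem_product] at ht ⊢
    tauto
  · intro t _; rfl
  · intro t _; rfl
  · rintro ⟨⟨x1, x2⟩, ⟨y1, y2⟩, ⟨a, b⟩⟩ _
    congr 1
    simp only [val, le_refl, if_true, eq_iff_iff]
    rw [← sub_eq_zero (a := s a + _)]
    have : s a - s b + (x1 ^ 3 + x2 ^ 3 - (y1 ^ 3 + y2 ^ 3)) • w =
      s a + (x1 ^ 3 - y1 ^ 3) • w - (s b + (y2 ^ 3 - x2 ^ 3) • w) := by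
      simp only [sub_smul, add_smul]; abel
    rw [this]

open scoped Classical in
-- With common h = x - y = x' - y', the two differences of cubes differ by 3h(y - y')(y + y' + h).
theorem collisions_le_sum_col (P : ℕ) (A : Finset α) (s : α → Q) (w : Q) :
    (∑ b ∈ A ×ˢ box P ×ˢ box P, ∑ b' ∈ A ×ˢ box P ×ˢ box P,
        if s b.1 + (b.2.1 ^ 3 - b.2.2 ^ 3) • w = s b'.1 + (b'.2.1 ^ 3 - b'.2.2 ^ 3) • w ∧
          b.2.1 - b.2.2 = b'.2.1 - b'.2.2
        then (1 : ℕ) else 0) ≤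
      ∑ t ∈ Finset.Icc (-(2 * P : ℤ)) (2 * P) ×ˢ box P ×ˢ box P,
        col A s ((3 * t.1 * (t.2.1 - t.2.2) * (t.2.1 + t.2.2 + t.1)) • w) := by
  simp only [col_eq_card]
  rw [← Finset.sum_product', ← Finset.card_filter, ← Finset.card_sigma]
  refine Finset.card_le_card_of_injOn
    (fun t => ⟨(t.1.2.1 - t.1.2.2, t.1.2.2, t.2.2.2), (t.1.1, t.2.1)⟩) ?_ ?_
  · rintro ⟨⟨a, x, y⟩, ⟨b, x', y'⟩⟩ ht
    simp only [Finset.coe_filter, Finset.mem_product, Set.mem_ofPred_eq] at ht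
    obtain ⟨⟨⟨ha, hx, hy⟩, ⟨hb, hx', hy'⟩⟩, h1, h2⟩ := ht
    simp only [Finset.coe_sigma, Set.mem_sigma_iff, Finset.mem_coe, Finset.mem_product,
      Finset.mem_filter]
    refine ⟨⟨?_, hy, hy'⟩, ⟨ha, hb⟩, ?_⟩
    · simp only [box, Finset.mem_Icc] at hx hy ⊢
      omega
    · have hx'e : x' = x - y + y' := by omega
      rw [← sub_eq_zero] at h1
      rw [← h1, hx'e]
      have : (3 * (x - y) * (y - y') * (y + y' + (x - y))) =
        (x ^ 3 - y ^ 3) - ((x - y + y') ^ 3 - y' ^ 3) := by ring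
      rw [this, sub_smul (x ^ 3 - y ^ 3)]
      abel
  · rintro ⟨⟨a, x, y⟩, ⟨b, x', y'⟩⟩ ht ⟨⟨a1, x1, y1⟩, ⟨b1, x1', y1'⟩⟩ ht' h
    simp only [Finset.coe_filter, Finset.mem_product, Set.mem_ofPred_eq] at ht ht'
    simp only [Sigma.mk.injEq, Prod.mk.injEq, heq_eq_eq] at h ⊢
    obtain ⟨⟨h1, h2, h3⟩, h4, h5⟩ := h
    have := ht.2.2
    have := ht'.2.2
    refine ⟨⟨h4, ?_, h2⟩, h5, ?_, h3⟩ <;> omega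

theorem sum_col_Icc_le (P : ℕ) (A : Finset α) (s : α → Q) (w : Q) :
    48 * P ^ 3 * (∑ m ∈ Finset.Icc (-(48 * (P : ℤ) ^ 3)) (48 * (P : ℤ) ^ 3), col A s (m • w)) ≤
      ∑ p ∈ half P 3, ∑ q ∈ half P 3, col A s ((val 3 p - val 3 q) • w) := by
  set M : ℤ := 48 * (P : ℤ) ^ 3 with hM
  have hc : (Finset.Ico 0 M).card = 48 * P ^ 3 := by
    rw [Int.card_Ico, sub_zero, hM, show 48 * (P : ℤ) ^ 3 = ((48 * P ^ 3 : ℕ) : ℤ) by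
      push_cast; ring, Int.toNat_natCast]
  have e1 : 48 * P ^ 3 * (∑ m ∈ Finset.Icc (-M) M, col A s (m • w)) =
      ∑ t ∈ Finset.Icc (-M) M ×ˢ Finset.Ico 0 M, col A s (t.1 • w) := by
    rw [Finset.sum_product, Finset.mul_sum]
    refine Finset.sum_congr rfl fun m _ => ?_
    simp only [Finset.sum_const, hc, smul_eq_mul]
  rw [e1, ← Finset.sum_product']
  -- A pair with difference `m` whose smaller member is `j`; distinct `(m, j)` give distinct pairs.
  let g : ℤ × ℤ → (ℤ × ℤ) × (ℤ × ℤ) := fun t =>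
    if 0 ≤ t.1 then ((t.1 + t.2, 0), (t.2, 0)) else ((t.2, 0), (t.2 - t.1, 0))
  have hg : ∀ t, (g t).1.1 - (g t).2.1 = t.1 := fun t => by
    simp only [g]; split_ifs <;> simp
  have hinj : Set.InjOn g (Finset.Icc (-M) M ×ˢ Finset.Ico 0 M : Finset (ℤ × ℤ)) := by
    rintro ⟨m, j⟩ _ ⟨m', j'⟩ _ h
    have h1 : m = m' := by
      have := hg (m, j)
      have h2 := hg (m', j')
      rw [← h] at h2
      simpa using this.symm.trans h2
    subst h1
    simp only [g] at h
    split_ifs at h <;> simp at h <;> simp [h]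
  have e2 : ∀ t ∈ Finset.Icc (-M) M ×ˢ Finset.Ico 0 M, col A s (t.1 • w) =
      (fun p : (ℤ × ℤ) × (ℤ × ℤ) => col A s ((val 3 p.1 - val 3 p.2) • w)) (g t) := by
    intro t _
    have : val 3 (g t).1 - val 3 (g t).2 = t.1 := by simpa [val] using hg t
    simp only [this]
  rw [Finset.sum_congr rfl e2, ← Finset.sum_image
    (f := fun p : (ℤ × ℤ) × (ℤ × ℤ) => col A s ((val 3 p.1 - val 3 p.2) • w)) hinj]
  refine Finset.sum_le_sum_of_subset ?_
  intro p hp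
  obtain ⟨⟨m, j⟩, ht, rfl⟩ := Finset.mem_image.1 hp
  simp only [Finset.mem_product, Finset.mem_Icc, Finset.mem_Ico] at ht
  have h3 : half P 3 = Finset.Ico 0 (2 * M) ×ˢ {0} := by
    simp only [half, hM]; norm_num
    congr 1; ring_nf
  rw [h3]
  simp only [g]
  split_ifs <;> simp only [Finset.mem_product, Finset.mem_Ico, Finset.mem_singleton] <;>
    refine ⟨⟨⟨?_, ?_⟩, trivial⟩, ⟨⟨?_, ?_⟩, trivial⟩⟩ <;> omega

/-- Weyl differencing: a fourth power column is replaced by a Fejér kernel. -/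
theorem exists_weyl (ε : ℝ) (hε : 0 < ε) :
    ∃ C : ℝ, 1 ≤ C ∧ ∀ P : ℕ, 1 ≤ P → ∀ {α Q : Type*} [AddCommGroup Q] (A : Finset α)
      (s : α → Q) (w : Q),
      ((∑ p ∈ half P 2, ∑ q ∈ half P 2, col A s ((val 2 p - val 2 q) • w) : ℕ) : ℝ) ≤
        C * (P : ℝ) ^ 3 * col A s 0 + C * (P : ℝ) ^ (-2 + ε) *
          ((∑ p ∈ half P 3, ∑ q ∈ half P 3, col A s ((val 3 p - val 3 q) • w) : ℕ) : ℝ) := by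
  obtain ⟨C, hC, hW⟩ := exists_card_weylTriples_le ε hε
  -- There are at most 5P values of h. The 39P² triples of value zero give the term 195P³, and the
  -- non-zero values give P · P^ε / P³ = P^(-2+ε), where P³ is the multiplicity in the Fejér kernel.
  refine ⟨195 * C, by linarith, fun P hP α Q _ A s w => ?_⟩
  classical
  set I := Finset.Icc (-(2 * P : ℤ)) (2 * P) with hI
  have hIc : (I.card : ℝ) ≤ 5 * P := by
    have : I.card ≤ 5 * P := by simp [hI]; omega
    exact_mod_cast this
  have hP' : (0 : ℝ) < P := by exact_mod_cast hP
  set J := Finset.Icc (-(48 * (P : ℤ) ^ 3)) (48 * (P : ℤ) ^ 3) with hJ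
  set T3 := ∑ p ∈ half P 3, ∑ q ∈ half P 3, col A s ((val 3 p - val 3 q) • w) with hT3
  set SJ := ∑ m ∈ J, col A s (m • w) with hSJ
  have h1 : (48 * (P : ℝ) ^ 3) * SJ ≤ T3 := by
    have := sum_col_Icc_le P A s w
    exact_mod_cast this
  have h2 : (∑ p ∈ half P 2, ∑ q ∈ half P 2, col A s ((val 2 p - val 2 q) • w)) ≤
      I.card * ∑ t ∈ I ×ˢ box P ×ˢ box P,
        col A s ((3 * t.1 * (t.2.1 - t.2.2) * (t.2.1 + t.2.2 + t.1)) • w) := by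
    rw [sum_col_half_two_eq]
    refine (collisions_le_card_mul (A ×ˢ box P ×ˢ box P)
      (fun b => s b.1 + (b.2.1 ^ 3 - b.2.2 ^ 3) • w) (fun b => b.2.1 - b.2.2) I ?_).trans ?_
    · intro b hb
      simp only [Finset.mem_product, box, hI, Finset.mem_Icc] at hb ⊢
      omega
    · exact Nat.mul_le_mul_left _ (collisions_le_sum_col P A s w)
  have h3 : (∑ t ∈ I ×ˢ box P ×ˢ box P,
        col A s ((3 * t.1 * (t.2.1 - t.2.2) * (t.2.1 + t.2.2 + t.1)) • w)) =
      ∑ m ∈ J, (weylTriples P m).card * col A s (m • w) := by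
    rw [← Finset.sum_fiberwise_of_maps_to
      (g := fun t : ℤ × ℤ × ℤ => 3 * t.1 * (t.2.1 - t.2.2) * (t.2.1 + t.2.2 + t.1)) (t := J)]
    · refine Finset.sum_congr rfl fun m _ => ?_
      rw [← smul_eq_mul, ← Finset.sum_const]
      refine Finset.sum_congr rfl fun t ht => ?_
      rw [(Finset.mem_filter.1 ht).2]
    · intro t ht
      have : t ∈ weylTriples P (3 * t.1 * (t.2.1 - t.2.2) * (t.2.1 + t.2.2 + t.1)) :=
        Finset.mem_filter.2 ⟨ht, rfl⟩
      have := abs_le.1 (abs_le_of_mem_weylTriples this)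
      exact Finset.mem_Icc.2 this
  have h4 : ((∑ m ∈ J, (weylTriples P m).card * col A s (m • w) : ℕ) : ℝ) ≤
      39 * (P : ℝ) ^ 2 * col A s 0 + C * (P : ℝ) ^ ε * SJ := by
    have h5 : ∀ m ∈ J, ((weylTriples P m).card : ℝ) * col A s (m • w) ≤
        (if m = 0 then 39 * (P : ℝ) ^ 2 * col A s 0 else 0) +
          C * (P : ℝ) ^ ε * col A s (m • w) := by
      intro m _
      split_ifs with h0
      · subst h0
        have : ((weylTriples P 0).card : ℝ) ≤ 39 * (P : ℝ) ^ 2 := by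
          exact_mod_cast card_weylTriples_zero_le hP
        rw [zero_smul]
        have h6 : (0 : ℝ) ≤ C * (P : ℝ) ^ ε * col A s 0 := by positivity
        have h7 : ((weylTriples P 0).card : ℝ) * col A s 0 ≤
          39 * (P : ℝ) ^ 2 * col A s 0 := by gcongr
        linarith
      · have := hW P hP m h0
        rw [zero_add]
        gcongr
    push_cast
    refine (Finset.sum_le_sum h5).trans ?_
    rw [Finset.sum_add_distrib, ← Finset.mul_sum, Finset.sum_ite_eq']
    have h0J : (0 : ℤ) ∈ J := by simp [hJ]
    rw [if_pos h0J]
    simp only [hSJ]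
    push_cast
    exact le_rfl
  have h6 : ((∑ p ∈ half P 2, ∑ q ∈ half P 2, col A s ((val 2 p - val 2 q) • w) : ℕ) : ℝ) ≤
      5 * P * (39 * (P : ℝ) ^ 2 * col A s 0 + C * (P : ℝ) ^ ε * SJ) := by
    calc _ ≤ ((I.card * ∑ m ∈ J, (weylTriples P m).card * col A s (m • w) : ℕ) : ℝ) := by
          rw [← h3]; exact Nat.cast_le.2 h2
      _ ≤ _ := by
          rw [Nat.cast_mul]
          exact mul_le_mul hIc h4 (Nat.cast_nonneg _) (by positivity)
  have h7 : (P : ℝ) ^ (-2 + ε) = (P : ℝ) ^ ε / (P : ℝ) ^ 2 := by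
    rw [add_comm, Real.rpow_add hP', Real.rpow_neg hP'.le, div_eq_mul_inv]
    norm_cast
  have h8 : (SJ : ℝ) ≤ T3 / (48 * (P : ℝ) ^ 3) := by
    rw [le_div_iff₀ (by positivity)]
    linarith
  refine h6.trans ?_
  rw [h7]
  have hc0 : (0 : ℝ) ≤ col A s 0 := Nat.cast_nonneg _
  have hT0 : (0 : ℝ) ≤ T3 := Nat.cast_nonneg _
  have hPe : (0 : ℝ) ≤ (P : ℝ) ^ ε := by positivity
  clear_value T3 SJ
  generalize ((col A s 0 : ℕ) : ℝ) = c0 at *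
  generalize (P : ℝ) ^ ε = Pe at *
  calc 5 * (P : ℝ) * (39 * (P : ℝ) ^ 2 * c0 + C * Pe * SJ)
      ≤ 5 * P * (39 * (P : ℝ) ^ 2 * c0 + C * Pe * (T3 / (48 * (P : ℝ) ^ 3))) := by
        gcongr
    _ = 195 * 1 * (P : ℝ) ^ 3 * c0 + (5 / 48) * (C * (Pe / (P : ℝ) ^ 2) * T3) := by
        field_simp
        ring
    _ ≤ 195 * C * (P : ℝ) ^ 3 * c0 + 195 * (C * (Pe / (P : ℝ) ^ 2) * T3) := by
        have : 0 ≤ C * (Pe / (P : ℝ) ^ 2) * T3 := by positivity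
        have : 195 * 1 * (P : ℝ) ^ 3 * c0 ≤ 195 * C * (P : ℝ) ^ 3 * c0 := by gcongr
        linarith
    _ = _ := by ring

end Weyl

/-! ### Solutions modulo a subspace: deletion, contraction and splitting. -/

section Count

variable {E W : Type*} [Fintype E] [DecidableEq E] [AddCommGroup W] [Module ℚ W]

/-- Configurations of half variables for the kinds `κ`. -/
noncomputable def conf (P : ℕ) (κ : E → ℕ) : Finset (E → ℤ × ℤ) :=
  Fintype.piFinset fun e => half P (κ e)

/-- The vector attached to a configuration of half variables. -/
def lin (v : E → W) (κ : E → ℕ) (a : E → ℤ × ℤ) : W := ∑ e, val (κ e) (a e) • v e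

/-- Number of solutions of the system of equations modulo `K` attached to the vectors `v` with the
kinds of variables given by `κ`. -/
noncomputable def cnt (P : ℕ) (v : E → W) (κ : E → ℕ) (K : Submodule ℚ W) : ℕ :=
  col (conf P κ) (fun a => K.mkQ (lin v κ a)) 0

open scoped Classical in
theorem col_mkQ {α : Type*} (A : Finset α) (f : α → W) (K : Submodule ℚ W) (y : W) :
    col A (fun a => K.mkQ (f a)) (K.mkQ y) =
      ∑ a ∈ A, ∑ b ∈ A, if f a - f b + y ∈ K then 1 else 0 := by
  unfold col
  refine Finset.sum_congr rfl fun a _ => Finset.sum_congr rfl fun b _ => ?_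
  have : (K.mkQ (f a) - K.mkQ (f b) + K.mkQ y = 0) ↔ f a - f b + y ∈ K := by
    rw [← map_sub, ← map_add, Submodule.mkQ_apply, Submodule.Quotient.mk_eq_zero]
  by_cases h : f a - f b + y ∈ K
  · rw [if_pos h, if_pos (this.2 h)]
  · rw [if_neg h, if_neg fun h' => h (this.1 h')]

open scoped Classical in
theorem cnt_eq (P : ℕ) (v : E → W) (κ : E → ℕ) (K : Submodule ℚ W) :
    cnt P v κ K = ∑ a ∈ conf P κ, ∑ b ∈ conf P κ,
      if lin v κ a - lin v κ b ∈ K then 1 else 0 := by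
  have := col_mkQ (conf P κ) (lin v κ) K 0
  rw [map_zero] at this
  simp only [add_zero] at this
  exact this

/-- An element switched to kind `0` keeps exactly one half variable, `(0, 0)`, so one coordinate can
be split off without changing the index type. -/
theorem sum_conf {M : Type*} [AddCommMonoid M] (P : ℕ) (κ : E → ℕ) (e : E)
    (F : (E → ℤ × ℤ) → M) :
    ∑ a ∈ conf P κ, F a =
      ∑ p ∈ half P (κ e), ∑ a ∈ conf P (Function.update κ e 0), F (Function.update a e p) := by
  rw [← Finset.sum_product']
  refine Finset.sum_nbij' (fun a => (a e, Function.update a e (0, 0)))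
    (fun t => Function.update t.2 e t.1) ?_ ?_ ?_ ?_ ?_
  · intro a ha
    simp only [conf, Fintype.mem_piFinset, Finset.mem_product] at ha ⊢
    refine ⟨ha e, fun f => ?_⟩
    by_cases hf : f = e
    · subst hf; simp [half_zero]
    · simp [hf, ha f]
  · rintro ⟨p, a⟩ ht
    simp only [conf, Fintype.mem_piFinset, Finset.mem_product] at ht ⊢
    intro f
    by_cases hf : f = e
    · subst hf; simpa using ht.1
    · simpa [hf] using ht.2 f
  · intro a _
    simp
  · rintro ⟨p, a⟩ ht
    simp only [conf, Fintype.mem_piFinset, Finset.mem_product] at ht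
    have h := ht.2 e
    simp only [Function.update_self, half_zero, Finset.mem_singleton] at h
    simp [← h]
  · intro a _
    simp

theorem lin_update (P : ℕ) (v : E → W) (κ : E → ℕ) (e : E) (p : ℤ × ℤ) {a : E → ℤ × ℤ}
    (ha : a ∈ conf P (Function.update κ e 0)) :
    lin v κ (Function.update a e p) =
      lin v (Function.update κ e 0) a + val (κ e) p • v e := by
  have h : a e = (0, 0) := by
    have := (Fintype.mem_piFinset.1 ha) e
    simpa [half_zero] using this
  unfold lin
  rw [← Finset.add_sum_erase _ _ (Finset.mem_univ e),
    ← Finset.add_sum_erase _ (fun f => val (Function.update κ e 0 f) (a f) • v f)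
      (Finset.mem_univ e)]
  simp only [Function.update_self, h, val_zero, zero_smul, zero_add]
  rw [add_comm]
  congr 1
  refine Finset.sum_congr rfl fun f hf => ?_
  have hf' := Finset.ne_of_mem_erase hf
  simp [hf']

theorem cnt_eq_sum (P : ℕ) (v : E → W) (κ : E → ℕ) (K : Submodule ℚ W) (e : E) :
    cnt P v κ K = ∑ p ∈ half P (κ e), ∑ q ∈ half P (κ e),
      col (conf P (Function.update κ e 0))
        (fun a => K.mkQ (lin v (Function.update κ e 0) a))
        ((val (κ e) p - val (κ e) q) • K.mkQ (v e)) := by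
  classical
  simp only [← map_zsmul, col_mkQ, cnt_eq]
  rw [sum_conf P κ e]
  refine Finset.sum_congr rfl fun p _ => ?_
  conv_rhs => rw [Finset.sum_comm]
  refine Finset.sum_congr rfl fun a ha => ?_
  rw [sum_conf P κ e]
  refine Finset.sum_congr rfl fun q _ => Finset.sum_congr rfl fun b hb => ?_
  have : lin v κ (Function.update a e p) - lin v κ (Function.update b e q) =
      lin v (Function.update κ e 0) a - lin v (Function.update κ e 0) b +
        (val (κ e) p - val (κ e) q) • v e := by
    rw [lin_update P v κ e p ha, lin_update P v κ e q hb, sub_smul]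
    abel
  rw [this]

theorem cnt_mono (P : ℕ) (v : E → W) (κ : E → ℕ) {K K' : Submodule ℚ W} (h : K ≤ K') :
    cnt P v κ K ≤ cnt P v κ K' := by
  rw [cnt_eq, cnt_eq]
  refine Finset.sum_le_sum fun a _ => Finset.sum_le_sum fun b _ => ?_
  split_ifs with h1 h2
  · exact le_rfl
  · exact absurd (h h1) h2
  · exact Nat.zero_le _
  · exact le_rfl

/-- Fixing the variables of `e` only shifts the remaining collision count, and a shift never
increases it. -/
theorem cnt_delete (P : ℕ) (v : E → W) (κ : E → ℕ) (K : Submodule ℚ W) (e : E) :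
    cnt P v κ K ≤ (half P (κ e)).card ^ 2 * cnt P v (Function.update κ e 0) K := by
  rw [cnt_eq_sum P v κ K e]
  calc _ ≤ ∑ _p ∈ half P (κ e), ∑ _q ∈ half P (κ e), cnt P v (Function.update κ e 0) K :=
        Finset.sum_le_sum fun p _ => Finset.sum_le_sum fun q _ => col_le_col_zero _ _ _
    _ = _ := by simp only [Finset.sum_const, smul_eq_mul]; ring

theorem sum_half_eq_sum_coll (P k : ℕ) (F : ℤ → ℕ) :
    ∑ p ∈ half P k, ∑ q ∈ half P k, F (val k p - val k q) =
      ∑ m ∈ (half P k ×ˢ half P k).image fun p => val k p.1 - val k p.2, coll P k m * F m := by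
  rw [← Finset.sum_product', ← Finset.sum_fiberwise_of_maps_to
    (g := fun p : (ℤ × ℤ) × (ℤ × ℤ) => val k p.1 - val k p.2)
    (t := (half P k ×ˢ half P k).image fun p => val k p.1 - val k p.2)]
  · refine Finset.sum_congr rfl fun m _ => ?_
    rw [coll, ← smul_eq_mul, ← Finset.sum_const]
    refine Finset.sum_congr rfl fun t ht => ?_
    rw [(Finset.mem_filter.1 ht).2]
  · intro t ht
    exact Finset.mem_image_of_mem _ ht

/-- As `v e ∉ K`, a pair of configurations satisfies the shifted condition for at most one `m`, and
it then satisfies the condition modulo the enlarged space. -/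
theorem sum_col_le_cnt_sup (P : ℕ) (v : E → W) (κ : E → ℕ) (K : Submodule ℚ W) {e : E}
    (he : v e ∉ K) (U : Finset ℤ) :
    ∑ m ∈ U, col (conf P κ) (fun a => K.mkQ (lin v κ a)) (m • K.mkQ (v e)) ≤
      cnt P v κ (K ⊔ Submodule.span ℚ {v e}) := by
  classical
  simp only [← map_zsmul, col_mkQ, cnt_eq]
  rw [Finset.sum_comm]
  refine Finset.sum_le_sum fun a _ => ?_
  rw [Finset.sum_comm]
  refine Finset.sum_le_sum fun b _ => ?_
  set x := lin v κ a - lin v κ b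
  by_cases h : ∃ m ∈ U, x + m • v e ∈ K
  · obtain ⟨m, hm, hmK⟩ := h
    rw [Finset.sum_eq_single m]
    · rw [if_pos hmK, if_pos]
      have : x = (x + m • v e) + ((-m : ℤ) : ℚ) • v e := by
        rw [Int.cast_smul_eq_zsmul]; simp
      rw [this]
      exact Submodule.add_mem_sup hmK (Submodule.smul_mem _ _ (Submodule.mem_span_singleton_self _))
    · intro m' _ hne
      rw [if_neg]
      intro hm'K
      apply he
      have h1 : ((m - m' : ℤ) : ℚ) • v e ∈ K := by
        rw [Int.cast_smul_eq_zsmul]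
        have := K.sub_mem hmK hm'K
        rwa [add_sub_add_left_eq_sub, ← sub_smul] at this
      have h2 : ((m - m' : ℤ) : ℚ) ≠ 0 := by
        exact_mod_cast sub_ne_zero.2 hne.symm
      exact (Submodule.smul_mem_iff K h2).1 h1
    · intro h; exact absurd hm h
  · push Not at h
    rw [Finset.sum_eq_zero fun m hm => if_neg (h m hm)]
    exact Nat.zero_le _

theorem cnt_contract {P : ℕ} {v : E → W} {κ : E → ℕ} {K : Submodule ℚ W} {e : E} {B : ℝ}
    (hB : ∀ m, (coll P (κ e) m : ℝ) ≤ B) (he : v e ∉ K) :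
    (cnt P v κ K : ℝ) ≤
      B * cnt P v (Function.update κ e 0) (K ⊔ Submodule.span ℚ {v e}) := by
  have hB0 : 0 ≤ B := le_trans (Nat.cast_nonneg _) (hB 0)
  rw [cnt_eq_sum P v κ K e, sum_half_eq_sum_coll P (κ e) fun m =>
    col (conf P (Function.update κ e 0)) (fun a => K.mkQ (lin v (Function.update κ e 0) a))
      (m • K.mkQ (v e))]
  push_cast
  refine (Finset.sum_le_sum fun m _ => mul_le_mul_of_nonneg_right (hB m) (Nat.cast_nonneg _)).trans
    ?_
  rw [← Finset.mul_sum]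
  refine mul_le_mul_of_nonneg_left ?_ hB0
  exact_mod_cast sum_col_le_cnt_sup P v (Function.update κ e 0) K he _

/-- The value `m = 0` leaves the condition modulo `K` untouched, while all other values are absorbed
by the contraction. For kind `1` this pays, since `B₀` is about P and `B` only P^ε. -/
theorem cnt_split {P : ℕ} {v : E → W} {κ : E → ℕ} {K : Submodule ℚ W} {e : E} {B₀ B : ℝ}
    (hB₀ : (coll P (κ e) 0 : ℝ) ≤ B₀) (hB : ∀ m, m ≠ 0 → (coll P (κ e) m : ℝ) ≤ B)
    (hB' : 0 ≤ B) (he : v e ∉ K) :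
    (cnt P v κ K : ℝ) ≤ B₀ * cnt P v (Function.update κ e 0) K +
      B * cnt P v (Function.update κ e 0) (K ⊔ Submodule.span ℚ {v e}) := by
  have hB₀' : 0 ≤ B₀ := le_trans (Nat.cast_nonneg _) hB₀
  rw [cnt_eq_sum P v κ K e, sum_half_eq_sum_coll P (κ e) fun m =>
    col (conf P (Function.update κ e 0)) (fun a => K.mkQ (lin v (Function.update κ e 0) a))
      (m • K.mkQ (v e))]
  set U := (half P (κ e) ×ˢ half P (κ e)).image fun p => val (κ e) p.1 - val (κ e) p.2
  set G : ℤ → ℕ := fun m => col (conf P (Function.update κ e 0))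
    (fun a => K.mkQ (lin v (Function.update κ e 0) a)) (m • K.mkQ (v e)) with hG
  have h0 : cnt P v (Function.update κ e 0) K = G 0 := by
    simp only [hG, zero_smul]; rfl
  have h1 : ∑ m ∈ U, G m ≤ cnt P v (Function.update κ e 0) (K ⊔ Submodule.span ℚ {v e}) :=
    sum_col_le_cnt_sup P v (Function.update κ e 0) K he _
  have h2 : ∀ m ∈ U, (coll P (κ e) m : ℝ) * G m ≤ (if m = 0 then B₀ * G 0 else 0) + B * G m := by
    intro m _
    split_ifs with hm
    · subst hm
      have := mul_le_mul_of_nonneg_right hB₀ (Nat.cast_nonneg (α := ℝ) (G 0))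
      have : 0 ≤ B * G 0 := mul_nonneg hB' (Nat.cast_nonneg _)
      linarith
    · rw [zero_add]
      exact mul_le_mul_of_nonneg_right (hB m hm) (Nat.cast_nonneg _)
  rw [h0]
  push_cast
  refine (Finset.sum_le_sum h2).trans ?_
  rw [Finset.sum_add_distrib, ← Finset.mul_sum, Finset.sum_ite_eq']
  refine add_le_add ?_ (mul_le_mul_of_nonneg_left (by exact_mod_cast h1) hB')
  split_ifs
  · exact le_rfl
  · positivity

theorem exists_cnt_weyl (ε : ℝ) (hε : 0 < ε) :
    ∃ C : ℝ, 1 ≤ C ∧ ∀ P : ℕ, 1 ≤ P → ∀ (v : E → W) (κ : E → ℕ) (K : Submodule ℚ W) (e : E),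
      κ e = 2 → (cnt P v κ K : ℝ) ≤ C * (P : ℝ) ^ 3 * cnt P v (Function.update κ e 0) K +
        C * (P : ℝ) ^ (-2 + ε) * cnt P v (Function.update κ e 3) K := by
  obtain ⟨C, hC, h⟩ := exists_weyl ε hε
  refine ⟨C, hC, fun P hP v κ K e he => ?_⟩
  rw [cnt_eq_sum P v κ K e, cnt_eq_sum P v (Function.update κ e 3) K e]
  simp only [he, Function.update_self, Function.update_idem]
  exact h P hP _ _ _

end Count

/-! ### Independence and general position modulo a subspace. -/

section Spans

variable {E W : Type*} [DecidableEq E] [AddCommGroup W] [Module ℚ W]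

/-- The span of the vectors indexed by a finite set. -/
def sp (v : E → W) (I : Finset E) : Submodule ℚ W := Submodule.span ℚ (v '' (I : Set E))

theorem mem_sp {v : E → W} {I : Finset E} {e : E} (he : e ∈ I) : v e ∈ sp v I :=
  Submodule.subset_span (Set.mem_image_of_mem _ (Finset.mem_coe.2 he))

theorem sp_le_iff {v : E → W} {I : Finset E} {K : Submodule ℚ W} :
    sp v I ≤ K ↔ ∀ e ∈ I, v e ∈ K := by
  rw [sp, Submodule.span_le, Set.image_subset_iff]
  rfl

theorem sp_mono {v : E → W} {I J : Finset E} (h : I ⊆ J) : sp v I ≤ sp v J :=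
  sp_le_iff.2 fun _ he => mem_sp (h he)

theorem sp_union (v : E → W) (I J : Finset E) : sp v (I ∪ J) = sp v I ⊔ sp v J := by
  rw [sp, Finset.coe_union, Set.image_union, Submodule.span_union]
  rfl

theorem sp_singleton (v : E → W) (e : E) : sp v {e} = Submodule.span ℚ {v e} := by
  rw [sp, Finset.coe_singleton, Set.image_singleton]

theorem sp_empty (v : E → W) : sp v (∅ : Finset E) = ⊥ := by
  rw [sp, Finset.coe_empty, Set.image_empty, Submodule.span_empty]

theorem sp_insert (v : E → W) (e : E) (I : Finset E) :
    sp v (insert e I) = Submodule.span ℚ {v e} ⊔ sp v I := by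
  rw [Finset.insert_eq, sp_union, sp_singleton]

variable [FiniteDimensional ℚ W]

theorem finrank_sp_le (v : E → W) (I : Finset E) : Module.finrank ℚ (sp v I) ≤ I.card := by
  classical
  rw [sp, ← Finset.coe_image]
  exact (finrank_span_finset_le_card _).trans Finset.card_image_le

theorem finrank_sup_sp_le (v : E → W) (K : Submodule ℚ W) (I : Finset E) :
    Module.finrank ℚ (K ⊔ sp v I : Submodule ℚ W) ≤ Module.finrank ℚ K + I.card :=
  (Submodule.finrank_add_le_finrank_add_finrank _ _).trans
    (Nat.add_le_add_left (finrank_sp_le v I) _)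

/-- The vectors indexed by `I` are independent modulo `K`. -/
def FreeMod (v : E → W) (K : Submodule ℚ W) (I : Finset E) : Prop :=
  Module.finrank ℚ (K ⊔ sp v I : Submodule ℚ W) = Module.finrank ℚ K + I.card

theorem FreeMod.of_insert {v : E → W} {K : Submodule ℚ W} {I : Finset E} {e : E} (he : e ∉ I)
    (h : FreeMod v K (insert e I)) :
    v e ∉ K ∧ FreeMod v (K ⊔ Submodule.span ℚ {v e}) I := by
  unfold FreeMod at *
  rw [sp_insert, ← sup_assoc, Finset.card_insert_of_notMem he] at h
  have h1 := finrank_sup_sp_le v (K ⊔ Submodule.span ℚ {v e}) I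
  have h2 := finrank_sup_sp_le v K {e}
  rw [sp_singleton, Finset.card_singleton] at h2
  refine ⟨fun hK => ?_, by omega⟩
  have : K ⊔ Submodule.span ℚ {v e} = K :=
    sup_eq_left.2 ((Submodule.span_singleton_le_iff_mem _ _).2 hK)
  rw [this] at h h1
  omega

/-- Submodularity of the rank: the rank of `I` modulo the smaller space is at least that modulo the
larger one. -/
theorem FreeMod.anti {v : E → W} {K K' : Submodule ℚ W} {I : Finset E} (hK : K ≤ K')
    (h : FreeMod v K' I) : FreeMod v K I := by
  unfold FreeMod at *
  have h1 := Submodule.finrank_sup_add_finrank_inf_eq K' (K ⊔ sp v I)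
  have h2 : K' ⊔ (K ⊔ sp v I) = K' ⊔ sp v I := by
    rw [← sup_assoc, sup_eq_left.2 hK]
  have h3 : Module.finrank ℚ K ≤ Module.finrank ℚ (K' ⊓ (K ⊔ sp v I) : Submodule ℚ W) :=
    Submodule.finrank_mono (le_inf hK le_sup_left)
  have h4 := finrank_sup_sp_le v K I
  rw [h2] at h1
  omega

theorem exists_freeMod (v : E → W) (K : Submodule ℚ W) (S : Finset E) :
    ∃ I ⊆ S, FreeMod v K I ∧ sp v S ≤ K ⊔ sp v I := by
  induction S using Finset.induction_on with
  | empty => exact ⟨∅, le_rfl, by rw [FreeMod, sp_empty, sup_bot_eq]; simp, by simp [sp_empty]⟩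
  | insert e S he ih =>
    obtain ⟨I, hI, hf, hs⟩ := ih
    by_cases h : v e ∈ K ⊔ sp v I
    · refine ⟨I, hI.trans (Finset.subset_insert _ _), hf, ?_⟩
      rw [sp_insert]
      exact sup_le ((Submodule.span_singleton_le_iff_mem _ _).2 h) hs
    · have heI : e ∉ I := fun h' => he (hI h')
      refine ⟨insert e I, Finset.insert_subset_insert _ hI, ?_, ?_⟩
      · unfold FreeMod at *
        have h1 := finrank_sup_sp_le v K (insert e I)
        rw [Finset.card_insert_of_notMem heI] at *
        have h2 : K ⊔ sp v I < K ⊔ sp v (insert e I) := by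
          refine lt_of_le_of_ne (sup_le_sup_left (sp_mono (Finset.subset_insert _ _)) _) ?_
          intro heq
          apply h
          rw [heq]
          exact Submodule.mem_sup_right (mem_sp (Finset.mem_insert_self _ _))
        have h3 := Submodule.finrank_lt_finrank_of_lt h2
        omega
      · rw [sp_insert, sp_insert]
        refine sup_le (le_sup_of_le_right le_sup_left) (hs.trans ?_)
        exact sup_le_sup_left le_sup_right _

/-- Modulo `K`, the vectors indexed by `G` lie in general position in the space `H`, which is
`d`-dimensional modulo `K`. -/
structure Unif (v : E → W) (K H : Submodule ℚ W) (G : Finset E) (d : ℕ) : Prop where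
  le : K ≤ H
  mem : ∀ e ∈ G, v e ∈ H
  rank : Module.finrank ℚ K + d = Module.finrank ℚ H
  spans : ∀ S ⊆ G, S.card = d → H ≤ K ⊔ sp v S

theorem Unif.mono {v : E → W} {K H : Submodule ℚ W} {G G' : Finset E} {d : ℕ}
    (h : Unif v K H G d) (hG : G' ⊆ G) : Unif v K H G' d :=
  ⟨h.le, fun e he => h.mem e (hG he), h.rank, fun S hS => h.spans S (hS.trans hG)⟩

/-- `I` extends to a set of `d + I.card` vectors of `G`, which spans `H` modulo `K`; comparing
ranks, `I` must be independent. Further sets of `d` vectors span because their unions with `I` do.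
-/
theorem Unif.contract {v : E → W} {K H : Submodule ℚ W} {G G' I : Finset E} {d : ℕ}
    (h : Unif v K H G (d + I.card)) (hI : I ⊆ G) (hd : d + I.card ≤ G.card) (hG' : G' ⊆ G)
    (hdisj : Disjoint I G') :
    FreeMod v K I ∧ Unif v (K ⊔ sp v I) H G' d := by
  have hle : K ⊔ sp v I ≤ H := sup_le h.le (sp_le_iff.2 fun e he => h.mem e (hI he))
  have hfree : FreeMod v K I := by
    obtain ⟨S, hIS, hSG, hS⟩ := Finset.exists_subsuperset_card_eq hI
      (show I.card ≤ d + I.card by omega) hd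
    have h1 := h.spans S hSG hS
    have h2 : K ⊔ sp v S ≤ (K ⊔ sp v I) ⊔ sp v (S \ I) := by
      rw [sup_assoc, ← sp_union]
      exact sup_le_sup_left (sp_mono (by simp)) _
    have h3 := Submodule.finrank_mono (h1.trans h2)
    have h4 := finrank_sup_sp_le v (K ⊔ sp v I) (S \ I)
    have h5 := finrank_sup_sp_le v K I
    have h6 := Finset.card_sdiff_add_card_eq_card hIS
    have h7 := h.rank
    unfold FreeMod
    omega
  refine ⟨hfree, hle, fun e he => h.mem e (hG' he), ?_, fun S hS hSc => ?_⟩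
  · have := h.rank
    unfold FreeMod at hfree
    omega
  · have hd : Disjoint I S := hdisj.mono_right hS
    have := h.spans (I ∪ S) (Finset.union_subset hI (hS.trans hG'))
      (by rw [Finset.card_union_of_disjoint hd]; omega)
    rwa [sp_union, ← sup_assoc] at this

theorem Unif.contract_one {v : E → W} {K H : Submodule ℚ W} {G : Finset E} {d : ℕ} {e : E}
    (h : Unif v K H G (d + 1)) (he : e ∈ G) (hd : d + 1 ≤ G.card) :
    v e ∉ K ∧ Unif v (K ⊔ Submodule.span ℚ {v e}) H (G.erase e) d := by
  obtain ⟨h1, h2⟩ := Unif.contract (I := {e}) (G' := G.erase e) (by simpa using h)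
    (Finset.singleton_subset_iff.2 he) (by simpa using hd) (Finset.erase_subset _ _)
    (by simp)
  rw [sp_singleton] at h2
  refine ⟨?_, h2⟩
  have h3 : FreeMod v K (insert e ∅) := by simpa using h1
  exact (FreeMod.of_insert (by simp) h3).1

end Spans

/-! ### Switching off sets of variables. -/

section Off

variable {E : Type*} [DecidableEq E]

/-- Remove all variables of the elements of `D`. -/
def off (D : Finset E) (κ : E → ℕ) : E → ℕ := fun e => if e ∈ D then 0 else κ e

theorem off_empty (κ : E → ℕ) : off ∅ κ = κ := by
  funext f
  simp [off]

theorem off_insert (D : Finset E) (κ : E → ℕ) (e : E) :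
    off (insert e D) κ = off D (Function.update κ e 0) := by
  funext f
  by_cases hf : f = e
  · subst hf; simp [off]
  · simp [off, hf]

theorem off_union (D I : Finset E) (κ : E → ℕ) : off (D ∪ I) κ = off I (off D κ) := by
  funext f
  by_cases h : f ∈ I <;> by_cases h' : f ∈ D <;> simp [off, h, h']

end Off

/-! ### Uniform bounds for classes of systems and the cost of each move. -/

section Bounds

variable {E W : Type*} [Fintype E] [DecidableEq E] [AddCommGroup W] [Module ℚ W]

/-- All systems in the class `C` have at most `O(P ^ (a + ε))` solutions, uniformly. -/
def Bnd (C : (E → W) → (E → ℕ) → Submodule ℚ W → Prop) (a : ℤ) : Prop :=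
  ∀ ε : ℝ, 0 < ε → ∃ c : ℝ, 0 ≤ c ∧ ∀ P : ℕ, 1 ≤ P → ∀ v κ K, C v κ K →
    (cnt P v κ K : ℝ) ≤ c * (P : ℝ) ^ ((a : ℝ) + ε)

variable {C C' C₁ C₂ : (E → W) → (E → ℕ) → Submodule ℚ W → Prop} {a a₁ a₂ : ℤ}

/-- Enlarging `K` relaxes the equations, so the target class only has to contain the system modulo
some larger space. -/
theorem Bnd.mono (h : Bnd C' a₁) (hC : ∀ v κ K, C v κ K → ∃ K', K ≤ K' ∧ C' v κ K')
    (ha : a₁ ≤ a) : Bnd C a := by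
  intro ε hε
  obtain ⟨c, hc, hb⟩ := h ε hε
  refine ⟨c, hc, fun P hP v κ K hCK => ?_⟩
  obtain ⟨K', hK, hC'⟩ := hC v κ K hCK
  have hP' : (1 : ℝ) ≤ P := by exact_mod_cast hP
  have ha' : (a₁ : ℝ) ≤ a := by exact_mod_cast ha
  calc (cnt P v κ K : ℝ) ≤ cnt P v κ K' := by exact_mod_cast cnt_mono P v κ hK
    _ ≤ c * (P : ℝ) ^ ((a₁ : ℝ) + ε) := hb P hP v κ K' hC'
    _ ≤ _ := by gcongr

/-- Two-branch moves: combine bounds for two derived systems. -/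
theorem Bnd.branch {b₁ b₂ : ℤ} (h₁ : Bnd C₁ a₁) (h₂ : Bnd C₂ a₂) (ha₁ : a₁ + b₁ ≤ a)
    (ha₂ : a₂ + b₂ ≤ a)
    (hC : ∀ ε : ℝ, 0 < ε → ∃ c : ℝ, 0 ≤ c ∧ ∀ P : ℕ, 1 ≤ P → ∀ v κ K, C v κ K →
      ∃ κ₁ K₁ κ₂ K₂, C₁ v κ₁ K₁ ∧ C₂ v κ₂ K₂ ∧
        (cnt P v κ K : ℝ) ≤ c * (P : ℝ) ^ ((b₁ : ℝ) + ε) * cnt P v κ₁ K₁ +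
          c * (P : ℝ) ^ ((b₂ : ℝ) + ε) * cnt P v κ₂ K₂) : Bnd C a := by
  intro ε hε
  obtain ⟨c₁, hc₁, hb₁⟩ := h₁ (ε / 2) (by positivity)
  obtain ⟨c₂, hc₂, hb₂⟩ := h₂ (ε / 2) (by positivity)
  obtain ⟨c, hc, hb⟩ := hC (ε / 2) (by positivity)
  refine ⟨c * c₁ + c * c₂, by positivity, fun P hP v κ K hCK => ?_⟩
  obtain ⟨κ₁, K₁, κ₂, K₂, h1, h2, h3⟩ := hb P hP v κ K hCK
  have hP' : (1 : ℝ) ≤ P := by exact_mod_cast hP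
  have hP0 : (0 : ℝ) < P := by linarith
  have key : ∀ (a' b' : ℤ) (c' : ℝ) (N : ℝ), 0 ≤ c' → a' + b' ≤ a →
      N ≤ c' * (P : ℝ) ^ ((a' : ℝ) + ε / 2) →
      c * (P : ℝ) ^ ((b' : ℝ) + ε / 2) * N ≤ c * c' * (P : ℝ) ^ ((a : ℝ) + ε) := by
    intro a' b' c' N hc' ha' hN
    have ha'' : (a' : ℝ) + b' ≤ a := by exact_mod_cast ha'
    calc _ ≤ c * (P : ℝ) ^ ((b' : ℝ) + ε / 2) * (c' * (P : ℝ) ^ ((a' : ℝ) + ε / 2)) := by gcongr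
      _ = c * c' * ((P : ℝ) ^ ((b' : ℝ) + ε / 2) * (P : ℝ) ^ ((a' : ℝ) + ε / 2)) := by ring
      _ = c * c' * (P : ℝ) ^ ((a' : ℝ) + b' + ε) := by
        rw [← Real.rpow_add hP0]; congr 2; ring
      _ ≤ _ := by gcongr
  have k1 := key a₁ b₁ c₁ _ hc₁ ha₁ (hb₁ P hP v κ₁ K₁ h1)
  have k2 := key a₂ b₂ c₂ _ hc₂ ha₂ (hb₂ P hP v κ₂ K₂ h2)
  linarith

theorem Bnd.weyl (h₁ : Bnd C₁ a₁) (h₂ : Bnd C₂ a₂) (ha₁ : a₁ + 3 ≤ a) (ha₂ : a₂ - 2 ≤ a)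
    (hC : ∀ v κ K, C v κ K → ∃ e, κ e = 2 ∧ C₁ v (Function.update κ e 0) K ∧
      C₂ v (Function.update κ e 3) K) : Bnd C a := by
  refine Bnd.branch (b₁ := 3) (b₂ := -2) h₁ h₂ ha₁ (by omega) fun ε hε => ?_
  obtain ⟨c, hc, h⟩ := exists_cnt_weyl (E := E) (W := W) ε hε
  refine ⟨c, by linarith, fun P hP v κ K hCK => ?_⟩
  obtain ⟨e, he, h1, h2⟩ := hC v κ K hCK
  refine ⟨_, _, _, _, h1, h2, (h P hP v κ K e he).trans ?_⟩
  have hP' : (1 : ℝ) ≤ P := by exact_mod_cast hP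
  have : (P : ℝ) ^ 3 ≤ (P : ℝ) ^ (((3 : ℤ) : ℝ) + ε) := by
    rw [← Real.rpow_natCast]
    refine Real.rpow_le_rpow_of_exponent_le hP' ?_
    push_cast
    linarith
  push_cast at *
  gcongr

/-- The Fejér kernel is contracted as soon as it appears: -2 from differencing and 3 from
contraction leave the exponent 1. -/
theorem Bnd.weyl_contract (h₁ : Bnd C₁ a₁) (h₂ : Bnd C₂ a₂) (ha₁ : a₁ + 3 ≤ a)
    (ha₂ : a₂ + 1 ≤ a)
    (hC : ∀ v κ K, C v κ K → ∃ e, κ e = 2 ∧ v e ∉ K ∧ C₁ v (Function.update κ e 0) K ∧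
      C₂ v (Function.update κ e 0) (K ⊔ Submodule.span ℚ {v e})) : Bnd C a := by
  refine Bnd.branch (b₁ := 3) (b₂ := 1) h₁ h₂ ha₁ ha₂ fun ε hε => ?_
  obtain ⟨c, hc, h⟩ := exists_cnt_weyl (E := E) (W := W) (ε / 2) (by positivity)
  obtain ⟨c', hc', h'⟩ := exists_coll_le (ε / 2) (by positivity)
  refine ⟨c * c', by nlinarith, fun P hP v κ K hCK => ?_⟩
  obtain ⟨e, he, heK, h1, h2⟩ := hC v κ K hCK
  refine ⟨_, _, _, _, h1, h2, (h P hP v κ K e he).trans ?_⟩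
  have hP' : (1 : ℝ) ≤ P := by exact_mod_cast hP
  have hP0 : (0 : ℝ) < P := by linarith
  have e1 : (P : ℝ) ^ 3 ≤ (P : ℝ) ^ (((3 : ℤ) : ℝ) + ε) := by
    rw [← Real.rpow_natCast]
    refine Real.rpow_le_rpow_of_exponent_le hP' ?_
    push_cast
    linarith
  have e2 := cnt_contract (κ := Function.update κ e 3) (v := v) (K := K)
    (B := c' * (P : ℝ) ^ ((3 : ℝ) + ε / 2)) (P := P) (e := e)
    (fun m => by simpa using h' P hP 3 le_rfl m) heK
  rw [Function.update_idem] at e2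
  have e3 : (P : ℝ) ^ (-2 + ε / 2) * (P : ℝ) ^ ((3 : ℝ) + ε / 2) =
      (P : ℝ) ^ (((1 : ℤ) : ℝ) + ε) := by
    rw [← Real.rpow_add hP0]; congr 1; push_cast; ring
  refine add_le_add ?_ ?_
  · have : c * (P : ℝ) ^ 3 ≤ c * c' * (P : ℝ) ^ (((3 : ℤ) : ℝ) + ε) := by
      have : c * 1 ≤ c * c' := by gcongr
      rw [mul_one] at this
      gcongr
    gcongr
  · rw [← e3]
    calc _ ≤ c * (P : ℝ) ^ (-2 + ε / 2) * (c' * (P : ℝ) ^ ((3 : ℝ) + ε / 2) *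
          (cnt P v (Function.update κ e 0) (K ⊔ Submodule.span ℚ {v e}) : ℝ)) := by gcongr
      _ = _ := by ring

theorem Bnd.split (h₁ : Bnd C₁ a₁) (h₂ : Bnd C₂ a₂) (ha₁ : a₁ + 1 ≤ a) (ha₂ : a₂ ≤ a)
    (hC : ∀ v κ K, C v κ K → ∃ e, κ e = 1 ∧ v e ∉ K ∧ C₁ v (Function.update κ e 0) K ∧
      C₂ v (Function.update κ e 0) (K ⊔ Submodule.span ℚ {v e})) : Bnd C a := by
  refine Bnd.branch (b₁ := 1) (b₂ := 0) h₁ h₂ ha₁ (by omega) fun ε hε => ?_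
  obtain ⟨c, hc, h⟩ := exists_coll_one_le ε hε
  obtain ⟨c', hc', h'⟩ := exists_coll_le ε hε
  refine ⟨max c c', by positivity, fun P hP v κ K hCK => ?_⟩
  obtain ⟨e, he, heK, h1, h2⟩ := hC v κ K hCK
  refine ⟨_, _, _, _, h1, h2, cnt_split ?_ ?_ ?_ heK⟩
  · rw [he]
    refine (h' P hP 1 (by norm_num) 0).trans ?_
    push_cast
    gcongr
    exact le_max_right _ _
  · intro m hm
    rw [he]
    refine (h P hP m hm).trans ?_
    push_cast
    rw [zero_add]
    gcongr
    exact le_max_left _ _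
  · positivity

theorem cnt_le_off {P : ℕ} (hP : 1 ≤ P) (v : E → W) (K : Submodule ℚ W) (D : Finset E) :
    ∀ κ : E → ℕ, (∀ e ∈ D, κ e ≤ 3) →
      cnt P v κ K ≤ 96 ^ (2 * D.card) * P ^ (2 * ∑ e ∈ D, κ e) * cnt P v (off D κ) K := by
  induction D using Finset.induction_on with
  | empty => intro κ _; simp [off_empty]
  | insert e D he ih =>
    intro κ hκ
    have h1 := cnt_delete P v κ K e
    have h2 := ih (Function.update κ e 0) fun f hf => by
      have hfe : f ≠ e := fun h => he (h ▸ hf)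
      simpa [hfe] using hκ f (Finset.mem_insert_of_mem hf)
    have h3 := card_half_le hP (hκ e (Finset.mem_insert_self _ _))
    have h4 : ∑ f ∈ D, Function.update κ e 0 f = ∑ f ∈ D, κ f :=
      Finset.sum_congr rfl fun f hf => by
        have hfe : f ≠ e := fun h => he (h ▸ hf)
        simp [hfe]
    rw [h4] at h2
    rw [off_insert, Finset.card_insert_of_notMem he, Finset.sum_insert he]
    calc _ ≤ _ := h1
      _ ≤ (96 * P ^ κ e) ^ 2 * (96 ^ (2 * D.card) * P ^ (2 * ∑ e ∈ D, κ e) *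
          cnt P v (off D (Function.update κ e 0)) K) := by gcongr
      _ = _ := by ring

theorem cnt_le_off_sup [FiniteDimensional ℚ W] {P : ℕ} {B δ : ℝ} (hP : 1 ≤ P) (hB0 : 0 ≤ B)
    (hB : ∀ k ≤ 3, ∀ m : ℤ, (coll P k m : ℝ) ≤ B * (P : ℝ) ^ ((k : ℝ) + δ)) (v : E → W)
    (I : Finset E) :
    ∀ (κ : E → ℕ) (K : Submodule ℚ W), (∀ e ∈ I, κ e ≤ 3) → FreeMod v K I →
      (cnt P v κ K : ℝ) ≤ B ^ I.card * (P : ℝ) ^ (((∑ e ∈ I, κ e : ℕ) : ℝ) + I.card * δ) *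
        cnt P v (off I κ) (K ⊔ sp v I) := by
  have hP0 : (0 : ℝ) < P := by exact_mod_cast hP
  induction I using Finset.induction_on with
  | empty => intro κ K _ _; simp [off_empty, sp_empty]
  | insert e I he ih =>
    intro κ K hκ hfree
    obtain ⟨heK, hfree'⟩ := hfree.of_insert he
    have h1 := cnt_contract (hB (κ e) (hκ e (Finset.mem_insert_self _ _))) heK
    have h2 := ih (Function.update κ e 0) _ (fun f hf => by
      have hfe : f ≠ e := fun h => he (h ▸ hf)
      simpa [hfe] using hκ f (Finset.mem_insert_of_mem hf)) hfree'
    have h4 : ∑ f ∈ I, Function.update κ e 0 f = ∑ f ∈ I, κ f :=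
      Finset.sum_congr rfl fun f hf => by
        have hfe : f ≠ e := fun h => he (h ▸ hf)
        simp [hfe]
    rw [h4] at h2
    rw [off_insert, Finset.card_insert_of_notMem he, Finset.sum_insert he, sp_insert, ← sup_assoc]
    calc _ ≤ _ := h1
      _ ≤ B * (P : ℝ) ^ ((κ e : ℝ) + δ) * (B ^ I.card *
          (P : ℝ) ^ (((∑ e ∈ I, κ e : ℕ) : ℝ) + I.card * δ) *
          cnt P v (off I (Function.update κ e 0)) (K ⊔ Submodule.span ℚ {v e} ⊔ sp v I)) := by
        gcongr
      _ = B ^ (I.card + 1) * ((P : ℝ) ^ ((κ e : ℝ) + δ) *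
          (P : ℝ) ^ (((∑ e ∈ I, κ e : ℕ) : ℝ) + I.card * δ)) *
          cnt P v (off I (Function.update κ e 0)) (K ⊔ Submodule.span ℚ {v e} ⊔ sp v I) := by
        ring
      _ = _ := by
        rw [← Real.rpow_add hP0]
        congr 3
        push_cast
        ring

/-- Delete the elements of `D` and contract the elements of `I`. -/
theorem Bnd.clear [FiniteDimensional ℚ W] {m : ℤ} (h : Bnd C' a₁) (ha : a₁ + m ≤ a)
    (hC : ∀ v κ K, C v κ K → ∃ D I : Finset E, Disjoint D I ∧ (∀ e ∈ D ∪ I, κ e ≤ 3) ∧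
      ((2 * ∑ e ∈ D, κ e + ∑ e ∈ I, κ e : ℕ) : ℤ) ≤ m ∧ FreeMod v K I ∧
      C' v (off (D ∪ I) κ) (K ⊔ sp v I)) : Bnd C a := by
  intro ε hε
  set n : ℕ := Fintype.card E with hn
  -- At most `n` contractions occur, each losing P^δ, hence P^(ε/2) altogether.
  set δ : ℝ := ε / (2 * (n + 1)) with hδ
  have hδ0 : 0 < δ := by positivity
  obtain ⟨c, hc, hb⟩ := h (ε / 2) (by positivity)
  obtain ⟨B, hB1, hB⟩ := exists_coll_le δ hδ0
  refine ⟨96 ^ (2 * n) * B ^ n * c, by positivity, fun P hP v κ K hCK => ?_⟩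
  have hP' : (1 : ℝ) ≤ P := by exact_mod_cast hP
  have hP0 : (0 : ℝ) < P := by linarith
  obtain ⟨D, I, hdisj, hκ, hm, hfree, hC'⟩ := hC v κ K hCK
  have h1 : (cnt P v κ K : ℝ) ≤ 96 ^ (2 * D.card) * (P : ℝ) ^ (2 * ∑ e ∈ D, κ e) *
      cnt P v (off D κ) K := by
    exact_mod_cast cnt_le_off hP v K D κ fun e he => hκ e (Finset.mem_union_left _ he)
  have hoff : ∀ e ∈ I, off D κ e = κ e := fun e he => by
    have : e ∉ D := fun h => Finset.disjoint_left.1 hdisj h he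
    simp [off, this]
  have h2 := cnt_le_off_sup hP (by linarith) (hB P hP) v I (off D κ) K
    (fun e he => by rw [hoff e he]; exact hκ e (Finset.mem_union_right _ he)) hfree
  rw [← off_union, Finset.sum_congr rfl hoff] at h2
  have h3 := hb P hP v _ _ hC'
  have hDn : D.card ≤ n := Finset.card_le_univ D
  have hIn : I.card ≤ n := Finset.card_le_univ I
  have hm' : (2 : ℝ) * ((∑ e ∈ D, κ e : ℕ) : ℝ) + ((∑ e ∈ I, κ e : ℕ) : ℝ) ≤ m := by
    exact_mod_cast hm
  have ha' : (a₁ : ℝ) + m ≤ a := by exact_mod_cast ha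
  have hIδ : (I.card : ℝ) * δ ≤ ε / 2 := by
    have : (I.card : ℝ) ≤ n + 1 := by
      have : (I.card : ℝ) ≤ n := by exact_mod_cast hIn
      linarith
    calc (I.card : ℝ) * δ ≤ (n + 1) * δ := by gcongr
      _ = ε / 2 := by rw [hδ]; field_simp
  calc (cnt P v κ K : ℝ) ≤ _ := h1
    _ ≤ 96 ^ (2 * D.card) * (P : ℝ) ^ (2 * ∑ e ∈ D, κ e) *
        (B ^ I.card * (P : ℝ) ^ (((∑ e ∈ I, κ e : ℕ) : ℝ) + I.card * δ) *
          (c * (P : ℝ) ^ ((a₁ : ℝ) + ε / 2))) := by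
        refine mul_le_mul_of_nonneg_left (h2.trans ?_) (by positivity)
        gcongr
    _ = 96 ^ (2 * D.card) * B ^ I.card * c * ((P : ℝ) ^ (((2 * ∑ e ∈ D, κ e : ℕ) : ℝ)) *
        (P : ℝ) ^ (((∑ e ∈ I, κ e : ℕ) : ℝ) + I.card * δ) * (P : ℝ) ^ ((a₁ : ℝ) + ε / 2)) := by
        rw [Real.rpow_natCast]; ring
    _ = 96 ^ (2 * D.card) * B ^ I.card * c * (P : ℝ) ^ (((2 * ∑ e ∈ D, κ e : ℕ) : ℝ) +
        (((∑ e ∈ I, κ e : ℕ) : ℝ) + I.card * δ) + ((a₁ : ℝ) + ε / 2)) := by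
        rw [← Real.rpow_add hP0, ← Real.rpow_add hP0]
    _ ≤ 96 ^ (2 * n) * B ^ n * c * (P : ℝ) ^ ((a : ℝ) + ε) := by
        have : (((2 * ∑ e ∈ D, κ e : ℕ) : ℝ) + (((∑ e ∈ I, κ e : ℕ) : ℝ) + I.card * δ) +
            ((a₁ : ℝ) + ε / 2)) ≤ (a : ℝ) + ε := by
          push_cast at hm' ⊢
          linarith
        have h96 : (96 : ℝ) ^ (2 * D.card) ≤ 96 ^ (2 * n) :=
          pow_le_pow_right₀ (by norm_num) (by omega)
        have hBn : B ^ I.card ≤ B ^ n := pow_le_pow_right₀ hB1 hIn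
        gcongr

end Bounds

/-! ### Chains of linked blocks: index sets, kinds and general position. -/

/-- Index sets of a chain of `n` linked blocks: the block `m` has the rows `X m` which meet no
later block, the rows `L m` linking it with the next block, and the columns `J m`; `below m` and
`after m` are the rows of the blocks up to and after `m`, and `cols m` the columns of the blocks
after `m`. -/
structure Links (E : Type*) [DecidableEq E] (n l q : ℕ) where
  X : ℕ → Finset E
  L : ℕ → Finset E
  J : ℕ → Finset E
  below : ℕ → Finset E
  after : ℕ → Finset E
  cols : ℕ → Finset E
  card_L : ∀ m < n, (L m).card = l
  card_X : ∀ m, m + 1 < n → (X (m + 1)).card = q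
  card_J : ∀ m, m + 1 < n → (J (m + 1)).card = q + l
  disj_L_after : ∀ m < n, Disjoint (L m) (after m)
  disj_below : ∀ m < n, Disjoint (below m) (after m)
  disj_X : ∀ m, m + 1 < n → Disjoint (X (m + 1)) (L (m + 1) ∪ after (m + 1))
  disj_J : ∀ m, m + 1 < n → Disjoint (J (m + 1)) (cols (m + 1))
  disj_L_J : ∀ m, m + 1 < n → Disjoint (L m) (J (m + 1))
  L_below : ∀ m < n, L m ⊆ below m
  below_succ : ∀ m, m + 1 < n → below (m + 1) = below m ∪ (X (m + 1) ∪ L (m + 1))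
  after_succ : ∀ m, m + 1 < n → after m = X (m + 1) ∪ (L (m + 1) ∪ after (m + 1))
  cols_succ : ∀ m, m + 1 < n → cols m = J (m + 1) ∪ cols (m + 1)
  after_last : ∀ m, m + 1 = n → after m = ∅
  cols_last : ∀ m, m + 1 = n → cols m = ∅

/-- The elements of kinds `1`, `2`, `3` are those of `AX`, `AF`, `AT`, all others have kind `0`. -/
def Shape {E : Type*} (κ : E → ℕ) (AX AF AT : Finset E) : Prop :=
  ∀ e, (κ e = 1 ↔ e ∈ AX) ∧ (κ e = 2 ↔ e ∈ AF) ∧ (κ e = 3 ↔ e ∈ AT) ∧ κ e ≤ 3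

section Shape

variable {E : Type*} [DecidableEq E] {κ : E → ℕ} {AX AF AT AX' AF' AT' : Finset E}

theorem off_singleton (κ : E → ℕ) (e : E) : off {e} κ = Function.update κ e 0 := by
  rw [← insert_empty_eq, off_insert, off_empty]

theorem Shape.off (h : Shape κ AX AF AT) (D : Finset E) (h1 : AX \ D = AX') (h2 : AF \ D = AF')
    (h3 : AT \ D = AT') : Shape (off D κ) AX' AF' AT' := by
  intro e
  subst h1 h2 h3
  have := h e
  by_cases he : e ∈ D
  · simp [CubicAux.off, he]
  · simpa [CubicAux.off, he] using this

theorem Shape.sum_AX (h : Shape κ AX AF AT) {I : Finset E} (hI : I ⊆ AX) :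
    ∑ e ∈ I, κ e = I.card := by
  rw [Finset.sum_congr rfl fun e he => ((h e).1.2 (hI he)), Finset.sum_const]
  simp

theorem Shape.sum_AF (h : Shape κ AX AF AT) {I : Finset E} (hI : I ⊆ AF) :
    ∑ e ∈ I, κ e = 2 * I.card := by
  rw [Finset.sum_congr rfl fun e he => ((h e).2.1.2 (hI he)), Finset.sum_const]
  simp [mul_comm]

theorem Shape.sum_AT (h : Shape κ AX AF AT) {I : Finset E} (hI : I ⊆ AT) :
    ∑ e ∈ I, κ e = 3 * I.card := by
  rw [Finset.sum_congr rfl fun e he => ((h e).2.2.1.2 (hI he)), Finset.sum_const]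
  simp [mul_comm]

theorem Shape.disj_XF (h : Shape κ AX AF AT) {e : E} (he : e ∈ AX) : e ∉ AF := fun h' => by
  have h1 := (h e).1.2 he
  have h2 := (h e).2.1.2 h'
  omega

theorem Shape.disj_XT (h : Shape κ AX AF AT) {e : E} (he : e ∈ AX) : e ∉ AT := fun h' => by
  have h1 := (h e).1.2 he
  have h2 := (h e).2.2.1.2 h'
  omega

theorem Shape.disj_FT (h : Shape κ AX AF AT) {e : E} (he : e ∈ AF) : e ∉ AT := fun h' => by
  have h1 := (h e).2.1.2 he
  have h2 := (h e).2.2.1.2 h'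
  omega

end Shape

section Chain

variable {E W : Type*} [Fintype E] [DecidableEq E] [AddCommGroup W] [Module ℚ W]
  [FiniteDimensional ℚ W] {n l q : ℕ}

/-- The space spanned by the rows of the blocks up to `m`. -/
def Links.H (Λ : Links E n l q) (v : E → W) (m : ℕ) : Submodule ℚ W := sp v (Λ.below m)

/-- The vectors `v` are in general position within each block. -/
structure Good (Λ : Links E n l q) (v : E → W) : Prop where
  free : ∀ m < n, FreeMod v ⊥ (Λ.below m ∪ Λ.after m)
  spans : ∀ m, m + 1 < n →
    ∀ S ⊆ Λ.L m ∪ (Λ.X (m + 1) ∪ (Λ.L (m + 1) ∪ Λ.J (m + 1))), S.card = q + 2 * l →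
      sp v (Λ.L m ∪ (Λ.X (m + 1) ∪ Λ.L (m + 1))) ≤ sp v S
  cols : ∀ m, m + 1 < n → ∀ e ∈ Λ.J (m + 1), v e ∈ sp v (Λ.L m ∪ (Λ.X (m + 1) ∪ Λ.L (m + 1)))

variable {Λ : Links E n l q} {v : E → W} {κ : E → ℕ} {K : Submodule ℚ W} {m : ℕ}

theorem Good.finrank_H (h : Good Λ v) (hm : m < n) :
    Module.finrank ℚ (Λ.H v m) = (Λ.below m).card ∧ FreeMod v (Λ.H v m) (Λ.after m) := by
  have h1 := h.free m hm
  unfold FreeMod at *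
  rw [bot_sup_eq, sp_union, finrank_bot, zero_add,
    Finset.card_union_of_disjoint (Λ.disj_below m hm)] at h1
  have h2 := finrank_sup_sp_le v (Λ.H v m) (Λ.after m)
  have h3 := finrank_sp_le v (Λ.below m)
  unfold Links.H at *
  omega

theorem Good.free_after (h : Good Λ v) (hm : m < n) (hK : K ≤ Λ.H v m) :
    FreeMod v K (Λ.after m) := (h.finrank_H hm).2.anti hK

theorem Good.finrank_H_succ (h : Good Λ v) (hm : m + 1 < n) :
    Module.finrank ℚ (Λ.H v (m + 1)) = Module.finrank ℚ (Λ.H v m) + (q + l) := by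
  rw [(h.finrank_H hm).1, (h.finrank_H (by omega : m < n)).1, Λ.below_succ m hm,
    Finset.card_union_of_disjoint, Finset.card_union_of_disjoint, Λ.card_X m hm, Λ.card_L _ hm]
  · exact (Λ.disj_X m hm).mono_right Finset.subset_union_left
  · refine (Λ.disj_below m (by omega)).mono_right ?_
    rw [Λ.after_succ m hm]
    grind

theorem Links.H_mono (Λ : Links E n l q) (v : E → W) (hm : m + 1 < n) :
    Λ.H v m ≤ Λ.H v (m + 1) := by
  unfold Links.H
  rw [Λ.below_succ m hm]
  exact sp_mono Finset.subset_union_left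

/-- Passage to the next block: general position modulo a space that complements the remaining
linking rows. -/
theorem Good.unif_next (h : Good Λ v) (hm : m + 1 < n) {L₀ : Finset E} (hL₀ : L₀ ⊆ Λ.L m)
    (hK : K ≤ Λ.H v m) (hLK : ∀ e ∈ Λ.L m \ L₀, v e ∈ K) (hH : Λ.H v m ≤ K ⊔ sp v L₀)
    (hr : Module.finrank ℚ K + L₀.card = Module.finrank ℚ (Λ.H v m)) :
    Unif v K (Λ.H v (m + 1)) (L₀ ∪ (Λ.X (m + 1) ∪ (Λ.L (m + 1) ∪ Λ.J (m + 1))))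
      (L₀.card + q + l) := by
  have hLX : sp v (Λ.L m ∪ (Λ.X (m + 1) ∪ Λ.L (m + 1))) ≤ Λ.H v (m + 1) := by
    unfold Links.H
    rw [Λ.below_succ m hm]
    exact sp_mono (Finset.union_subset_union_left (Λ.L_below m (by omega)))
  refine ⟨hK.trans (Λ.H_mono v hm), ?_, ?_, ?_⟩
  · intro e he
    by_cases heJ : e ∈ Λ.J (m + 1)
    · exact hLX (h.cols m hm e heJ)
    · refine hLX (mem_sp ?_)
      grind
  · have := h.finrank_H_succ hm
    omega
  · intro S hS hSc
    have hd : Disjoint S (Λ.L m \ L₀) := by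
      rw [Finset.disjoint_left]
      intro e he he'
      have h1 : e ∉ Λ.after m := Finset.disjoint_left.1 (Λ.disj_below m (by omega))
        (Λ.L_below m (by omega) (by grind))
      rw [Λ.after_succ m hm] at h1
      have h2 : e ∈ Λ.L m → e ∉ Λ.J (m + 1) := fun h => Finset.disjoint_left.1 (Λ.disj_L_J m hm) h
      have h3 := hS he
      grind
    -- The linking rows outside `L₀` lie in `K`. They complete `S` to as many vectors of the block
    -- as it has rows, so general position of the whole block applies.
    have hc : (S ∪ (Λ.L m \ L₀)).card = q + 2 * l := by
      rw [Finset.card_union_of_disjoint hd]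
      have := Finset.card_sdiff_add_card_eq_card hL₀
      have := Λ.card_L m (by omega)
      omega
    have h1 := h.spans m hm (S ∪ (Λ.L m \ L₀)) (by
      refine Finset.union_subset (hS.trans ?_) ?_
      · exact Finset.union_subset_union_left hL₀
      · exact Finset.sdiff_subset.trans Finset.subset_union_left) hc
    have h2 : sp v (S ∪ (Λ.L m \ L₀)) ≤ K ⊔ sp v S := by
      rw [sp_union]
      exact sup_le le_sup_right ((sp_le_iff.2 hLK).trans le_sup_left)
    have h3 := h1.trans h2
    have h4 : Λ.H v (m + 1) = Λ.H v m ⊔ sp v (Λ.X (m + 1) ∪ Λ.L (m + 1)) := by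
      unfold Links.H
      rw [Λ.below_succ m hm, sp_union]
    rw [h4]
    refine sup_le (hH.trans (sup_le le_sup_left ?_)) ?_
    · exact (sp_mono (hL₀.trans Finset.subset_union_left)).trans h3
    · exact (sp_mono Finset.subset_union_right).trans h3

/-- A partially processed system: in the block `m` there remain the rows `X₁` besides the linking
rows, the columns `J₁` and the Fejér elements `S`; all later blocks are untouched. -/
structure St (Λ : Links E n l q) (m : ℕ) (X₁ J₁ S : Finset E) (v : E → W) (κ : E → ℕ)
    (K : Submodule ℚ W) (d : ℕ) : Prop where
  good : Good Λ v
  disjX : Disjoint X₁ (Λ.L m ∪ Λ.after m)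
  disjJ : Disjoint J₁ (Λ.cols m)
  shape : Shape κ (X₁ ∪ (Λ.L m ∪ Λ.after m)) (J₁ ∪ Λ.cols m) S
  unif : Unif v K (Λ.H v m) (X₁ ∪ (Λ.L m ∪ J₁)) d

theorem St.card {X₁ J₁ S : Finset E} {d : ℕ} (h : St Λ m X₁ J₁ S v κ K d) (hm : m < n) :
    (X₁ ∪ (Λ.L m ∪ J₁)).card = X₁.card + l + J₁.card := by
  rw [← Finset.union_assoc, Finset.card_union_of_disjoint, Finset.card_union_of_disjoint,
    Λ.card_L m hm]
  · exact h.disjX.mono_right Finset.subset_union_left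
  · rw [Finset.disjoint_left]
    intro e he he'
    exact h.shape.disj_XF (e := e) (by grind) (by grind)

/-- Delete `D` and contract `I`. -/
theorem St.off {X₁ J₁ S D I : Finset E} {d : ℕ} (h : St Λ m X₁ J₁ S v κ K (d + I.card))
    (hm : m < n) (hD : D ⊆ X₁ ∪ (J₁ ∪ S)) (hI : I ⊆ X₁ ∪ J₁)
    (hd : d + I.card ≤ X₁.card + l + J₁.card) :
    FreeMod v K I ∧ St Λ m (X₁ \ (D ∪ I)) (J₁ \ (D ∪ I)) (S \ (D ∪ I)) v (off (D ∪ I) κ)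
      (K ⊔ sp v I) d := by
  rw [← h.card hm] at hd
  have hX := Finset.disjoint_left.1 h.disjX
  have hJ := Finset.disjoint_left.1 h.disjJ
  have hXF := fun e => h.shape.disj_XF (e := e)
  have hXT := fun e => h.shape.disj_XT (e := e)
  have hFT := fun e => h.shape.disj_FT (e := e)
  obtain ⟨h1, h2⟩ := h.unif.contract (I := I)
    (G' := (X₁ \ (D ∪ I)) ∪ (Λ.L m ∪ (J₁ \ (D ∪ I)))) (by grind) hd (by grind) (by
      rw [Finset.disjoint_left]
      intro e he he'
      have := hX (a := e)
      have := hXF e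
      grind)
  refine ⟨h1, h.good, h.disjX.mono_left Finset.sdiff_subset,
    h.disjJ.mono_left Finset.sdiff_subset, h.shape.off _ ?_ ?_ rfl, h2⟩
  · ext e
    have := hX (a := e)
    have := hXF e
    have := hXT e
    grind
  · ext e
    have := hJ (a := e)
    have := hXF e
    have := hFT e
    grind

end Chain

/-! ### Eliminating the rows of the first remaining block. -/

section Moves

variable {E W : Type*} [Fintype E] [DecidableEq E] [AddCommGroup W] [Module ℚ W]
  [FiniteDimensional ℚ W] {n l q : ℕ} {Λ : Links E n l q} {v : E → W} {κ : E → ℕ}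
  {K : Submodule ℚ W} {m : ℕ}

theorem St.delX {X₁ J₁ S : Finset E} {d : ℕ} {e : E} (h : St Λ m X₁ J₁ S v κ K d) (hm : m < n)
    (he : e ∈ X₁) (hd : d ≤ X₁.card + l + J₁.card) :
    St Λ m (X₁.erase e) J₁ S v (Function.update κ e 0) K d := by
  have h1 := (St.off (D := {e}) (I := ∅) (d := d) h hm (by grind) (by simp) (by simpa using hd)).2
  have hF := h.shape.disj_XF (e := e) (by grind)
  have hT := h.shape.disj_XT (e := e) (by grind)
  rwa [Finset.union_empty, off_singleton, Finset.sdiff_singleton_eq_erase,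
    Finset.sdiff_singleton_eq_erase, Finset.sdiff_singleton_eq_erase,
    Finset.erase_eq_of_notMem (s := J₁) (by grind), Finset.erase_eq_of_notMem hT, sp_empty,
    sup_bot_eq] at h1

theorem St.delJ {X₁ J₁ S : Finset E} {d : ℕ} {e : E} (h : St Λ m X₁ J₁ S v κ K d) (hm : m < n)
    (he : e ∈ J₁) (hd : d ≤ X₁.card + l + J₁.card) :
    St Λ m X₁ (J₁.erase e) S v (Function.update κ e 0) K d := by
  have h1 := (St.off (D := {e}) (I := ∅) (d := d) h hm (by grind) (by simp) (by simpa using hd)).2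
  have hF := fun hX => h.shape.disj_XF (e := e) hX (by grind)
  have hT := h.shape.disj_FT (e := e) (by grind)
  rwa [Finset.union_empty, off_singleton, Finset.sdiff_singleton_eq_erase,
    Finset.sdiff_singleton_eq_erase, Finset.sdiff_singleton_eq_erase,
    Finset.erase_eq_of_notMem (s := X₁) (by grind), Finset.erase_eq_of_notMem hT, sp_empty,
    sup_bot_eq] at h1

theorem St.con {X₁ J₁ S : Finset E} {d : ℕ} {e : E} (h : St Λ m X₁ J₁ S v κ K (d + 1))
    (hm : m < n) (he : e ∈ X₁ ∪ J₁) (hd : d + 1 ≤ X₁.card + l + J₁.card) :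
    v e ∉ K ∧ St Λ m (X₁.erase e) (J₁.erase e) (S.erase e) v (Function.update κ e 0)
      (K ⊔ Submodule.span ℚ {v e}) d := by
  obtain ⟨h1, h2⟩ := St.off (D := ∅) (I := {e}) (d := d) (by simpa using h) hm (by simp)
    (by simpa using he) (by simpa using hd)
  rw [Finset.empty_union, off_singleton, Finset.sdiff_singleton_eq_erase,
    Finset.sdiff_singleton_eq_erase, Finset.sdiff_singleton_eq_erase, sp_singleton] at h2
  exact ⟨(FreeMod.of_insert (I := ∅) (by simp) (by simpa using h1)).1, h2⟩

theorem St.conX {X₁ J₁ S : Finset E} {d : ℕ} {e : E} (h : St Λ m X₁ J₁ S v κ K (d + 1))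
    (hm : m < n) (he : e ∈ X₁) (hd : d + 1 ≤ X₁.card + l + J₁.card) :
    v e ∉ K ∧ St Λ m (X₁.erase e) J₁ S v (Function.update κ e 0)
      (K ⊔ Submodule.span ℚ {v e}) d := by
  have hF := h.shape.disj_XF (e := e) (by grind)
  have hT := h.shape.disj_XT (e := e) (by grind)
  have := h.con hm (e := e) (by grind) hd
  rwa [Finset.erase_eq_of_notMem (s := J₁) (by grind), Finset.erase_eq_of_notMem hT] at this

theorem St.conJ {X₁ J₁ S : Finset E} {d : ℕ} {e : E} (h : St Λ m X₁ J₁ S v κ K (d + 1))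
    (hm : m < n) (he : e ∈ J₁) (hd : d + 1 ≤ X₁.card + l + J₁.card) :
    v e ∉ K ∧ St Λ m X₁ (J₁.erase e) S v (Function.update κ e 0)
      (K ⊔ Submodule.span ℚ {v e}) d := by
  have hF := fun hX => h.shape.disj_XF (e := e) hX (by grind)
  have hT := h.shape.disj_FT (e := e) (by grind)
  have := h.con hm (e := e) (by grind) hd
  rwa [Finset.erase_eq_of_notMem (s := X₁) (by grind), Finset.erase_eq_of_notMem hT] at this

/-- Systems whose first block has `x` rows besides the linking ones, `z` rows without variables,
and `x + z + w` columns. -/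
def Blk (Λ : Links E n l q) (m x z w : ℕ) (v : E → W) (κ : E → ℕ) (K : Submodule ℚ W) : Prop :=
  ∃ X₁ J₁ : Finset E, X₁.card = x ∧ J₁.card = x + z + w ∧ St Λ m X₁ J₁ ∅ v κ K (x + z + l)

/-- Contracting `z` columns, each at cost P², lowers the rank by the number of rows that carry no
variables. -/
theorem bnd_blk_zero_rows (hm : m < n) {x z w : ℕ} {a b : ℤ}
    (h : Bnd (Blk (W := W) Λ m x 0 w) a) (hab : a + 2 * z ≤ b) : Bnd (Blk (W := W) Λ m x z w) b := by
  refine Bnd.clear (m := 2 * z) h hab ?_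
  rintro v κ K ⟨X₁, J₁, hX, hJ, hst⟩
  obtain ⟨I, hIJ, hI⟩ := Finset.exists_subset_card_eq (show z ≤ J₁.card by omega)
  have hst' : St Λ m X₁ J₁ ∅ v κ K (x + l + I.card) := by
    rw [hI]; convert hst using 1; omega
  obtain ⟨h1, h2⟩ := St.off (D := ∅) (I := I) hst' hm (by simp)
    (hIJ.trans Finset.subset_union_right) (by omega)
  have hIs : I ⊆ J₁ ∪ Λ.cols m := hIJ.trans Finset.subset_union_left
  refine ⟨∅, I, by simp, fun e _ => (hst.shape e).2.2.2, ?_, h1, X₁, J₁ \ I, hX, ?_, ?_⟩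
  · rw [hst.shape.sum_AF hIs, hI]; simp
  · have := Finset.card_sdiff_add_card_eq_card hIJ
    omega
  · have hX₁ : X₁ \ I = X₁ := by
      ext e
      have := fun hX => hst.shape.disj_XF (e := e) hX
      grind
    simpa [hX₁] using h2

/-- Systems with one dispensable row. -/
def BlkExtra (Λ : Links E n l q) (m x w : ℕ) (v : E → W) (κ : E → ℕ) (K : Submodule ℚ W) : Prop :=
  ∃ X₁ J₁ : Finset E, X₁.card = x + 1 ∧ J₁.card = x + w ∧ St Λ m X₁ J₁ ∅ v κ K (x + l)

theorem bnd_blk_extra (hm : m < n) {x w : ℕ} {a b : ℤ}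
    (h : Bnd (Blk (W := W) Λ m x 0 w) a) (hab : a + 2 ≤ b) : Bnd (BlkExtra (W := W) Λ m x w) b := by
  refine Bnd.clear (m := 2) h hab ?_
  rintro v κ K ⟨X₁, J₁, hX, hJ, hst⟩
  obtain ⟨e, he⟩ := Finset.card_pos.1 (show 0 < X₁.card by omega)
  have h1 := hst.delX hm he (by omega)
  refine ⟨{e}, ∅, by simp, fun e _ => (hst.shape e).2.2.2, ?_, ?_, X₁.erase e, J₁, ?_, hJ, ?_⟩
  · rw [hst.shape.sum_AX (by grind)]; simp
  · rw [FreeMod, sp_empty, sup_bot_eq]; simp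
  · rw [Finset.card_erase_of_mem he]; omega
  · rw [sp_empty, sup_bot_eq, Finset.union_empty, off_singleton]
    exact h1

/-- Each row and each excess column is worth 3. The induction alternates: a row is split when there
is no excess, and a column is differenced otherwise, so the excess never passes `l`. -/
theorem bnd_blk_of_zero (hm : m < n) (hl : 1 ≤ l)
    (h : ∀ w ≤ l, Bnd (Blk (W := W) Λ m 0 0 w) (3 * w + 3 * (Λ.cols m).card + l)) (x : ℕ) :
    ∀ w ≤ l, Bnd (Blk (W := W) Λ m x 0 w) (3 * (x + w) + 3 * (Λ.cols m).card + l) := by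
  induction x with
  | zero => intro w hw; simpa using h w hw
  | succ x ih =>
    intro w
    induction w with
    | zero =>
      intro _
      -- Deleting the row costs 1, and the column then contracted for it costs 2. If the row is
      -- contracted instead, at no cost beyond P^ε, one column becomes excess, which needs `1 ≤ l`.
      have h1 : Bnd (Blk (W := W) Λ m x 1 0) (3 * x + 3 * (Λ.cols m).card + l + 2) :=
        bnd_blk_zero_rows hm (ih 0 (by omega)) (by push_cast; omega)
      refine Bnd.split h1 (ih 1 hl) (by push_cast; omega) (by push_cast; omega) ?_
      rintro v κ K ⟨X₁, J₁, hX, hJ, hst⟩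
      obtain ⟨e, he⟩ := Finset.card_pos.1 (show 0 < X₁.card by omega)
      have hd := hst.delX hm he (by omega)
      obtain ⟨hc, hc'⟩ := St.conX (d := x + l) (by convert hst using 1; omega) hm he (by omega)
      have hXc : (X₁.erase e).card = x := by rw [Finset.card_erase_of_mem he]; omega
      refine ⟨e, (hst.shape e).1.2 (by grind), hc, ⟨X₁.erase e, J₁, hXc, by omega, ?_⟩,
        ⟨X₁.erase e, J₁, hXc, by omega, hc'⟩⟩
      convert hd using 1
    | succ w ihw =>
      intro hw
      -- Deleting the column costs 3 and removes one excess. Contracting it costs 1 and makes one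
      -- row dispensable, whose deletion costs 2.
      have h2 : Bnd (BlkExtra (W := W) Λ m x (w + 1))
          (3 * (x + (w + 1)) + 3 * (Λ.cols m).card + l + 2) :=
        bnd_blk_extra hm (ih (w + 1) hw) (by push_cast; omega)
      refine Bnd.weyl_contract (ihw (by omega)) h2 (by push_cast; omega) (by push_cast; omega) ?_
      rintro v κ K ⟨X₁, J₁, hX, hJ, hst⟩
      obtain ⟨e, he⟩ := Finset.card_pos.1 (show 0 < J₁.card by omega)
      have hd := hst.delJ hm he (by omega)
      obtain ⟨hc, hc'⟩ := St.conJ (d := x + l) (by convert hst using 1; omega) hm he (by omega)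
      have hJc : (J₁.erase e).card = x + (w + 1) := by rw [Finset.card_erase_of_mem he]; omega
      exact ⟨e, (hst.shape e).2.1.2 (by grind), hc, ⟨X₁, J₁.erase e, hX, by omega, hd⟩,
        ⟨X₁, J₁.erase e, hX, hJc, hc'⟩⟩

/-- Systems whose first block has only linking rows, with `j` columns and `s` Fejér elements. -/
def Mix (Λ : Links E n l q) (m j s : ℕ) (v : E → W) (κ : E → ℕ) (K : Submodule ℚ W) : Prop :=
  ∃ J₁ S : Finset E, J₁.card = j ∧ S.card = s ∧ Good Λ v ∧ Disjoint J₁ (Λ.cols m) ∧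
    Shape κ (Λ.L m ∪ Λ.after m) (J₁ ∪ Λ.cols m) S ∧ Unif v K (Λ.H v m) (Λ.L m ∪ (J₁ ∪ S)) l

theorem Shape.toT {AX AF AT AF' : Finset E} {e : E} (h : Shape κ AX AF AT) (he : e ∈ AF)
    (hAF : AF.erase e = AF') :
    Shape (Function.update κ e 3) AX AF' (insert e AT) := by
  intro f
  have hf := h f
  have h1 := fun hX => h.disj_XF (e := e) hX he
  subst hAF
  by_cases hfe : f = e
  · subst hfe; simp; exact h1
  · simpa [hfe] using hf

/-- A column is worth 3 and a Fejér element 5, as 5 - 2 = 3. The Fejér elements are not contracted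
yet: of their 5, contraction takes 3, and 2 remain to delete a linking row. -/
theorem bnd_mix
    (h : ∀ s ≤ l, Bnd (Mix (W := W) Λ m 0 s) (5 * s + 3 * (Λ.cols m).card + l)) (j : ℕ) :
    ∀ s, j + s ≤ l → Bnd (Mix (W := W) Λ m j s) (3 * j + 5 * s + 3 * (Λ.cols m).card + l) := by
  induction j with
  | zero => intro s hs; simpa using h s (by omega)
  | succ j ih =>
    intro s hs
    refine Bnd.weyl (ih s (by omega)) (ih (s + 1) (by omega)) (by push_cast; omega)
      (by push_cast; omega) ?_
    rintro v κ K ⟨J₁, S, hJ, hS, hg, hdJ, hsh, hu⟩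
    obtain ⟨e, he⟩ := Finset.card_pos.1 (show 0 < J₁.card by omega)
    have hJc : (J₁.erase e).card = j := by rw [Finset.card_erase_of_mem he]; omega
    have hF := fun hX => hsh.disj_XF (e := e) hX (by grind)
    have hT := hsh.disj_FT (e := e) (by grind)
    have hec := Finset.disjoint_left.1 hdJ he
    refine ⟨e, (hsh e).2.1.2 (by grind),
      ⟨J₁.erase e, S, hJc, hS, hg, hdJ.mono_left (Finset.erase_subset _ _), ?_, ?_⟩,
      ⟨J₁.erase e, insert e S, hJc, ?_, hg, hdJ.mono_left (Finset.erase_subset _ _), ?_, ?_⟩⟩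
    · rw [← off_singleton]
      exact hsh.off {e} (by grind) (by grind) (by grind)
    · exact hu.mono (by grind)
    · rw [Finset.card_insert_of_notMem hT, hS]
    · exact hsh.toT (by grind) (by grind)
    · exact hu.mono (by grind)

end Moves

/-! ### Fejér elements carried over into the next block. -/

section Linked

variable {E W : Type*} [Fintype E] [DecidableEq E] [AddCommGroup W] [Module ℚ W]
  [FiniteDimensional ℚ W] {n l q : ℕ} {Λ : Links E n l q} {v : E → W} {κ : E → ℕ}
  {K : Submodule ℚ W} {m : ℕ}

theorem FreeMod.union {v : E → W} {K : Submodule ℚ W} {I J : Finset E} (hI : FreeMod v K I)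
    (hJ : FreeMod v (K ⊔ sp v I) J) (h : Disjoint I J) : FreeMod v K (I ∪ J) := by
  unfold FreeMod at *
  rw [sp_union, ← sup_assoc, Finset.card_union_of_disjoint h, hJ, hI, add_assoc]

/-- Systems in which the Fejér elements inherited from the previous block have rank defect at most
`g` modulo the rows after the block `m - 1`, and the first block `m` has `x` rows besides the
linking ones, `z` rows without variables and `x + z + w` columns. -/
def Defect (Λ : Links E n l q) (m s g x z w : ℕ) (A : Finset E) (v : E → W) (κ : E → ℕ)
    (K : Submodule ℚ W) : Prop :=
  ∃ X₁ J₁ S : Finset E, X₁.card = x ∧ J₁.card = x + z + w ∧ S.card = s ∧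
    X₁ ⊆ A ∧ Λ.L m ∪ Λ.after m ⊆ A ∧ St Λ m X₁ J₁ S v κ K (x + z + l) ∧
    (∀ e ∈ S, v e ∈ Λ.H v m) ∧
    Module.finrank ℚ (K ⊔ sp v A : Submodule ℚ W) + s ≤
      Module.finrank ℚ (K ⊔ sp v A ⊔ sp v S : Submodule ℚ W) + g

/-- Once the admitted defect equals the number of Fejér elements, all of them are deleted at cost 6
each, which is 5s + g with g = s. -/
theorem bnd_defect_full (hm : m < n) {A : Finset E} {s x z w : ℕ} {a b : ℤ}
    (h : Bnd (Blk (W := W) Λ m x 0 w) a) (hab : a + 6 * s + 2 * z ≤ b) :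
    Bnd (Defect (W := W) Λ m s s x z w A) b := by
  refine Bnd.clear (m := 6 * s + 2 * z) h (by omega) ?_
  rintro v κ K ⟨X₁, J₁, S, hX, hJ, hS, hXA, hA, hst, hSH, hrk⟩
  obtain ⟨I, hIJ, hI⟩ := Finset.exists_subset_card_eq (show z ≤ J₁.card by omega)
  have hst' : St Λ m X₁ J₁ S v κ K (x + l + I.card) := by
    rw [hI]; convert hst using 1; omega
  obtain ⟨h1, h2⟩ := St.off (D := S) (I := I) hst' hm (by grind)
    (hIJ.trans Finset.subset_union_right) (by omega)
  have hFX := fun e => hst.shape.disj_XF (e := e)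
  have hFT := fun e => hst.shape.disj_FT (e := e)
  have hXT := fun e => hst.shape.disj_XT (e := e)
  refine ⟨S, I, ?_, fun e _ => (hst.shape e).2.2.2, ?_, h1, X₁, J₁ \ I, hX, ?_, ?_⟩
  · rw [Finset.disjoint_left]
    intro e he he'
    exact hFT e (by grind) he
  · rw [hst.shape.sum_AF (hIJ.trans Finset.subset_union_left), hst.shape.sum_AT le_rfl, hI, hS]
    push_cast
    omega
  · have := Finset.card_sdiff_add_card_eq_card hIJ
    omega
  · have e1 : X₁ \ (S ∪ I) = X₁ := by
      ext e
      have := hFX e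
      have := hXT e
      grind
    have e2 : J₁ \ (S ∪ I) = J₁ \ I := by
      ext e
      have := hFT e
      grind
    have e3 : S \ (S ∪ I) = ∅ := by grind
    rw [e1, e2, e3] at h2
    simpa using h2

/-- Only `z` columns remain, for rank `z` besides the linking rows. An independent part S₀ of the
Fejér elements, of size at least s - g, is completed by z - |S₀| columns; these are contracted and
the rest deleted. The cost is 3|S₀| + 6(s - |S₀|) + 2(z - |S₀|) + 4|S₀| = 6s - |S₀| + 2z ≤ 5s + g +
2z. -/
theorem bnd_defect_end (hm : m < n) {A : Finset E} {s g z : ℕ} {a b : ℤ}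
    (h : Bnd (Blk (W := W) Λ m 0 0 0) a) (hab : a + 5 * s + g + 2 * z ≤ b) :
    Bnd (Defect (W := W) Λ m s g 0 z 0 A) b := by
  refine Bnd.clear (m := 5 * s + g + 2 * z) h (by omega) ?_
  rintro v κ K ⟨X₁, J₁, S, hX, hJ, hS, hXA, hA, hst, hSH, hrk⟩
  obtain rfl : X₁ = ∅ := Finset.card_eq_zero.1 hX
  have hFX := fun e => hst.shape.disj_XF (e := e)
  have hFT := fun e => hst.shape.disj_FT (e := e)
  have hXT := fun e => hst.shape.disj_XT (e := e)
  obtain ⟨S₀, hS₀, hfS, hsS⟩ := exists_freeMod v (K ⊔ sp v A) S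
  obtain ⟨J₀, hJ₀, hfJ, hsJ⟩ :=
    exists_freeMod v (K ⊔ sp v (Λ.L m ∪ Λ.after m) ⊔ sp v S₀) J₁
  have hfS' : FreeMod v (K ⊔ sp v (Λ.L m ∪ Λ.after m)) S₀ :=
    hfS.anti (sup_le_sup_left (sp_mono hA) _)
  have hdSJ : Disjoint S₀ J₀ := by
    rw [Finset.disjoint_left]
    intro e he he'
    exact hFT e (by grind) (hS₀ he)
  have hfI := hfS'.union hfJ hdSJ
  have hu : Unif v K (Λ.H v m) (Λ.L m ∪ J₁) (z + l) := by
    have := hst.unif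
    rw [Finset.empty_union] at this
    convert this using 1
    omega
  have hLc := Λ.card_L m hm
  have hcard := hst.card hm
  rw [Finset.empty_union, Finset.card_empty] at hcard
  obtain ⟨hfL, huL⟩ := Unif.contract (I := Λ.L m) (G' := J₁) (d := z) (by rw [hLc]; exact hu)
    Finset.subset_union_left (by omega) Finset.subset_union_right (by
      rw [Finset.disjoint_left]
      intro e he he'
      exact hFX e (by grind) (by grind))
  have hfA := hst.good.free_after hm huL.le
  set M := K ⊔ sp v (S₀ ∪ J₀) with hM
  have hML : M ⊔ sp v (Λ.L m) ≤ Λ.H v m := by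
    refine sup_le (sup_le hu.le (sp_le_iff.2 fun e he => ?_)) (huL.le.trans' le_sup_right)
    rcases Finset.mem_union.1 he with he | he
    · exact hSH e (hS₀ he)
    · exact hu.mem e (Finset.mem_union_right _ (hJ₀ he))
  have hH : Λ.H v m ≤ M ⊔ sp v (Λ.L m) ⊔ sp v (Λ.after m) := by
    have h1 := hu.spans (Λ.L m ∪ J₁) le_rfl (by omega)
    rw [sp_union] at h1
    refine h1.trans (sup_le ?_ (sup_le ?_ (hsJ.trans ?_)))
    · exact (le_sup_left.trans le_sup_left).trans le_sup_left
    · exact le_sup_right.trans le_sup_left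
    · rw [sp_union, hM, sp_union]
      refine le_of_eq ?_
      ac_rfl
  have hfA' := hst.good.free_after hm (K := Λ.H v m) le_rfl
  have hfA'' := hst.good.free_after hm hML
  -- The later rows are independent modulo `H` and modulo its subspace alike. The spaces agree after
  -- adding those rows, hence they agree already.
  have hHrk : Module.finrank ℚ (Λ.H v m) = Module.finrank ℚ (M ⊔ sp v (Λ.L m) : Submodule ℚ W) := by
    have h1 := Submodule.finrank_mono (sup_le hH le_sup_right :
      Λ.H v m ⊔ sp v (Λ.after m) ≤ M ⊔ sp v (Λ.L m) ⊔ sp v (Λ.after m))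
    have h2 := Submodule.finrank_mono hML
    unfold FreeMod at hfA' hfA''
    omega
  have hIc : (S₀ ∪ J₀).card = z := by
    have h1 : K ⊔ sp v (Λ.L m ∪ Λ.after m) ⊔ sp v (S₀ ∪ J₀) =
        M ⊔ sp v (Λ.L m) ⊔ sp v (Λ.after m) := by
      rw [hM, sp_union v (Λ.L m)]
      ac_rfl
    have h2 := hu.rank
    unfold FreeMod at hfI hfA'' hfA hfL
    rw [h1] at hfI
    rw [sp_union v (Λ.L m), ← sup_assoc] at hfI
    omega
  have hfK : FreeMod v K (S₀ ∪ J₀) := hfI.anti le_sup_left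
  have hSc : s ≤ S₀.card + g := by
    have h1 := Submodule.finrank_mono (sup_le le_sup_left hsS :
      K ⊔ sp v A ⊔ sp v S ≤ K ⊔ sp v A ⊔ sp v S₀)
    unfold FreeMod at hfS
    omega
  have hSS := Finset.card_sdiff_add_card_eq_card hS₀
  have hJJ := Finset.card_sdiff_add_card_eq_card hJ₀
  rw [Finset.card_union_of_disjoint hdSJ] at hIc
  have hsF : ∀ I ⊆ J₁, ∑ e ∈ I, κ e = 2 * I.card := fun I hI =>
    hst.shape.sum_AF (hI.trans Finset.subset_union_left)
  have hsT : ∀ I ⊆ S, ∑ e ∈ I, κ e = 3 * I.card := fun I hI => hst.shape.sum_AT hI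
  have hdJ := Finset.disjoint_left.1 hst.disjJ
  have hdD : Disjoint (S \ S₀) (J₁ \ J₀) := by
    rw [Finset.disjoint_left]
    intro e he he'
    exact hFT e (by grind) (by grind)
  refine ⟨(S \ S₀) ∪ (J₁ \ J₀), S₀ ∪ J₀, ?_, fun e _ => (hst.shape e).2.2.2, ?_, hfK, ∅, ∅, rfl,
    rfl, hst.good, by simp, by simp, hst.shape.off _ ?_ ?_ ?_, le_sup_left.trans hML, ?_, ?_, ?_⟩
  · rw [Finset.disjoint_left]
    intro e he he'
    have := hFT e
    grind
  · rw [Finset.sum_union hdD, Finset.sum_union hdSJ, hsT _ Finset.sdiff_subset, hsT _ hS₀,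
      hsF _ Finset.sdiff_subset, hsF _ hJ₀]
    push_cast
    omega
  · ext e
    have := hFX e
    have := hXT e
    grind
  · ext e
    have := hFT e
    have := hdJ (a := e)
    grind
  · rw [Finset.sdiff_eq_empty_iff_subset]
    intro e he
    simp only [Finset.mem_union, Finset.mem_sdiff, he]
    tauto
  · intro e he
    exact hu.mem e (by grind)
  · have := hu.rank
    rw [← Finset.card_union_of_disjoint hdSJ] at hIc
    unfold FreeMod at hfK
    omega
  · intro T hT hTc
    have hTL : T = Λ.L m := Finset.eq_of_subset_of_card_le (by grind) (by omega)
    rw [hTL]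
    exact (Submodule.eq_of_le_of_finrank_eq hML hHrk.symm).ge

/-- Descent on `2x + z + w` preserves `g ≤ s < z + g`. Splitting a row either creates a row without
variables or an excess column; differencing a column either removes an excess or trades one unit of
`z` for one unit of defect. It stops when the defect is full or only linking rows and `z` columns
are left. -/
theorem bnd_defect (hm : m < n) (hl : 1 ≤ l) (A : Finset E)
    (h : ∀ x, ∀ w ≤ l, Bnd (Blk (W := W) Λ m x 0 w) (3 * (x + w) + 3 * (Λ.cols m).card + l))
    (s N : ℕ) :
    ∀ g x z w, 2 * x + z + w = N → w ≤ l → g ≤ s → s < z + g →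
      Bnd (Defect (W := W) Λ m s g x z w A)
        (5 * s + g + 2 * z + 3 * x + 3 * w + 3 * (Λ.cols m).card + l) := by
  induction N using Nat.strong_induction_on with
  | _ N ih =>
    intro g x z w hN hw hg hsz
    rcases hg.eq_or_lt with rfl | hg
    · exact bnd_defect_full hm (h x w hw) (by omega)
    rcases w with _ | w
    · rcases x with _ | x
      · exact bnd_defect_end hm (h 0 0 (by omega)) (by push_cast; omega)
      · refine Bnd.split (ih (2 * x + (z + 1) + 0) (by omega) g x (z + 1) 0 rfl hw hg.le (by omega))
          (ih (2 * x + z + 1) (by omega) g x z 1 rfl hl hg.le hsz) (by push_cast; omega)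
          (by push_cast; omega) ?_
        rintro v κ K ⟨X₁, J₁, S, hX, hJ, hS, hXA, hA, hst, hSH, hrk⟩
        obtain ⟨e, he⟩ := Finset.card_pos.1 (show 0 < X₁.card by omega)
        have hd := hst.delX hm he (by omega)
        obtain ⟨hc, hc'⟩ := St.conX (d := x + z + l) (by convert hst using 1; omega) hm he
          (by omega)
        have hXc : (X₁.erase e).card = x := by rw [Finset.card_erase_of_mem he]; omega
        have hXA' := (Finset.erase_subset e X₁).trans hXA
        refine ⟨e, (hst.shape e).1.2 (by grind), hc,
          ⟨X₁.erase e, J₁, S, hXc, by omega, hS, hXA', hA, by convert hd using 1; omega, hSH, hrk⟩,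
          ⟨X₁.erase e, J₁, S, hXc, by omega, hS, hXA', hA, hc', hSH, ?_⟩⟩
        -- A contracted row of `A` already lies in the space modulo which the defect is measured.
        have : K ⊔ Submodule.span ℚ {v e} ⊔ sp v A = K ⊔ sp v A := by
          have hvA : Submodule.span ℚ {v e} ≤ sp v A :=
            (Submodule.span_singleton_le_iff_mem _ _).2 (mem_sp (hXA he))
          rw [sup_assoc, sup_eq_right.2 hvA]
        rw [this]
        exact hrk
    -- `z` is positive because `g < s < z + g`.
    · obtain ⟨z, rfl⟩ : ∃ z', z = z' + 1 := ⟨z - 1, by omega⟩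
      refine Bnd.weyl_contract
        (ih (2 * x + (z + 1) + w) (by omega) g x (z + 1) w rfl (by omega) hg.le hsz)
        (ih (2 * x + z + (w + 1)) (by omega) (g + 1) x z (w + 1) rfl hw hg (by omega))
        (by push_cast; omega) (by push_cast; omega) ?_
      rintro v κ K ⟨X₁, J₁, S, hX, hJ, hS, hXA, hA, hst, hSH, hrk⟩
      obtain ⟨e, he⟩ := Finset.card_pos.1 (show 0 < J₁.card by omega)
      have hd := hst.delJ hm he (by omega)
      obtain ⟨hc, hc'⟩ := St.conJ (d := x + z + l) (by convert hst using 1; omega) hm he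
        (by omega)
      have hJc : (J₁.erase e).card = x + z + (w + 1) := by
        rw [Finset.card_erase_of_mem he]; omega
      refine ⟨e, (hst.shape e).2.1.2 (by grind), hc,
        ⟨X₁, J₁.erase e, S, hX, by omega, hS, hXA, hA, hd, hSH, hrk⟩,
        ⟨X₁, J₁.erase e, S, hX, hJc, hS, hXA, hA, hc', hSH, ?_⟩⟩
      -- A contracted column raises the rank of the reference space by at most one, so the defect
      -- grows by at most one.
      have h1 : K ⊔ Submodule.span ℚ {v e} ⊔ sp v A = (K ⊔ sp v A) ⊔ sp v {e} := by
        rw [sp_singleton]; ac_rfl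
      have h2 := finrank_sup_sp_le v (K ⊔ sp v A) {e}
      have h3 : Module.finrank ℚ (K ⊔ sp v A ⊔ sp v S : Submodule ℚ W) ≤
          Module.finrank ℚ ((K ⊔ sp v A) ⊔ sp v {e} ⊔ sp v S : Submodule ℚ W) :=
        Submodule.finrank_mono (sup_le_sup_right le_sup_left _)
      rw [h1]
      rw [Finset.card_singleton] at h2
      omega

end Linked

/-! ### Linking rows and the induction over the blocks. -/

section Main

variable {E W : Type*} [Fintype E] [DecidableEq E] [AddCommGroup W] [Module ℚ W]
  [FiniteDimensional ℚ W] {n l q : ℕ} {Λ : Links E n l q} {v : E → W} {κ : E → ℕ}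
  {K : Submodule ℚ W} {m : ℕ}

theorem cnt_zero_le (P : ℕ) (v : E → W) (K : Submodule ℚ W) (h : ∀ e, κ e = 0) :
    cnt P v κ K ≤ 1 := by
  classical
  have h1 : (conf P κ).card = 1 := by
    simp [conf, h, half_zero]
  rw [cnt_eq]
  calc _ ≤ ∑ a ∈ conf P κ, ∑ b ∈ conf P κ, 1 :=
        Finset.sum_le_sum fun a _ => Finset.sum_le_sum fun b _ => by split_ifs <;> omega
    _ = 1 := by simp [h1]

theorem bnd_zero : Bnd (fun (_ : E → W) (κ : E → ℕ) _ => ∀ e, κ e = 0) 0 := by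
  intro ε hε
  refine ⟨1, zero_le_one, fun P hP v κ K h => ?_⟩
  have hP' : (1 : ℝ) ≤ P := by exact_mod_cast hP
  have h1 : (cnt P v κ K : ℝ) ≤ 1 := by exact_mod_cast cnt_zero_le P v K h
  have h2 : (1 : ℝ) ≤ (P : ℝ) ^ (((0 : ℤ) : ℝ) + ε) :=
    Real.one_le_rpow hP' (by push_cast; linarith)
  linarith

theorem Shape.eq_zero (h : Shape κ ∅ ∅ ∅) (e : E) : κ e = 0 := by
  have := h e
  simp only [Finset.notMem_empty, iff_false] at this
  omega

/-- Systems in which only the blocks after `m` are left. -/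
def Done (Λ : Links E n l q) (m : ℕ) (v : E → W) (κ : E → ℕ) (K : Submodule ℚ W) : Prop :=
  Good Λ v ∧ K = Λ.H v m ∧ Shape κ (Λ.after m) (Λ.cols m) ∅

/-- Systems with `p` linking rows with variables, `z` without variables, and `s` Fejér elements. -/
def Part (Λ : Links E n l q) (m s z p : ℕ) (v : E → W) (κ : E → ℕ) (K : Submodule ℚ W) : Prop :=
  ∃ L' L₀ S : Finset E, L' ⊆ L₀ ∧ L₀ ⊆ Λ.L m ∧ L'.card = p ∧ L₀.card = p + z ∧ S.card = s ∧
    Good Λ v ∧ Shape κ (L' ∪ Λ.after m) (Λ.cols m) S ∧ (∀ e ∈ Λ.L m \ L₀, v e ∈ K) ∧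
    Disjoint L₀ S ∧ Unif v K (Λ.H v m) (L₀ ∪ S) (p + z)

/-- The Fejér elements are as many as the remaining rank, so they span `H` modulo `K`. They are
contracted, and the `p` linking rows that still have variables are deleted, at cost 3s + 2p = 5s -
2z. -/
theorem bnd_part_eq (hm : m < n) {s z p : ℕ} {a b : ℤ} (h : Bnd (Done (W := W) Λ m) a)
    (hs : p + z = s) (hab : a + 2 * p + 3 * s ≤ b) : Bnd (Part (W := W) Λ m s z p) b := by
  refine Bnd.clear (m := 2 * p + 3 * s) h (by omega) ?_
  rintro v κ K ⟨L', L₀, S, hL', hL₀, hp, hpz, hS, hg, hsh, hK, hd, hu⟩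
  have hXF := fun e => hsh.disj_XF (e := e)
  have hXT := fun e => hsh.disj_XT (e := e)
  have hFT := fun e => hsh.disj_FT (e := e)
  have hLA := Finset.disjoint_left.1 (Λ.disj_L_after m hm)
  have hH : K ⊔ sp v S = Λ.H v m := le_antisymm
    (sup_le hu.le (sp_le_iff.2 fun e he => hu.mem e (Finset.mem_union_right _ he)))
    (hu.spans S Finset.subset_union_right (by omega))
  refine ⟨L', S, ?_, fun e _ => (hsh e).2.2.2, ?_, ?_, hg, hH, hsh.off _ ?_ ?_ ?_⟩
  · exact hd.mono_left hL'
  · rw [hsh.sum_AX Finset.subset_union_left, hsh.sum_AT le_rfl, hp, hS]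
    push_cast
    omega
  · have := hu.rank
    unfold FreeMod
    rw [hH]
    omega
  · ext e
    have := hXT e
    have := hLA (a := e)
    grind
  · ext e
    have := hFT e
    have := hXF e
    grind
  · rw [Finset.sdiff_eq_empty_iff_subset]
    exact Finset.subset_union_right

/-- Splitting a linking row either deletes its variables at cost 1, so that `z` grows and the
allowance falls by one, or contracts it freely. The process ends when the rank has come down to `s`
or no linking row has variables. -/
theorem bnd_part (hm : m < n) {s : ℕ} (hdone : Bnd (Done (W := W) Λ m) (3 * (Λ.cols m).card + l))
    (hz : ∀ z ≤ l, s < z → Bnd (Part (W := W) Λ m s z 0) (5 * s + 3 * (Λ.cols m).card + l - z))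
    (p : ℕ) :
    ∀ z, s ≤ p + z → p + z ≤ l →
      Bnd (Part (W := W) Λ m s z p) (5 * s + 3 * (Λ.cols m).card + l - z) := by
  induction p with
  | zero =>
    intro z hsz hzl
    rcases hsz.eq_or_lt with h | h
    · exact bnd_part_eq hm hdone h.symm (by push_cast; omega)
    · exact hz z (by omega) (by omega)
  | succ p ih =>
    intro z hsz hzl
    rcases hsz.eq_or_lt with h | h
    · exact bnd_part_eq hm hdone h.symm (by push_cast; omega)
    refine Bnd.split (ih (z + 1) (by omega) (by omega)) (ih z (by omega) (by omega))
      (by push_cast; omega) (by omega) ?_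
    rintro v κ K ⟨L', L₀, S, hL', hL₀, hp, hpz, hS, hg, hsh, hK, hd, hu⟩
    obtain ⟨e, he⟩ := Finset.card_pos.1 (show 0 < L'.card by omega)
    have hXF := hsh.disj_XF (e := e) (by grind)
    have hXT := hsh.disj_XT (e := e) (by grind)
    have heA : e ∉ Λ.after m := Finset.disjoint_left.1 (Λ.disj_L_after m hm) (hL₀ (hL' he))
    have hc : (L₀ ∪ S).card = p + 1 + z + s := by rw [Finset.card_union_of_disjoint hd]; omega
    obtain ⟨h1, h2⟩ := Unif.contract_one (d := p + z) (e := e) (by convert hu using 1; omega)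
      (by grind) (by omega)
    have hL'c : (L'.erase e).card = p := by rw [Finset.card_erase_of_mem he]; omega
    have hL₀c : (L₀.erase e).card = p + z := by rw [Finset.card_erase_of_mem (hL' he)]; omega
    have hsh' : Shape (Function.update κ e 0) (L'.erase e ∪ Λ.after m) (Λ.cols m) S := by
      rw [← off_singleton]
      exact hsh.off {e} (by grind) (by grind) (by grind)
    refine ⟨e, (hsh e).1.2 (by grind), h1,
      ⟨L'.erase e, L₀, S, (Finset.erase_subset _ _).trans hL', hL₀, hL'c, by omega, hS, hg, hsh',
        hK, hd, by convert hu using 1; omega⟩,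
      ⟨L'.erase e, L₀.erase e, S, Finset.erase_subset_erase _ hL',
        (Finset.erase_subset _ _).trans hL₀, hL'c, hL₀c, hS, hg, hsh', ?_,
        hd.mono_left (Finset.erase_subset _ _), h2.mono (by grind)⟩⟩
    intro f hf
    by_cases hfe : f = e
    · subst hfe
      exact Submodule.mem_sup_right (Submodule.mem_span_singleton_self _)
    · exact Submodule.mem_sup_left (hK f (by grind))

theorem Unif.freeMod {v : E → W} {K H : Submodule ℚ W} {G I : Finset E} {d : ℕ}
    (h : Unif v K H G d) (hI : I ⊆ G) (hd : d ≤ G.card) (hId : I.card ≤ d) : FreeMod v K I :=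
  (Unif.contract (d := d - I.card) (G' := ∅) (by rwa [Nat.sub_add_cancel hId]) hI (by omega)
    (by simp) (by simp)).1

theorem bnd_part_last (hm : m + 1 = n) {s z : ℕ} (hsz : s ≤ z) {b : ℤ} (hb : 3 * s ≤ b) :
    Bnd (Part (W := W) Λ m s z 0) b := by
  refine Bnd.clear (m := 3 * s) bnd_zero (by omega) ?_
  rintro v κ K ⟨L', L₀, S, hL', hL₀, hp, hpz, hS, hg, hsh, hK, hd, hu⟩
  obtain rfl : L' = ∅ := Finset.card_eq_zero.1 hp
  rw [Λ.after_last m hm, Λ.cols_last m hm] at hsh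
  have hc : (L₀ ∪ S).card = z + s := by rw [Finset.card_union_of_disjoint hd]; omega
  refine ⟨∅, S, by simp, fun e _ => (hsh e).2.2.2, ?_,
    hu.freeMod Finset.subset_union_right (by omega) (by omega), ?_⟩
  · rw [hsh.sum_AT le_rfl, hS]; simp
  · exact Shape.eq_zero (hsh.off (∅ ∪ S) (by simp) (by simp) (by simp))

/-- The `z` uncontracted linking rows are the rows without variables of the next block, and its q +
l columns leave the excess l - z. The Fejér elements are independent modulo `K` and lie in the span
of the earlier rows, so later rows do not disturb this and the defect is 0. -/
theorem bnd_part_next (hm : m + 1 < n) (hl : 1 ≤ l)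
    (h : ∀ x, ∀ w ≤ l,
      Bnd (Blk (W := W) Λ (m + 1) x 0 w) (3 * (x + w) + 3 * (Λ.cols (m + 1)).card + l))
    {s z : ℕ} (hzl : z ≤ l) (hsz : s < z) :
    Bnd (Part (W := W) Λ m s z 0) (5 * s + 3 * (Λ.cols m).card + l - z) := by
  have hcols : (Λ.cols m).card = q + l + (Λ.cols (m + 1)).card := by
    rw [Λ.cols_succ m hm, Finset.card_union_of_disjoint (Λ.disj_J m hm), Λ.card_J m hm]
  refine Bnd.mono (bnd_defect hm hl (Λ.after m) h s (2 * q + z + (l - z)) 0 q z (l - z) rfl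
    (by omega) (by omega) (by omega)) ?_ (by push_cast [Nat.cast_sub hzl]; omega)
  rintro v κ K ⟨L', L₀, S, hL', hL₀, hp, hpz, hS, hg, hsh, hK, hd, hu⟩
  obtain rfl : L' = ∅ := Finset.card_eq_zero.1 hp
  have hLc := Λ.card_L m (by omega)
  have hc : (L₀ ∪ S).card = z + s := by rw [Finset.card_union_of_disjoint hd]; omega
  have hH := hu.spans L₀ Finset.subset_union_left (by omega)
  have hnext := hg.unif_next hm hL₀ hu.le hK hH (by have := hu.rank; omega)
  have hA := Λ.after_succ m hm
  refine ⟨K, le_rfl, Λ.X (m + 1), Λ.J (m + 1), S, Λ.card_X m hm, by rw [Λ.card_J m hm]; omega, hS,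
    by grind, by grind, ⟨hg, Λ.disj_X m hm, Λ.disj_J m hm, ?_, ?_⟩, ?_, ?_⟩
  · rwa [Finset.empty_union, hA, Λ.cols_succ m hm] at hsh
  · have := hnext.mono (G' := Λ.X (m + 1) ∪ (Λ.L (m + 1) ∪ Λ.J (m + 1)))
      Finset.subset_union_right
    convert this using 1
    omega
  · intro e he
    exact Λ.H_mono v hm (hu.mem e (Finset.mem_union_right _ he))
  · have hf := hu.freeMod (I := S) Finset.subset_union_right (by omega) (by omega)
    have h1 : K ⊔ sp v S ≤ Λ.H v m :=
      sup_le hu.le (sp_le_iff.2 fun e he => hu.mem e (Finset.mem_union_right _ he))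
    have h2 := hg.free_after (by omega) h1
    have h3 := hg.free_after (by omega) hu.le
    have h4 : K ⊔ sp v (Λ.after m) ⊔ sp v S = K ⊔ sp v S ⊔ sp v (Λ.after m) := by ac_rfl
    rw [h4]
    unfold FreeMod at hf h2 h3
    omega

theorem bnd_done_last (hm : m + 1 = n) {b : ℤ} (hb : 0 ≤ b) : Bnd (Done (W := W) Λ m) b := by
  refine Bnd.mono bnd_zero ?_ hb
  rintro v κ K ⟨hg, hK, hsh⟩
  rw [Λ.after_last m hm, Λ.cols_last m hm] at hsh
  exact ⟨K, le_rfl, hsh.eq_zero⟩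

/-- With the whole span of the previous rows in `K`, the linking rows vanish: the next block has `q`
own rows and q + l columns, hence excess `l`. -/
theorem bnd_done_next (hm : m + 1 < n)
    (h : Bnd (Blk (W := W) Λ (m + 1) q 0 l) (3 * (q + l) + 3 * (Λ.cols (m + 1)).card + l)) :
    Bnd (Done (W := W) Λ m) (3 * (Λ.cols m).card + l) := by
  have hcols : (Λ.cols m).card = q + l + (Λ.cols (m + 1)).card := by
    rw [Λ.cols_succ m hm, Finset.card_union_of_disjoint (Λ.disj_J m hm), Λ.card_J m hm]
  refine Bnd.mono h ?_ (by push_cast [hcols]; omega)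
  rintro v κ K ⟨hg, rfl, hsh⟩
  have hnext := hg.unif_next hm (L₀ := ∅) (by simp) le_rfl
    (fun e he => mem_sp (Λ.L_below m (by omega) (by grind))) le_sup_left (by simp)
  refine ⟨_, le_rfl, Λ.X (m + 1), Λ.J (m + 1), Λ.card_X m hm, by rw [Λ.card_J m hm]; omega,
    hg, Λ.disj_X m hm, Λ.disj_J m hm, ?_, ?_⟩
  · rwa [Λ.after_succ m hm, Λ.cols_succ m hm] at hsh
  · rw [Finset.empty_union] at hnext
    convert hnext using 1
    simp

theorem bnd_blk_of_part (hm : m < n) (hl : 1 ≤ l)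
    (h : ∀ s ≤ l, Bnd (Part (W := W) Λ m s 0 l) (5 * s + 3 * (Λ.cols m).card + l)) (x : ℕ) :
    ∀ w ≤ l, Bnd (Blk (W := W) Λ m x 0 w) (3 * (x + w) + 3 * (Λ.cols m).card + l) := by
  refine bnd_blk_of_zero hm hl (fun w hw => ?_) x
  refine Bnd.mono (bnd_mix (fun s hs => Bnd.mono (h s hs) ?_ le_rfl) w 0 hw) ?_
    (by push_cast; omega)
  · rintro v κ K ⟨J₁, S, hJ, hS, hg, hdJ, hsh, hu⟩
    obtain rfl : J₁ = ∅ := Finset.card_eq_zero.1 hJ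
    rw [Finset.empty_union] at hu hsh
    refine ⟨K, le_rfl, Λ.L m, Λ.L m, S, le_rfl, le_rfl, Λ.card_L m hm, Λ.card_L m hm, hS, hg, hsh,
      by simp, ?_, hu⟩
    rw [Finset.disjoint_left]
    exact fun e he => hsh.disj_XT (by grind)
  · rintro v κ K ⟨X₁, J₁, hX, hJ, hst⟩
    obtain rfl : X₁ = ∅ := Finset.card_eq_zero.1 hX
    have h1 := hst.shape
    have h2 := hst.unif
    rw [Finset.empty_union] at h1 h2
    refine ⟨K, le_rfl, J₁, ∅, by omega, rfl, hst.good, hst.disjJ, h1, ?_⟩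
    rw [Finset.union_empty]
    convert h2 using 1
    omega

/-- Induction on the number `k` of blocks after `m`; the last block has nothing to hand its Fejér
elements to and simply contracts them. -/
theorem bnd_blk (hl : 1 ≤ l) (k : ℕ) :
    ∀ m, m + k + 1 = n → ∀ x, ∀ w ≤ l,
      Bnd (Blk (W := W) Λ m x 0 w) (3 * (x + w) + 3 * (Λ.cols m).card + l) := by
  induction k with
  | zero =>
    intro m hm x
    refine bnd_blk_of_part (by omega) hl (fun s hs => ?_) x
    simpa using bnd_part (by omega) (bnd_done_last hm (by positivity))
      (fun z hz hsz => bnd_part_last hm hsz.le (by omega)) l 0 (by omega) (by omega)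
  | succ k ih =>
    intro m hm x
    have hnext := ih (m + 1) (by omega)
    refine bnd_blk_of_part (by omega) hl (fun s hs => ?_) x
    simpa using bnd_part (by omega) (bnd_done_next (by omega) (hnext q l le_rfl))
      (fun z hz hsz => bnd_part_next (by omega) hl hnext hz hsz) l 0 (by omega) (by omega)

end Main

/-! ### The mean value as a number of solutions. -/

section Orthogonality

open MeasureTheory

/-- The additive character `e(x) = exp(2πix)`. -/
noncomputable def ee (x : ℝ) : ℂ := Complex.exp (2 * Real.pi * Complex.I * (x : ℂ))

theorem ee_add (x y : ℝ) : ee (x + y) = ee x * ee y := by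
  unfold ee
  rw [← Complex.exp_add]
  push_cast
  ring_nf

theorem ee_sum {ι : Type*} (s : Finset ι) (f : ι → ℝ) : ee (∑ i ∈ s, f i) = ∏ i ∈ s, ee (f i) := by
  unfold ee
  rw [← Complex.exp_sum]
  push_cast
  rw [Finset.mul_sum]

theorem conj_ee (x : ℝ) : (starRingEnd ℂ) (ee x) = ee (-x) := by
  unfold ee
  rw [← Complex.exp_conj]
  simp [Complex.conj_ofReal, Complex.conj_ofNat]

theorem continuous_ee : Continuous ee := by
  unfold ee
  fun_prop

theorem integral_ee (c : ℤ) :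
    ∫ x in Set.Icc (0 : ℝ) 1, ee (c * x) = if c = 0 then 1 else 0 := by
  rw [integral_Icc_eq_integral_Ioc, ← intervalIntegral.integral_of_le zero_le_one]
  split_ifs with hc
  · simp [hc, ee]
  · have hne : (2 * Real.pi * Complex.I * (c : ℂ)) ≠ 0 := by
      have : (c : ℂ) ≠ 0 := by exact_mod_cast hc
      have := Complex.two_pi_I_ne_zero
      positivity
    have h := integral_exp_mul_complex (a := 0) (b := 1) hne
    have h1 : ∀ x : ℝ, ee (c * x) = Complex.exp (2 * Real.pi * Complex.I * (c : ℂ) * (x : ℂ)) := by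
      intro x
      unfold ee
      push_cast
      ring_nf
    simp only [h1]
    rw [h]
    have h2 : Complex.exp (2 * Real.pi * Complex.I * (c : ℂ)) = 1 := by
      rw [mul_comm]
      exact Complex.exp_int_mul_two_pi_mul_I c
    simp [h2]

theorem integral_ee_box {R : ℕ} (c : Fin R → ℤ) :
    ∫ η in Set.Icc (0 : Fin R → ℝ) 1, ee (∑ i, c i * η i) = if c = 0 then 1 else 0 := by
  have h1 : (volume : Measure (Fin R → ℝ)).restrict (Set.Icc 0 1) =
      Measure.pi fun _ => (volume : Measure ℝ).restrict (Set.Icc 0 1) := by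
    rw [← Measure.restrict_pi_pi, ← volume_pi, Set.pi_univ_Icc]
    rfl
  simp only [ee_sum]
  rw [h1, integral_fintype_prod_eq_prod (fun i x => ee (c i * x))]
  simp only [integral_ee]
  split_ifs with h
  · simp [h]
  · obtain ⟨i, hi⟩ := Function.ne_iff.1 h
    exact Finset.prod_eq_zero (Finset.mem_univ i) (if_neg hi)

/-- Kinds of the variables in the mean value. -/
def kind {R C : ℕ} : Fin R ⊕ Fin C → ℕ := Sum.elim (fun _ => 1) fun _ => 2

/-- The columns of `D` as rational vectors. -/
def colVec {R : ℕ} {E : Type*} (D : Matrix (Fin R) E ℤ) (e : E) : Fin R → ℚ := fun i => (D i e : ℚ)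

theorem cubicSum_eq (P : ℕ) (θ : ℝ) :
    cubicSum P θ = ∑ p ∈ half P 1, ee ((val 1 p : ℤ) * θ) := by
  simp only [cubicSum, half, box, val, ee]
  simp [mul_comm]

theorem cubicSum_sq_eq (P : ℕ) (θ : ℝ) :
    cubicSum P θ ^ 2 = ∑ p ∈ half P 2, ee ((val 2 p : ℤ) * θ) := by
  have h1 : cubicSum P θ = ∑ x ∈ box P, ee ((x : ℝ) ^ 3 * θ) := by
    simp [cubicSum, box, ee, mul_comm]
  rw [h1, sq, Finset.sum_mul_sum]
  simp only [half, val]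
  simp only [OfNat.ofNat_ne_zero, if_false, OfNat.ofNat_ne_one, if_true, le_refl,
    Finset.sum_product, ← ee_add]
  push_cast
  simp only [add_mul]

/-- The integrand is the squared modulus of one exponential sum over `conf`, since |g|⁴ = |g²|².
Expanding it as a double sum, integration keeps the pairs of configurations whose integer
coefficient vectors agree. -/
theorem meanValue_eq_cnt {R C : ℕ} (P : ℕ) (D : Matrix (Fin R) (Fin R ⊕ Fin C) ℤ) :
    meanValue P D = cnt P (colVec D) kind ⊥ := by
  classical
  set A := conf P (kind (R := R) (C := C)) with hA
  set c : (Fin R ⊕ Fin C → ℤ × ℤ) → Fin R → ℤ := fun a i => ∑ e, val (kind e) (a e) * D i e with hc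
  have hlin : ∀ a, lin (colVec D) kind a = fun i => (c a i : ℚ) := by
    intro a
    funext i
    simp [lin, colVec, hc]
  have hprod : ∀ η : Fin R → ℝ,
      (∏ a : Fin R, cubicSum P (linForm D η (Sum.inl a))) *
        ∏ b : Fin C, cubicSum P (linForm D η (Sum.inr b)) ^ 2 =
      ∑ a ∈ A, ee (∑ i, c a i * η i) := by
    intro η
    have h1 : (∏ a : Fin R, cubicSum P (linForm D η (Sum.inl a))) *
        ∏ b : Fin C, cubicSum P (linForm D η (Sum.inr b)) ^ 2 =
        ∏ e : Fin R ⊕ Fin C, ∑ p ∈ half P (kind e), ee ((val (kind e) p : ℤ) * linForm D η e) := by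
      rw [Fintype.prod_sum_type]
      congr 1
      · exact Finset.prod_congr rfl fun a _ => cubicSum_eq P _
      · exact Finset.prod_congr rfl fun b _ => cubicSum_sq_eq P _
    rw [h1, Finset.prod_univ_sum]
    refine Finset.sum_congr rfl fun a _ => ?_
    rw [← ee_sum]
    congr 1
    simp only [linForm, hc, Finset.mul_sum]
    rw [Finset.sum_comm]
    refine Finset.sum_congr rfl fun i _ => ?_
    push_cast
    rw [Finset.sum_mul]
    exact Finset.sum_congr rfl fun e _ => by ring
  have hint : ∀ η : Fin R → ℝ,
      (((∏ a : Fin R, ‖cubicSum P (linForm D η (Sum.inl a))‖ ^ 2) *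
        ∏ b : Fin C, ‖cubicSum P (linForm D η (Sum.inr b))‖ ^ 4 : ℝ) : ℂ) =
      ∑ a ∈ A, ∑ b ∈ A, ee (∑ i, (c a - c b) i * η i) := by
    intro η
    have h1 : (∏ a : Fin R, ‖cubicSum P (linForm D η (Sum.inl a))‖ ^ 2) *
        ∏ b : Fin C, ‖cubicSum P (linForm D η (Sum.inr b))‖ ^ 4 =
        ‖(∏ a : Fin R, cubicSum P (linForm D η (Sum.inl a))) *
        ∏ b : Fin C, cubicSum P (linForm D η (Sum.inr b)) ^ 2‖ ^ 2 := by
      rw [norm_mul, norm_prod, norm_prod, mul_pow, ← Finset.prod_pow, ← Finset.prod_pow]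
      congr 1
      refine Finset.prod_congr rfl fun b _ => ?_
      rw [norm_pow, ← pow_mul]
    rw [h1, hprod, Complex.ofReal_pow, ← Complex.mul_conj', map_sum, Finset.sum_mul_sum]
    refine Finset.sum_congr rfl fun a _ => Finset.sum_congr rfl fun b _ => ?_
    rw [conj_ee, ← ee_add]
    congr 1
    rw [← sub_eq_add_neg, ← Finset.sum_sub_distrib]
    refine Finset.sum_congr rfl fun i _ => ?_
    simp [sub_mul]
  have hcont : ∀ a b, IntegrableOn (fun η : Fin R → ℝ => ee (∑ i, (c a - c b) i * η i))
      (Set.Icc 0 1) := by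
    intro a b
    refine ContinuousOn.integrableOn_compact isCompact_Icc (Continuous.continuousOn ?_)
    exact continuous_ee.comp (by fun_prop)
  have hfin : ((meanValue P D : ℝ) : ℂ) = ((cnt P (colVec D) kind ⊥ : ℕ) : ℂ) := by
    rw [meanValue, ← integral_complex_ofReal]
    simp only [hint]
    rw [integral_finsetSum _ fun a _ => integrable_finsetSum _ fun b _ => hcont a b, cnt_eq]
    push_cast
    refine Finset.sum_congr rfl fun a _ => ?_
    rw [integral_finsetSum _ fun b _ => hcont a b]
    refine Finset.sum_congr rfl fun b _ => ?_
    rw [integral_ee_box]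
    refine if_congr ?_ rfl rfl
    rw [Submodule.mem_bot, hlin, hlin, sub_eq_zero, sub_eq_zero]
    constructor
    · intro h; rw [h]
    · intro h
      funext i
      exact_mod_cast congrFun h i
  exact_mod_cast hfin

end Orthogonality

/-! ### From non-vanishing minors to linear independence. -/

section Minors

theorem freeMod_of_linearIndepOn {E W : Type*} [DecidableEq E] [AddCommGroup W] [Module ℚ W]
    [FiniteDimensional ℚ W] {v : E → W} {S : Finset E} (h : LinearIndepOn ℚ v (S : Set E)) :
    FreeMod v ⊥ S := by
  have h1 := finrank_span_eq_card h
  rw [Set.range_comp' v Subtype.val, Subtype.range_coe] at h1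
  unfold FreeMod sp
  rw [bot_sup_eq, finrank_bot, zero_add, h1]
  simp

variable {R C : ℕ}

/-- The diagonal part next to a matrix. -/
abbrev withDiag (u : Fin R → ℤ) (V : Matrix (Fin R) (Fin C) ℤ) :
    Matrix (Fin R) (Fin R ⊕ Fin C) ℤ := Matrix.fromCols (Matrix.diagonal u) V

variable {u : Fin R → ℤ} {V : Matrix (Fin R) (Fin C) ℤ}

theorem minor_ne_zero {l m : ℕ} {i j : ℕ → ℕ} (h : IsTotallyNonsingular (block l i j V m))
    {T : Finset (Fin R)} {U : Finset (Fin C)} {k : ℕ} (hTk : T.card = k) (hUk : U.card = k)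
    (hT : ∀ a ∈ T, (a : ℕ) ∈ blockRows l i m) (hU : ∀ b ∈ U, (b : ℕ) ∈ blockCols j m) :
    (V.submatrix (T.orderEmbOfFin hTk) (U.orderEmbOfFin hUk)).det ≠ 0 :=
  h k
    (OrderEmbedding.ofMapLEIff
      (fun p => ⟨T.orderEmbOfFin hTk p, hT _ (T.orderEmbOfFin_mem hTk p)⟩) fun p p' => by
        rw [Subtype.mk_le_mk]; exact (T.orderEmbOfFin hTk).le_iff_le)
    (OrderEmbedding.ofMapLEIff
      (fun p => ⟨U.orderEmbOfFin hUk p, hU _ (U.orderEmbOfFin_mem hUk p)⟩) fun p p' => by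
        rw [Subtype.mk_le_mk]; exact (U.orderEmbOfFin hUk).le_iff_le)

theorem sum_colVec (S : Finset (Fin R ⊕ Fin C)) (f : Fin R ⊕ Fin C → ℚ) (a : Fin R) :
    (∑ e ∈ S, f e • colVec (withDiag u V) e) a =
      (if a ∈ S.toLeft then f (Sum.inl a) * u a else 0) +
        ∑ b ∈ S.toRight, f (Sum.inr b) * V a b := by
  rw [← Finset.toLeft_disjSum_toRight (u := S), Finset.sum_disjSum, Pi.add_apply]
  simp only [Finset.sum_apply, Pi.smul_apply, smul_eq_mul, colVec, Matrix.fromCols_apply_inl,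
    Matrix.fromCols_apply_inr, Finset.toLeft_disjSum, Finset.toRight_disjSum,
    Matrix.diagonal_apply]
  congr 1
  rw [← Finset.sum_ite_eq S.toLeft a fun b => f (Sum.inl b) * u b]
  refine Finset.sum_congr rfl fun b _ => ?_
  split_ifs with h
  · rw [h]
  · simp

/-- As many columns as there are rows in a totally non-singular block, out of the block and the
diagonal above it, are linearly independent. -/
theorem linearIndepOn_block {l m : ℕ} {i j : ℕ → ℕ} (hu : ∀ a, u a ≠ 0)
    (h : IsTotallyNonsingular (block l i j V m)) {B : Finset (Fin R)}
    (hB : ∀ a ∈ B, (a : ℕ) ∈ blockRows l i m) {S : Finset (Fin R ⊕ Fin C)}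
    (hSl : S.toLeft ⊆ B) (hSr : ∀ b ∈ S.toRight, (b : ℕ) ∈ blockCols j m)
    (hc : S.card = B.card) :
    LinearIndepOn ℚ (colVec (withDiag u V)) (S : Set (Fin R ⊕ Fin C)) := by
  rw [linearIndepOn_finset_iff]
  intro f hf
  have hrow : ∀ a, (if a ∈ S.toLeft then f (Sum.inl a) * u a else 0) +
      ∑ b ∈ S.toRight, f (Sum.inr b) * V a b = 0 := by
    intro a
    rw [← sum_colVec, hf, Pi.zero_apply]
  have hTk : (B \ S.toLeft).card = S.toRight.card := by
    have h1 := Finset.card_sdiff_add_card_eq_card hSl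
    have h2 := Finset.card_toLeft_add_card_toRight (u := S)
    omega
  set T := B \ S.toLeft
  set M : Matrix (Fin S.toRight.card) (Fin S.toRight.card) ℚ :=
    (V.submatrix (T.orderEmbOfFin hTk) (S.toRight.orderEmbOfFin rfl)).map (Int.castRingHom ℚ)
    with hM
  have hdet : M.det ≠ 0 := by
    have := minor_ne_zero h hTk rfl (fun a ha => hB a (Finset.mem_sdiff.1 ha).1) hSr
    rw [hM, ← RingHom.mapMatrix_apply, ← RingHom.map_det]
    simpa using this
  -- In the rows of `T` no chosen diagonal column has an entry, so the relation involves only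
  -- columns of `V` there, and their minor is non-zero. The diagonal coefficients follow from the
  -- other rows.
  have hMf : M.mulVec (fun p => f (Sum.inr (S.toRight.orderEmbOfFin rfl p))) = 0 := by
    funext p
    have h1 := hrow (T.orderEmbOfFin hTk p)
    have h2 := (Finset.mem_sdiff.1 (T.orderEmbOfFin_mem hTk p)).2
    rw [if_neg h2, zero_add] at h1
    have h3 := Finset.sum_map Finset.univ (S.toRight.orderEmbOfFin rfl).toEmbedding
      fun b => f (Sum.inr b) * (V (T.orderEmbOfFin hTk p) b : ℚ)
    rw [Finset.map_orderEmbOfFin_univ, h1] at h3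
    rw [Pi.zero_apply, h3]
    simp [M, Matrix.mulVec, dotProduct, mul_comm]
  have hcols : ∀ b ∈ S.toRight, f (Sum.inr b) = 0 := by
    intro b hb
    have h1 := Matrix.eq_zero_of_mulVec_eq_zero hdet hMf
    have h2 : b ∈ Finset.univ.map (S.toRight.orderEmbOfFin rfl).toEmbedding := by
      rwa [Finset.map_orderEmbOfFin_univ]
    obtain ⟨p, -, rfl⟩ := Finset.mem_map.1 h2
    exact congrFun h1 p
  rintro (a | b) he
  · have h1 := hrow a
    rw [Finset.sum_eq_zero fun b hb => by rw [hcols b hb, zero_mul], add_zero,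
      if_pos (Finset.mem_toLeft.2 he)] at h1
    exact (mul_eq_zero.1 h1).resolve_right (by exact_mod_cast hu a)
  · exact hcols b (Finset.mem_toRight.2 he)

theorem linearIndepOn_inl (hu : ∀ a, u a ≠ 0) {S : Finset (Fin R ⊕ Fin C)}
    (hS : S.toRight = ∅) :
    LinearIndepOn ℚ (colVec (withDiag u V)) (S : Set (Fin R ⊕ Fin C)) := by
  rw [linearIndepOn_finset_iff]
  intro f hf
  rintro (a | b) he
  · have h1 : (∑ e ∈ S, f e • colVec (withDiag u V) e) a = 0 := by rw [hf, Pi.zero_apply]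
    rw [sum_colVec, hS, Finset.sum_empty, add_zero, if_pos (Finset.mem_toLeft.2 he)] at h1
    exact (mul_eq_zero.1 h1).resolve_right (by exact_mod_cast hu a)
  · have := Finset.mem_toRight.2 he
    simp [hS] at this

theorem mem_sp_inl (hu : ∀ a, u a ≠ 0) {S : Finset (Fin R ⊕ Fin C)} {w : Fin R → ℚ}
    (hw : ∀ a, Sum.inl a ∉ S → w a = 0) : w ∈ sp (colVec (withDiag u V)) S := by
  have h1 : w = ∑ a : Fin R, (w a / u a) • colVec (withDiag u V) (Sum.inl a) := by
    funext a
    simp only [Finset.sum_apply, Pi.smul_apply, smul_eq_mul, colVec, Matrix.fromCols_apply_inl,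
      Matrix.diagonal_apply]
    rw [Finset.sum_eq_single a]
    · have : (u a : ℚ) ≠ 0 := by exact_mod_cast hu a
      rw [if_pos rfl]
      field_simp
    · intro b _ hb
      simp [hb.symm]
    · simp
  rw [h1]
  refine Submodule.sum_mem _ fun a _ => ?_
  by_cases ha : Sum.inl a ∈ S
  · exact Submodule.smul_mem _ _ (mem_sp ha)
  · rw [hw a ha, zero_div, zero_smul]
    exact Submodule.zero_mem _

end Minors

/-! ### Auxiliary matrices as chains of linked blocks. -/

section Concrete

variable {R C : ℕ}

/-- The diagonal columns with indices in `[a, b)`. -/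
def rowsIn (R C a b : ℕ) : Finset (Fin R ⊕ Fin C) :=
  (Finset.univ.filter fun i : Fin R => a ≤ (i : ℕ) ∧ (i : ℕ) < b).disjSum ∅

/-- The block columns with indices in `[a, b)`. -/
def colsIn (R C a b : ℕ) : Finset (Fin R ⊕ Fin C) :=
  (∅ : Finset (Fin R)).disjSum (Finset.univ.filter fun j : Fin C => a ≤ (j : ℕ) ∧ (j : ℕ) < b)

@[simp] theorem inl_mem_rowsIn {a b : ℕ} {i : Fin R} :
    Sum.inl i ∈ rowsIn R C a b ↔ a ≤ (i : ℕ) ∧ (i : ℕ) < b := by simp [rowsIn]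

@[simp] theorem inr_mem_rowsIn {a b : ℕ} {j : Fin C} : Sum.inr j ∉ rowsIn R C a b := by
  simp [rowsIn]

@[simp] theorem inl_mem_colsIn {a b : ℕ} {i : Fin R} : Sum.inl i ∉ colsIn R C a b := by
  simp [colsIn]

@[simp] theorem inr_mem_colsIn {a b : ℕ} {j : Fin C} :
    Sum.inr j ∈ colsIn R C a b ↔ a ≤ (j : ℕ) ∧ (j : ℕ) < b := by simp [colsIn]

theorem card_filter_fin {N a b : ℕ} (hb : b ≤ N) :
    (Finset.univ.filter fun i : Fin N => a ≤ (i : ℕ) ∧ (i : ℕ) < b).card = b - a := by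
  rw [← Nat.card_Ico, ← Finset.card_map Fin.valEmbedding]
  congr 1
  ext i
  simp only [Finset.mem_map, Finset.mem_filter, Finset.mem_univ, true_and, Fin.valEmbedding_apply,
    Finset.mem_Ico]
  constructor
  · rintro ⟨j, hj, rfl⟩
    exact hj
  · intro hi
    exact ⟨⟨i, by omega⟩, hi, rfl⟩

theorem card_rowsIn {a b : ℕ} (hb : b ≤ R) : (rowsIn R C a b).card = b - a := by
  rw [rowsIn, Finset.card_disjSum, card_filter_fin hb, Finset.card_empty, add_zero]

theorem card_colsIn {a b : ℕ} (hb : b ≤ C) : (colsIn R C a b).card = b - a := by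
  rw [colsIn, Finset.card_disjSum, card_filter_fin hb, Finset.card_empty, zero_add]

variable {r l n t ω : ℕ}

theorem auxRowCorner_succ (r l t m : ℕ) :
    auxRowCorner r l t (m + 1) = auxRowCorner r l t m + (r - l) := by
  unfold auxRowCorner; ring

theorem auxColCorner_succ (r l t ω m : ℕ) :
    auxColCorner r l t ω (m + 1) = auxColCorner r l t ω m + (r - l) := by
  unfold auxColCorner; ring

theorem auxRowCorner_mono (r l t : ℕ) : Monotone (auxRowCorner r l t) :=
  monotone_nat_of_le_succ fun m => by rw [auxRowCorner_succ]; omega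

theorem auxColCorner_mono (r l t ω : ℕ) : Monotone (auxColCorner r l t ω) :=
  monotone_nat_of_le_succ fun m => by rw [auxColCorner_succ]; omega

theorem auxRows_eq {m : ℕ} (h : m + 1 = n) : auxRows r l n t = auxRowCorner r l t m := by
  subst h; simp [auxRows, auxRowCorner, add_comm]

theorem auxCols_eq {m : ℕ} (h : m + 1 = n) : auxCols r l n t ω = auxColCorner r l t ω m := by
  subst h; simp [auxCols, auxColCorner, add_comm]

theorem auxRowCorner_le {m : ℕ} (h : m < n) : auxRowCorner r l t m ≤ auxRows r l n t := by
  rw [auxRows_eq (show n - 1 + 1 = n by omega)]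
  exact auxRowCorner_mono r l t (by omega)

theorem auxColCorner_le {m : ℕ} (h : m < n) : auxColCorner r l t ω m ≤ auxCols r l n t ω := by
  rw [auxCols_eq (show n - 1 + 1 = n by omega)]
  exact auxColCorner_mono r l t ω (by omega)

/-- The index sets of the blocks of an auxiliary matrix. -/
def auxLinks (r l n t ω : ℕ) (hr : 2 * l ≤ r) (ht : l ≤ t) :
    Links (Fin (auxRows r l n t) ⊕ Fin (auxCols r l n t ω)) n l (r - 2 * l) where
  -- For `m = 0` the truncated `m - 1` makes `X` and `J` empty. These values are never used: the
  -- first block is supplied by `blk_zero`.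
  X m := rowsIn _ _ (auxRowCorner r l t (m - 1)) (auxRowCorner r l t m - l)
  L m := rowsIn _ _ (auxRowCorner r l t m - l) (auxRowCorner r l t m)
  J m := colsIn _ _ (auxColCorner r l t ω (m - 1)) (auxColCorner r l t ω m)
  below m := rowsIn _ _ 0 (auxRowCorner r l t m)
  after m := rowsIn _ _ (auxRowCorner r l t m) (auxRows r l n t)
  cols m := colsIn _ _ (auxColCorner r l t ω m) (auxCols r l n t ω)
  card_L m hm := by
    rw [card_rowsIn (auxRowCorner_le hm)]
    have := auxRowCorner_mono r l t (Nat.zero_le m)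
    simp only [auxRowCorner, zero_mul, add_zero] at this ⊢
    omega
  card_X m hm := by
    have := auxRowCorner_le (r := r) (l := l) (t := t) hm
    rw [card_rowsIn (by omega), auxRowCorner_succ, Nat.add_sub_cancel]
    omega
  card_J m hm := by
    rw [card_colsIn (auxColCorner_le hm), auxColCorner_succ, Nat.add_sub_cancel]
    omega
  disj_L_after m _ := by
    rw [Finset.disjoint_left]
    rintro (i | j) h h' <;> simp at h h'; omega
  disj_below m _ := by
    rw [Finset.disjoint_left]
    rintro (i | j) h h' <;> simp at h h'; omega
  disj_X m _ := by
    rw [Finset.disjoint_left]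
    rintro (i | j) h h' <;> simp at h h'; omega
  disj_J m _ := by
    rw [Finset.disjoint_left]
    rintro (i | j) h h' <;> simp at h h'; omega
  disj_L_J m _ := by
    rw [Finset.disjoint_left]
    rintro (i | j) h h' <;> simp at h h'
  L_below m _ := by
    rintro (i | j) h <;> simp at h ⊢; omega
  below_succ m _ := by
    have := auxRowCorner_succ r l t m
    ext (i | j) <;> simp; omega
  after_succ m hm := by
    have := auxRowCorner_succ r l t m
    have := auxRowCorner_le (r := r) (l := l) (t := t) hm
    ext (i | j) <;> simp; omega
  cols_succ m hm := by
    have := auxColCorner_succ r l t ω m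
    have := auxColCorner_le (r := r) (l := l) (t := t) (ω := ω) hm
    ext (i | j) <;> simp; omega
  after_last m hm := by
    rw [← auxRows_eq hm]
    ext (i | j) <;> simp
  cols_last m hm := by
    rw [← auxCols_eq hm]
    ext (i | j) <;> simp

theorem blockCols_unique {m m' j : ℕ} (hj : j ∈ blockCols (auxColCorner r l t ω) m)
    (hj' : j ∈ blockCols (auxColCorner r l t ω) m') : m = m' := by
  have key : ∀ a b : ℕ, a < b → j ∈ blockCols (auxColCorner r l t ω) a →
      j ∈ blockCols (auxColCorner r l t ω) b → False := by
    intro a b hab ha hb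
    obtain ⟨b, rfl⟩ : ∃ b', b = b' + 1 := ⟨b - 1, by omega⟩
    have h1 := auxColCorner_mono r l t ω (show a ≤ b by omega)
    have h2 : j < auxColCorner r l t ω a := by
      rcases a with _ | a <;> simp [blockCols] at ha <;> omega
    simp only [blockCols, Finset.mem_Ico] at hb
    omega
  rcases lt_trichotomy m m' with h | h | h
  · exact (key _ _ h hj hj').elim
  · exact h
  · exact (key _ _ h hj' hj).elim

variable {u : Fin (auxRows r l n t) → ℤ}
  {V : Matrix (Fin (auxRows r l n t)) (Fin (auxCols r l n t ω)) ℤ}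

/-- The columns of a block lie in the span of its rows. -/
theorem colVec_mem_block (hu : ∀ a, u a ≠ 0)
    (hV : IsLinkedBlock n l (auxRowCorner r l t) (auxColCorner r l t ω) V) {m : ℕ}
    {b : Fin (auxCols r l n t ω)} (hb : (b : ℕ) ∈ blockCols (auxColCorner r l t ω) m)
    {S : Finset (Fin (auxRows r l n t) ⊕ Fin (auxCols r l n t ω))}
    (hS : ∀ a : Fin (auxRows r l n t), (a : ℕ) ∈ blockRows l (auxRowCorner r l t) m →
      Sum.inl a ∈ S) :
    colVec (withDiag u V) (Sum.inr b) ∈ sp (colVec (withDiag u V)) S := by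
  refine mem_sp_inl hu fun a ha => ?_
  simp only [colVec, Matrix.fromCols_apply_inr]
  rw [hV a b, Int.cast_zero]
  rintro m' - ⟨h1, h2⟩
  rw [← blockCols_unique hb h2] at h1
  exact ha (hS a h1)

/-- Any choice of as many vectors as there are rows from the rows and columns of a block spans the
space of the rows. -/
theorem sp_block_le (hu : ∀ a, u a ≠ 0)
    (hV : IsLinkedBlock n l (auxRowCorner r l t) (auxColCorner r l t ω) V) {m : ℕ}
    (hT : IsTotallyNonsingular (block l (auxRowCorner r l t) (auxColCorner r l t ω) V m))
    {B S : Finset (Fin (auxRows r l n t) ⊕ Fin (auxCols r l n t ω))}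
    (hB : ∀ a : Fin (auxRows r l n t), Sum.inl a ∈ B ↔
      (a : ℕ) ∈ blockRows l (auxRowCorner r l t) m) (hB' : B.toRight = ∅)
    (hSl : S.toLeft ⊆ B.toLeft)
    (hSr : ∀ b ∈ S.toRight, (b : ℕ) ∈ blockCols (auxColCorner r l t ω) m)
    (hc : S.card = B.card) :
    sp (colVec (withDiag u V)) B ≤ sp (colVec (withDiag u V)) S := by
  have hcB := Finset.card_toLeft_add_card_toRight (u := B)
  rw [hB', Finset.card_empty, add_zero] at hcB
  have hi := linearIndepOn_block hu hT (B := B.toLeft)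
    (fun a ha => (hB a).1 (Finset.mem_toLeft.1 ha)) hSl hSr (by omega)
  have h1 := freeMod_of_linearIndepOn hi
  have h2 : sp (colVec (withDiag u V)) S ≤ sp (colVec (withDiag u V)) B := by
    rw [sp_le_iff]
    rintro (a | b) he
    · exact mem_sp (Finset.mem_toLeft.1 (hSl (Finset.mem_toLeft.2 he)))
    · exact colVec_mem_block hu hV (hSr b (Finset.mem_toRight.2 he)) fun a ha => (hB a).2 ha
  refine (Submodule.eq_of_le_of_finrank_le h2 ?_).ge
  have h3 := finrank_sp_le (colVec (withDiag u V)) B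
  unfold FreeMod at h1
  rw [bot_sup_eq, finrank_bot, zero_add] at h1
  omega

theorem auxLinks_good (hr : 2 * l ≤ r) (ht : l ≤ t) (hu : ∀ a, u a ≠ 0)
    (hV : IsLinkedBlock n l (auxRowCorner r l t) (auxColCorner r l t ω) V)
    (hT : ∀ m < n, IsTotallyNonsingular
      (block l (auxRowCorner r l t) (auxColCorner r l t ω) V m)) :
    Good (auxLinks r l n t ω hr ht) (colVec (withDiag u V)) where
  free m hm := by
    refine freeMod_of_linearIndepOn (linearIndepOn_inl hu ?_)
    ext b
    simp [auxLinks]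
  spans m hm S hS hSc := by
    have h0 := auxRowCorner_succ r l t m
    have h1 : (auxLinks r l n t ω hr ht).L m ∪ ((auxLinks r l n t ω hr ht).X (m + 1) ∪
        (auxLinks r l n t ω hr ht).L (m + 1)) =
        rowsIn _ _ (auxRowCorner r l t m - l) (auxRowCorner r l t (m + 1)) := by
      ext (i | j) <;> simp [auxLinks]; omega
    rw [h1]
    refine sp_block_le hu hV (hT _ hm) (by simp [blockRows]) ?_ ?_ ?_ ?_
    · ext b; simp
    · intro a ha
      have := hS (Finset.mem_toLeft.1 ha)
      rw [Finset.mem_toLeft, ← h1]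
      simp [auxLinks] at this ⊢
      exact this
    · intro b hb
      have := hS (Finset.mem_toRight.1 hb)
      simpa [auxLinks, blockCols] using this
    · rw [hSc, card_rowsIn (auxRowCorner_le hm)]
      have : l ≤ auxRowCorner r l t m := by unfold auxRowCorner; omega
      omega
  cols m hm e he := by
    rcases e with a | b
    · simp [auxLinks] at he
    · have h0 := auxRowCorner_succ r l t m
      refine colVec_mem_block hu hV (m := m + 1) (by simpa [auxLinks, blockCols] using he) ?_
      intro a ha
      simp [auxLinks, blockRows] at ha ⊢
      omega

/-- Start of the reduction: nothing is contracted, and the `t - l + ω` columns of the first block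
exceed its `t - l` own rows by `ω`. -/
theorem blk_zero (hr : 2 * l ≤ r) (ht : l ≤ t) (hn : 1 ≤ n) (hu : ∀ a, u a ≠ 0)
    (hV : IsLinkedBlock n l (auxRowCorner r l t) (auxColCorner r l t ω) V)
    (hT : ∀ m < n, IsTotallyNonsingular
      (block l (auxRowCorner r l t) (auxColCorner r l t ω) V m)) :
    Blk (auxLinks r l n t ω hr ht) 0 (t - l) 0 ω (colVec (withDiag u V)) kind ⊥ := by
  have hR := auxRowCorner_le (r := r) (l := l) (t := t) (show 0 < n by omega)
  have hC := auxColCorner_le (r := r) (l := l) (t := t) (ω := ω) (show 0 < n by omega)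
  have hR0 : auxRowCorner r l t 0 = t := by simp [auxRowCorner]
  have hC0 : auxColCorner r l t ω 0 = t - l + ω := by simp [auxColCorner]
  rw [hR0] at hR
  rw [hC0] at hC
  have hg := auxLinks_good hr ht hu hV hT
  have hfin := (hg.finrank_H (show 0 < n by omega)).1
  have hbelow : (auxLinks r l n t ω hr ht).below 0 = rowsIn _ _ 0 t := by
    simp [auxLinks, hR0]
  refine ⟨rowsIn _ _ 0 (t - l), colsIn _ _ 0 (t - l + ω), ?_, ?_, hg, ?_, ?_, ?_, bot_le, ?_,
    ?_, ?_⟩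
  · rw [card_rowsIn (by omega)]; omega
  · rw [card_colsIn (by omega)]; omega
  · rw [Finset.disjoint_left]
    rintro (i | j) h h' <;> simp [auxLinks, hR0] at h h'
    omega
  · rw [Finset.disjoint_left]
    rintro (i | j) h h' <;> simp [auxLinks, hC0] at h h'
    omega
  · rintro (i | j)
    · have : (i : ℕ) < t - l ∨ t ≤ (i : ℕ) + l ∧ (i : ℕ) < t ∨ t ≤ (i : ℕ) := by omega
      simpa [kind, auxLinks, hR0] using this
    · have : (j : ℕ) < t - l + ω ∨ t - l + ω ≤ (j : ℕ) := by omega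
      simpa [kind, auxLinks, hC0] using this
  · rintro (a | b) he
    · refine mem_sp ?_
      simp [auxLinks, hR0] at he ⊢
      omega
    · refine colVec_mem_block hu hV (m := 0) ?_ ?_
      · simpa [auxLinks, blockCols, hC0] using he
      · intro a ha
        simpa [auxLinks, blockRows] using ha
  · rw [finrank_bot, hfin, hbelow, card_rowsIn hR]
    omega
  · intro S hS hSc
    rw [bot_sup_eq, Links.H]
    refine sp_block_le hu hV (hT 0 (by omega)) ?_ ?_ ?_ ?_ ?_
    · simp [auxLinks, blockRows]
    · ext b; simp [auxLinks]
    · intro a ha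
      have := hS (Finset.mem_toLeft.1 ha)
      simp [auxLinks, hR0] at this ⊢
      omega
    · intro b hb
      have := hS (Finset.mem_toRight.1 hb)
      simpa [auxLinks, blockCols, hC0] using this
    · rw [hSc, hbelow, card_rowsIn hR]
      omega

end Concrete

end CubicAux

/-! ### The bound for the supremum. -/

theorem proposition2p2 (r l n t ω : ℕ) (hl : 1 ≤ l) (hr : 2 * l ≤ r) (hn : 1 ≤ n)
    (ht : l ≤ t) (hω : ω ≤ l) (ε : ℝ) (hε : 0 < ε) :
    ∃ K : ℝ, ∀ P : ℕ, 1 ≤ P →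
      BddAbove (CubicAux.auxMeanValues r l n t ω P) ∧
      CubicAux.auxMeanSup r l n t ω P ≤
        K * (P : ℝ) ^
          (3 * (((n : ℝ) - 1) * ((r : ℝ) - l) + t + ω) - 2 * l + ε) := by
  -- The exponent 3(t - l + ω) + 3(n - 1)(r - l) + l is the one claimed.
  obtain ⟨c, hc, hb⟩ := CubicAux.bnd_blk (W := Fin (CubicAux.auxRows r l n t) → ℚ)
    (Λ := CubicAux.auxLinks r l n t ω hr ht) hl (n - 1) 0 (by omega) (t - l) ω hω ε hε
  have hcols : (((CubicAux.auxLinks r l n t ω hr ht).cols 0).card : ℝ) =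
      ((n : ℝ) - 1) * ((r : ℝ) - l) := by
    have : ((CubicAux.auxLinks r l n t ω hr ht).cols 0).card = (n - 1) * (r - l) := by
      simp only [CubicAux.auxLinks]
      rw [CubicAux.card_colsIn le_rfl]
      simp [CubicAux.auxCols, CubicAux.auxColCorner]
    rw [this]
    push_cast [Nat.cast_sub hn, Nat.cast_sub (show l ≤ r by omega)]
    ring
  have key : ∀ P : ℕ, 1 ≤ P → ∀ y ∈ CubicAux.auxMeanValues r l n t ω P,
      y ≤ c * (P : ℝ) ^ (3 * (((n : ℝ) - 1) * ((r : ℝ) - l) + t + ω) - 2 * l + ε) := by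
    rintro P hP y ⟨D, ⟨u, V, rfl, hu, hV, hT⟩, rfl⟩
    rw [CubicAux.meanValue_eq_cnt]
    refine (hb P hP _ _ _ (CubicAux.blk_zero hr ht hn hu hV hT)).trans (le_of_eq ?_)
    congr 2
    push_cast [Nat.cast_sub ht]
    rw [hcols]
    ring
  refine ⟨c, fun P hP => ⟨⟨_, fun y hy => key P hP y hy⟩, ?_⟩⟩
  -- Non-negativity of the bound replaces a proof that auxiliary matrices exist, as the empty
  -- supremum is `0`.
  exact Real.sSup_le (fun y hy => key P hP y hy) (by positivity)
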